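/- Let $(M,g_M)$ and $(N,g_N)$ be compact smooth Riemannian $n$-manifolds without boundary, let $\omega_M$ be the Riemannian volume of $g_M$, and let $h:M\to N$ be a diffeomorphism. For a smooth diffeomorphism $k:M\to N$ put $$\Phi_2(k)=\int_M\|k^*g_N-g_M\|^2\,\omega_M ,$$ where $\|\cdot\|$ is the norm induced by $g_M$ on covariant $2$-tensors, i.e. $\|T\|^2=g_M^{ik}g_M^{jl}T_{ij}T_{kl}$. Let $B(h)$ be the tensor field of type $(2,0)$ obtained from $h^*g_N-g_M$ by raising both indices with $g_M$. Let $\nabla$ and $\bar\nabla$ be the Levi-Civita connections on $M$ of $g_M$ and of $h^*g_N$, and let $A(h)(X,Y)=\bar\nabla_XY-\nabla_XY$. Denote by $\operatorname{div}B(h)$ and $A(h):B(h)$ the vector fields with components $\nabla_iB(h)^{ij}$ and $A(h)^j{}_{kl}B(h)^{kl}$. For every smooth vector field $Y$ on $M$ with flow $\phi_t$, the first variation of $\Phi_2$ at $h$ in the direction $Y$ is $$\frac{d}{dt}\Big|_{t=0}\Phi_2(h\circ\phi_t)=-4\int_M (h^*g_N)\big(\operatorname{div}B(h)+A(h):B(h),\,Y\big)\,\omega_M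 .$$ Moreover, $h$ is a critical point of $\Phi_2$ (that is, $\frac{d}{dt}\big|_{t=0}\Phi_2(h\circ\phi_t)=0$ for the flow $\phi_t$ of every smooth vector field on $M$) if and only if $$\operatorname{div}B(h)+A(h):B(h)=0\quad\text{on } M.$$ -/

import Mathlib

open Bundle MeasureTheory
open scoped Manifold ContDiff

noncomputable section

namespace MinimalBending

variable {n : ℕ}
variable {M : Type*} [TopologicalSpace M] [ChartedSpace (EuclideanSpace ℝ (Fin n)) M]
variable {N : Type*} [TopologicalSpace N] [ChartedSpace (EuclideanSpace ℝ (Fin n)) N]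

/-- A smooth Riemannian metric on the tangent bundle of the `n`-manifold `M`. -/
abbrev RiemMetric (n : ℕ) (M : Type*) [TopologicalSpace M]
    [ChartedSpace (EuclideanSpace ℝ (Fin n)) M] [IsManifold (𝓡 n) ∞ M] :=
  ContMDiffRiemannianMetric (𝓡 n) ∞ (EuclideanSpace ℝ (Fin n))
    (fun p : M => TangentSpace (𝓡 n) p)

/-- Covariant tensor fields of order two on `M` (no regularity is imposed). -/
abbrev TensorField02 (n : ℕ) (M : Type*) [TopologicalSpace M]
    [ChartedSpace (EuclideanSpace ℝ (Fin n)) M] :=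
  (p : M) → TangentSpace (𝓡 n) p →L[ℝ] TangentSpace (𝓡 n) p →L[ℝ] ℝ

/-- The standard basis vector `e_i` of `ℝⁿ`. -/
def stdVec (i : Fin n) : EuclideanSpace ℝ (Fin n) := EuclideanSpace.single i 1

/-- The coordinate vector field `∂/∂xⁱ` of the preferred chart at `p`, at the point of `M` whose
coordinates in that chart are `x`. -/
def coordVec (p : M) (x : EuclideanSpace ℝ (Fin n)) (i : Fin n) :
    TangentSpace (𝓡 n) ((extChartAt (𝓡 n) p).symm x) :=
  mfderiv 𝓘(ℝ, EuclideanSpace ℝ (Fin n)) (𝓡 n) (extChartAt (𝓡 n) p).symm x (stdVec i)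

/-- The components `T_{ij}(x) = T(∂/∂xⁱ, ∂/∂xʲ)` of `T` in the preferred chart at `p`. -/
def components (T : TensorField02 n M) (p : M) (x : EuclideanSpace ℝ (Fin n)) :
    Matrix (Fin n) (Fin n) ℝ :=
  Matrix.of fun i j => T ((extChartAt (𝓡 n) p).symm x) (coordVec p x i) (coordVec p x j)

/-- The components of `T` with both indices raised by means of `g`:
`T^{ij} = g^{ik} g^{jl} T_{kl}`, in the preferred chart at `p`. -/
def raised (g T : TensorField02 n M) (p : M) (x : EuclideanSpace ℝ (Fin n)) :
    Matrix (Fin n) (Fin n) ℝ :=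
  Matrix.of fun i j => ∑ k, ∑ l,
    (components g p x)⁻¹ i k * (components g p x)⁻¹ j l * components T p x k l

/-- The squared fibre norm of `T` at `p` for the fibre metric `g* ⊗ g*`:
`g^{ik} g^{jl} T_{ij} T_{kl}`. -/
def fiberNormSq (g T : TensorField02 n M) (p : M) : ℝ :=
  ∑ i, ∑ j, raised g T p (extChartAt (𝓡 n) p p) i j *
    components T p (extChartAt (𝓡 n) p p) i j

/-- The partial derivative `∂f/∂xⁱ` at `x`. -/
def partialD (f : EuclideanSpace ℝ (Fin n) → ℝ) (x : EuclideanSpace ℝ (Fin n)) (i : Fin n) : ℝ :=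
  fderiv ℝ f x (stdVec i)

/-- The Christoffel symbol `Γ^k_{ij}` at `p` of the Levi-Civita connection of `g`, in the preferred
chart at `p`: `Γ^k_{ij} = ½ g^{kl} (∂_i g_{jl} + ∂_j g_{il} - ∂_l g_{ij})`. -/
def christoffel (g : TensorField02 n M) (p : M) (k i j : Fin n) : ℝ :=
  (1 / 2) * ∑ l, (components g p (extChartAt (𝓡 n) p p))⁻¹ k l *
    (partialD (fun x => components g p x j l) (extChartAt (𝓡 n) p p) i
      + partialD (fun x => components g p x i l) (extChartAt (𝓡 n) p p) j
      - partialD (fun x => components g p x i j) (extChartAt (𝓡 n) p p) l)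

/-- The vector at `p` with the given components in the preferred chart at `p`
(the fibre `TangentSpace (𝓡 n) p` is `ℝⁿ`, identified through that chart). -/
def tangentOfComponents (p : M) (v : Fin n → ℝ) : TangentSpace (𝓡 n) p :=
  (WithLp.toLp 2 v : EuclideanSpace ℝ (Fin n))

/-- The divergence at `p`, for the Levi-Civita connection of `g`, of the tensor field of type
`(2,0)` obtained from `T` by raising its indices with `g`:
`(div T^♯)^j = ∇_i T^{ij} = ∂_i T^{ij} + Γ^i_{ik} T^{kj} + Γ^j_{ik} T^{ik}`. -/
def divRaised (g T : TensorField02 n M) (p : M) : TangentSpace (𝓡 n) p :=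
  tangentOfComponents p fun j =>
    (∑ i, partialD (fun x => raised g T p x i j) (extChartAt (𝓡 n) p p) i)
    + (∑ i, ∑ k, christoffel g p i i k * raised g T p (extChartAt (𝓡 n) p p) k j)
    + (∑ i, ∑ k, christoffel g p j i k * raised g T p (extChartAt (𝓡 n) p p) i k)

/-- The components `A^m_{kl} = Γ̄^m_{kl} - Γ^m_{kl}` at `p` of the difference tensor
`A(X, Y) = ∇̄_X Y - ∇_X Y` of the Levi-Civita connections `∇̄` of `g'` and `∇` of `g`. -/
def connDiff (g g' : TensorField02 n M) (p : M) (m k l : Fin n) : ℝ :=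
  christoffel g' p m k l - christoffel g p m k l

/-- The contraction `A : T^♯`, with components `A^m_{kl} T^{kl}`, of the difference tensor of
the Levi-Civita connections of `g'` and `g` with `T`, indices raised by `g`. -/
def connDiffContract (g g' T : TensorField02 n M) (p : M) : TangentSpace (𝓡 n) p :=
  tangentOfComponents p fun m =>
    ∑ k, ∑ l, connDiff g g' p m k l * raised g T p (extChartAt (𝓡 n) p p) k l

/-- The pull-back `h^* g`, `(h^* g)_p(u, v) = g_{h(p)}(dh u, dh v)`. -/
def pullback (h : M → N) (g : TensorField02 n N) : TensorField02 n M := fun p =>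
  (ContinuousLinearMap.precomp ℝ (mfderiv (𝓡 n) (𝓡 n) h p)).comp
    ((g (h p)).comp (mfderiv (𝓡 n) (𝓡 n) h p))

/-- Check of the formula for the pull-back. -/
theorem pullback_apply (h : M → N) (g : TensorField02 n N) (p : M)
    (u v : TangentSpace (𝓡 n) p) :
    pullback h g p u v
      = g (h p) (mfderiv (𝓡 n) (𝓡 n) h p u) (mfderiv (𝓡 n) (𝓡 n) h p v) := rfl

/-- The volume `√(det g_{ij}) dx¹⋯dxⁿ` on the domain of the preferred chart at `p`, as a measure
on `M` carried by that domain. -/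
def chartVolume [MeasurableSpace M] (g : TensorField02 n M) (p : M) : Measure M :=
  ((volume.restrict (extChartAt (𝓡 n) p).target).withDensity
    (fun x => ENNReal.ofReal √(components g p x).det)).map (extChartAt (𝓡 n) p).symm

/-- The Riemannian volume measure of `g`: the least measure dominating the volumes of all the chart
domains. (These agree on overlaps, so on each chart domain it is `√(det g_{ij}) dx¹⋯dxⁿ`.) -/
def riemannianVolume [MeasurableSpace M] (g : TensorField02 n M) : Measure M :=
  ⨆ p : M, chartVolume g p

/-- The strain tensor field `h^* g_N - g_M`. -/
def strain [IsManifold (𝓡 n) ∞ M] [IsManifold (𝓡 n) ∞ N]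
    (gM : RiemMetric n M) (gN : RiemMetric n N) (h : M → N) : TensorField02 n M :=
  fun p => pullback h gN.inner p - gM.inner p

/-- The deformation energy `Φ₂(h) = ∫_M ‖h^* g_N - g_M‖² ω_M`. -/
def deformationEnergy [MeasurableSpace M] [IsManifold (𝓡 n) ∞ M] [IsManifold (𝓡 n) ∞ N]
    (gM : RiemMetric n M) (gN : RiemMetric n N) (h : M → N) : ℝ :=
  ∫ p, fiberNormSq gM.inner (strain gM gN h) p ∂(riemannianVolume gM.inner)

/-- The vector field `div B(h) + A(h) : B(h)` on `M`, where `B(h)` is the strain tensor with its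
indices raised by `g_M`, `div` is taken with the Levi-Civita connection `∇` of `g_M`, and
`A(h) = ∇̄ - ∇` with `∇̄` the Levi-Civita connection of `h^* g_N`. -/
def eulerLagrangeField [IsManifold (𝓡 n) ∞ M] [IsManifold (𝓡 n) ∞ N]
    (gM : RiemMetric n M) (gN : RiemMetric n N) (h : M → N) (p : M) : TangentSpace (𝓡 n) p :=
  divRaised gM.inner (strain gM gN h) p
    + connDiffContract gM.inner (pullback h gN.inner) (strain gM gN h) p

/-- `Y` is a smooth vector field on `M`. -/
def IsSmoothVectorField [IsManifold (𝓡 n) ∞ M] (Y : (p : M) → TangentSpace (𝓡 n) p) : Prop :=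
  ContMDiff (𝓡 n) (𝓡 n).tangent ∞ (fun p => (⟨p, Y p⟩ : TangentBundle (𝓡 n) M))

/-- `φ` is the (smooth, global) flow of the vector field `Y`: `φ₀ = id`, and `t ↦ φ_t(p)` is an
integral curve of `Y` for each `p`. -/
structure IsFlow [IsManifold (𝓡 n) ∞ M] (Y : (p : M) → TangentSpace (𝓡 n) p)
    (φ : ℝ → M → M) : Prop where
  smooth : ContMDiff (𝓘(ℝ, ℝ).prod (𝓡 n)) (𝓡 n) ∞ (fun q : ℝ × M => φ q.1 q.2)
  zero : ∀ p, φ 0 p = p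
  integralCurve : ∀ p, IsMIntegralCurve (I := 𝓡 n) (fun t => φ t p) Y

/-- `h` is a critical point of `Φ₂`: `d/dt Φ₂(h ∘ φ_t) = 0` at `t = 0` for the flow `φ` of every
smooth vector field on `M`. -/
def IsCriticalPoint [MeasurableSpace M] [IsManifold (𝓡 n) ∞ M] [IsManifold (𝓡 n) ∞ N]
    (gM : RiemMetric n M) (gN : RiemMetric n N) (h : M → N) : Prop :=
  ∀ Y : (p : M) → TangentSpace (𝓡 n) p, IsSmoothVectorField Y →
    ∀ φ : ℝ → M → M, IsFlow Y φ →
      HasDerivAt (fun t => deformationEnergy gM gN (fun p => h (φ t p))) 0 0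

end MinimalBending

end

/-!
# The first variation of the deformation energy

Everything is reduced to a computation in one chart. Let `G` and `H` be the matrices of `g_M` and of
`h^* g_N` in a chart.

*The variation density.* Since `(h ∘ φ_t)^* g_N = φ_t^* (h^* g_N)`, the derivative at `t = 0` of the
energy density `‖(h ∘ φ_t)^* g_N - g_M‖²` is `2 ⟨h^* g_N - g_M, L_Y (h^* g_N)⟩`, with the Lie
derivative `L_Y` (`hasDerivAt_energyDensity`; the expression in a chart is `locVar`). The density is
jointly smooth in the time and the point, so it may be differentiated under the integral sign
(`hasDerivAt_deformationEnergy`).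

*Integration by parts.* In a chart, `2 ⟨H - G, L_Y H⟩ + 4 H(div B + A : B, Y)`, multiplied by
`√(det G)`, is the divergence of an explicit flux (`locVar_add_locPairing`). The integral of this
divergence vanishes when `Y` has compact support in the chart, which gives the formula for such `Y`
(`integral_locVar`, `integral_varDensity_chart`). The volume `riemannianVolume`, a supremum of the
volumes of the charts, restricts on each chart domain to `√(det G) dx`, by the change of variables
formula (`riemannianVolume_restrict_source`).

*Independence of the chart.* The vector `div B + A : B` is defined at each point through the
preferred chart there. That all charts give the same vector need not be checked with transformation
laws of Christoffel symbols: the left-hand side of the first variation formula does not depend on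
the chart, so neither does the right-hand side, and the fundamental lemma of the calculus of
variations (`eq_zero_of_integral_tensorForm_eq_zero`) shows that the two fields agree on the overlap
of two charts (`elChart_eq`). The derivative of the energy density is independent of the chart for a
similar reason, as soon as `Y` has a flow; for fields supported in a chart the flow is constructed
from a smooth flow on `ℝⁿ` (`exists_smooth_flow`, `exists_isFlow`).

*Conclusion.* A partition of unity extends the formula to all smooth vector fields
(`integral_varDensity`), and testing with fields supported in a chart shows that the Euler-Lagrange
field of a critical point vanishes.
-/

namespace MinimalBending

/-! ### Flows of compactly supported vector fields on Banach spaces -/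

open Set in
/-- A bounded Lipschitz vector field is complete, since its integral curves all exist for a time
independent of the initial point. -/
theorem exists_global_integral_curve {E : Type*} [NormedAddCommGroup E] [NormedSpace ℝ E]
    [CompleteSpace E] {f : E → E} (hf : ContDiff ℝ 1 f) (hs : HasCompactSupport f) (x : E) :
    ∃ α : ℝ → E, α 0 = x ∧ ∀ t, HasDerivAt α (f (α t)) t := by
  obtain ⟨K, hK⟩ := ContDiff.lipschitzWith_of_hasCompactSupport hs hf one_ne_zero
  obtain ⟨C, hC⟩ := hf.continuous.bounded_above_of_compact_support hs
  have hC' : ∀ x, ‖f x‖ ≤ (C.toNNReal : ℝ) := fun x => (hC x).trans (Real.le_coe_toNNReal C)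
  have hloc : ∀ x : E, ∃ γ : ℝ → E, γ 0 = x ∧
      IsMIntegralCurveOn (I := 𝓘(ℝ, E)) γ (fun y => f y) (Ioo (-1) 1) := by
    intro x
    have hPL : IsPicardLindelof (fun _ => f) (tmin := -1) (tmax := 1) ⟨0, by norm_num⟩ x
        C.toNNReal 0 C.toNNReal K :=
      ⟨fun _ _ => hK.lipschitzOnWith, fun _ _ => continuousOn_const, fun _ _ y _ => hC' y, by simp⟩
    obtain ⟨α, h0, hα⟩ := hPL.exists_eq_forall_mem_Icc_hasDerivWithinAt₀
    refine ⟨α, h0, fun t ht => ?_⟩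
    have := ((hα t (Ioo_subset_Icc_self ht)).mono Ioo_subset_Icc_self).hasFDerivWithinAt
    exact this.hasMFDerivWithinAt
  obtain ⟨γ, h0, hγ⟩ := exists_isMIntegralCurve_of_isMIntegralCurveOn (I := 𝓘(ℝ, E)) (M := E)
    (v := fun y => f y) (contMDiff_vectorSpace_iff_contDiff.2 hf) one_pos hloc x
  exact ⟨γ, h0, fun t => (hγ t).hasFDerivAt⟩

section Nemytskii

universe u

variable {K : Type*} [TopologicalSpace K] [CompactSpace K]
  {E : Type*} [NormedAddCommGroup E] [NormedSpace ℝ E]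
  {F : Type*} [NormedAddCommGroup F] [NormedSpace ℝ F]

set_option synthInstance.maxHeartbeats 200000 in
/-- Pointwise application of a continuous family of operators to a continuous family of vectors,
as a continuous bilinear map on spaces of continuous functions. -/
noncomputable def pointwiseApply (K E F : Type*) [TopologicalSpace K] [CompactSpace K]
    [NormedAddCommGroup E] [NormedSpace ℝ E] [NormedAddCommGroup F] [NormedSpace ℝ F] :
    C(K, E →L[ℝ] F) →L[ℝ] C(K, E) →L[ℝ] C(K, F) :=
  LinearMap.mkContinuous₂
    (LinearMap.mk₂ ℝ
      (fun (A : C(K, E →L[ℝ] F)) (γ : C(K, E)) =>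
        (⟨fun t => A t (γ t), A.continuous.clm_apply γ.continuous⟩ : C(K, F)))
      (fun A A' γ => by ext; simp) (fun c A γ => by ext; simp)
      (fun A γ γ' => by ext; simp) (fun c A γ => by ext; simp)) 1
    (fun A γ => by
      refine (ContinuousMap.norm_le _ (by positivity)).2 fun t => ?_
      rw [one_mul]
      exact (A t).le_of_opNorm_le_of_le (A.norm_coe_le_norm t) (γ.norm_coe_le_norm t))

/-- The superposition operator `γ ↦ f ∘ γ` of a compactly supported `C¹` map `f` is differentiable
for the supremum norm, because the derivative of `f` is uniformly continuous. -/
theorem hasFDerivAt_superposition {f : E → F} (hf : ContDiff ℝ 1 f) (hs : HasCompactSupport f)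
    (γ : C(K, E)) :
    HasFDerivAt (fun γ : C(K, E) => (⟨f, hf.continuous⟩ : C(E, F)).comp γ)
      (pointwiseApply K E F
        ((⟨fderiv ℝ f, hf.continuous_fderiv one_ne_zero⟩ : C(E, E →L[ℝ] F)).comp γ)) γ := by
  have huc : UniformContinuous (fderiv ℝ f) :=
    (hs.fderiv ℝ).uniformContinuous_of_continuous (hf.continuous_fderiv one_ne_zero)
  rw [hasFDerivAt_iff_isLittleO_nhds_zero, Asymptotics.isLittleO_iff]
  intro ε hε
  obtain ⟨δ, hδ, h⟩ := Metric.uniformContinuous_iff.1 huc ε hε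
  filter_upwards [Metric.ball_mem_nhds (0 : C(K, E)) hδ] with η hη
  rw [mem_ball_zero_iff] at hη
  refine (ContinuousMap.norm_le _ (by positivity)).2 fun t => ?_
  have key : ‖f (γ t + η t) - f (γ t) - fderiv ℝ f (γ t) (γ t + η t - γ t)‖
      ≤ ε * ‖γ t + η t - γ t‖ := by
    refine (convex_ball (γ t) δ).norm_image_sub_le_of_norm_hasFDerivWithin_le'
      (f' := fderiv ℝ f) (fun y _ =>
        (hf.differentiable one_ne_zero y).hasFDerivAt.hasFDerivWithinAt) (fun y hy => ?_)
      (Metric.mem_ball_self hδ) ?_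
    · rw [← dist_eq_norm]; exact (h hy).le
    · rw [Metric.mem_ball, dist_eq_norm, add_sub_cancel_left]
      exact (η.norm_coe_le_norm t).trans_lt hη
  rw [add_sub_cancel_left] at key
  refine le_trans key ?_
  gcongr
  exact η.norm_coe_le_norm t

set_option synthInstance.maxHeartbeats 200000 in
/-- By induction, since the derivative of the superposition operator of `f` is essentially that of
`fderiv ℝ f`. The two spaces share a universe so that the induction may pass to `E →L[ℝ] F`. -/
theorem contDiff_superposition_nat {E : Type u} [NormedAddCommGroup E] [NormedSpace ℝ E] (k : ℕ) :
    ∀ {F : Type u} [NormedAddCommGroup F] [NormedSpace ℝ F] {f : E → F} (hf : ContDiff ℝ ∞ f)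
      (_ : HasCompactSupport f),
    ContDiff ℝ k (fun γ : C(K, E) => (⟨f, hf.continuous⟩ : C(E, F)).comp γ) := by
  induction k with
  | zero =>
    intro F _ _ f hf hs
    refine contDiff_zero.2 (continuous_iff_continuousAt.2 fun γ =>
      (hasFDerivAt_superposition (hf.of_le (mod_cast le_top)) hs γ).continuousAt)
  | succ k ih =>
    intro F _ _ f hf hs
    have hd := hasFDerivAt_superposition (K := K) (hf.of_le (mod_cast le_top)) hs
    rw [Nat.cast_succ]
    refine contDiff_succ_iff_fderiv.2 ⟨fun γ => (hd γ).differentiableAt,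
      fun h => absurd h (by simp), ?_⟩
    rw [funext fun γ => (hd γ).fderiv]
    have h1 := ih (F := E →L[ℝ] F) (hf.fderiv_right (m := ∞) (by simp)) (hs.fderiv ℝ)
    have h2 : ContDiff ℝ k (pointwiseApply K E F) := ContinuousLinearMap.contDiff _
    exact h2.comp h1

theorem contDiff_superposition {E F : Type u} [NormedAddCommGroup E] [NormedSpace ℝ E]
    [NormedAddCommGroup F] [NormedSpace ℝ F] {f : E → F} (hf : ContDiff ℝ ∞ f)
    (hs : HasCompactSupport f) :
    ContDiff ℝ ∞ (fun γ : C(K, E) => (⟨f, hf.continuous⟩ : C(E, F)).comp γ) :=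
  contDiff_infty.2 fun k => contDiff_superposition_nat k hf hs

end Nemytskii

section Flow

open unitInterval intervalIntegral

variable {E : Type*} [NormedAddCommGroup E] [NormedSpace ℝ E]

/-- The primitive `t ↦ ∫₀ᵗ u` of a continuous function on the unit interval, as a continuous
linear operator. -/
noncomputable def primitiveOp (E : Type*) [NormedAddCommGroup E] [NormedSpace ℝ E] :
    C(I, E) →L[ℝ] C(I, E) :=
  LinearMap.mkContinuous
    { toFun := fun u => ⟨fun t => ∫ s in (0 : ℝ)..t, u.IccExtend zero_le_one s,
        (intervalIntegral.continuous_primitive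
          (fun a b => (u.IccExtend zero_le_one).continuous.intervalIntegrable a b) 0).comp
          continuous_subtype_val⟩
      map_add' := fun u v => by
        ext t
        exact intervalIntegral.integral_add
          ((u.IccExtend zero_le_one).continuous.intervalIntegrable _ _)
          ((v.IccExtend zero_le_one).continuous.intervalIntegrable _ _)
      map_smul' := fun c u => by
        ext t
        exact intervalIntegral.integral_smul c _ } 1
    (fun u => by
      refine (ContinuousMap.norm_le _ (by positivity)).2 fun t => ?_
      have := intervalIntegral.norm_integral_le_of_norm_le_const (a := 0) (b := (t : ℝ))
        (C := ‖u‖) (f := u.IccExtend zero_le_one) (fun s _ => u.norm_coe_le_norm _)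
      refine this.trans ?_
      rw [sub_zero, abs_of_nonneg t.2.1, one_mul]
      exact mul_le_of_le_one_right (norm_nonneg _) t.2.2)

theorem primitiveOp_apply (u : C(I, E)) (t : I) :
    primitiveOp E u t = ∫ s in (0 : ℝ)..t, u.IccExtend zero_le_one s := rfl

theorem norm_primitiveOp_le : ‖primitiveOp E‖ ≤ 1 :=
  LinearMap.mkContinuous_norm_le _ zero_le_one _

variable {f : E → E} (hf : ContDiff ℝ ∞ f)

/-- The defect `γ - x - s ∫₀ f(γ)` whose zeros are the solutions on the unit interval of
`γ' = s f(γ)`, `γ(0) = x`. -/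
noncomputable def odeDefect (hf : ContDiff ℝ ∞ f) (u : (ℝ × E) × C(I, E)) : C(I, E) :=
  u.2 - ContinuousMap.const I u.1.2
    - u.1.1 • primitiveOp E ((⟨f, hf.continuous⟩ : C(E, E)).comp u.2)

theorem contDiff_odeDefect (hs : HasCompactSupport f) : ContDiff ℝ ∞ (odeDefect hf) := by
  have h1 := contDiff_superposition (K := I) hf hs
  have h2 : ContDiff ℝ ∞ (fun x : E => ContinuousMap.const I x) :=
    ((ContinuousLinearMap.const ℝ I : E →L[ℝ] C(I, E)).contDiff)
  exact (contDiff_snd.sub (h2.comp (contDiff_snd.comp contDiff_fst))).sub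
    ((contDiff_fst.comp contDiff_fst).smul
      ((primitiveOp E).contDiff.comp (h1.comp contDiff_snd)))

set_option synthInstance.maxHeartbeats 200000 in
/-- The partial derivative of the defect in the curve is `1 - T` with `‖T‖ ≤ |s| L < 1`, so a
Neumann series inverts it. -/
theorem isInvertible_fderiv_odeDefect [CompleteSpace E] {L : NNReal} (hL : LipschitzWith L f)
    (hs : HasCompactSupport f) {s : ℝ} (hsL : |s| * L < 1) (x : E) (γ : C(I, E)) :
    (fderiv ℝ (odeDefect hf) ((s, x), γ) ∘L .inr ℝ (ℝ × E) C(I, E)).IsInvertible := by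
  set T : C(I, E) →L[ℝ] C(I, E) := s • (primitiveOp E ∘L (pointwiseApply I E E
    ((⟨fderiv ℝ f, hf.continuous_fderiv (by simp)⟩ : C(E, E →L[ℝ] E)).comp γ))) with hT
  have hTn : ‖T‖ < 1 := by
    refine lt_of_le_of_lt ?_ hsL
    refine (ContinuousLinearMap.opNorm_smul_le s _).trans ?_
    rw [Real.norm_eq_abs]
    gcongr
    refine (ContinuousLinearMap.opNorm_comp_le _ _).trans ?_
    refine (mul_le_of_le_one_left (norm_nonneg _) norm_primitiveOp_le).trans ?_
    refine ContinuousLinearMap.opNorm_le_bound _ L.2 fun η => ?_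
    refine (ContinuousMap.norm_le _ (by positivity)).2 fun t => ?_
    exact ContinuousLinearMap.le_of_opNorm_le_of_le _ (norm_fderiv_le_of_lipschitz ℝ hL)
      (η.norm_coe_le_norm t)
  have hd : fderiv ℝ (odeDefect hf) ((s, x), γ) ∘L .inr ℝ (ℝ × E) C(I, E) = 1 - T := by
    have h1 : HasFDerivAt (fun η : C(I, E) => odeDefect hf ((s, x), η)) (1 - T) γ := by
      have h2 := hasFDerivAt_superposition (K := I) (hf.of_le (mod_cast le_top)) hs γ
      have h3 := ((primitiveOp E).hasFDerivAt.comp γ h2).const_smul s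
      exact ((hasFDerivAt_id γ).sub_const (ContinuousMap.const I x)).sub h3
    have h4 := (((contDiff_odeDefect hf hs).differentiable (by simp) ((s, x), γ)).hasFDerivAt).comp
      γ (hasFDerivAt_prodMk_right (s, x) γ)
    exact h4.unique h1
  rw [hd]
  let e := ContinuousLinearEquiv.ofUnit (Units.oneSub T hTn)
  exact ⟨e, rfl⟩

theorem odeDefect_zero_unique {L : NNReal} (hL : LipschitzWith L f) {s : ℝ} (hsL : |s| * L < 1)
    {x : E} {γ γ' : C(I, E)} (h : odeDefect hf ((s, x), γ) = 0)
    (h' : odeDefect hf ((s, x), γ') = 0) : γ = γ' := by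
  set N : C(I, E) → C(I, E) := fun γ => (⟨f, hf.continuous⟩ : C(E, E)).comp γ
  have e : γ - γ' = s • primitiveOp E (N γ - N γ') := by
    have : (γ - ContinuousMap.const I x - s • primitiveOp E (N γ))
      - (γ' - ContinuousMap.const I x - s • primitiveOp E (N γ')) = 0 := by
      have h1 : γ - ContinuousMap.const I x - s • primitiveOp E (N γ) = 0 := h
      have h2 : γ' - ContinuousMap.const I x - s • primitiveOp E (N γ') = 0 := h'
      rw [h1, h2, sub_zero]
    rw [map_sub, smul_sub, ← sub_eq_zero, ← this]
    abel
  have hN : ‖N γ - N γ'‖ ≤ L * ‖γ - γ'‖ := by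
    refine (ContinuousMap.norm_le _ (by positivity)).2 fun t => ?_
    exact (hL.norm_sub_le _ _).trans
      (mul_le_mul_of_nonneg_left ((γ - γ').norm_coe_le_norm t) L.2)
  have hle : ‖γ - γ'‖ ≤ |s| * L * ‖γ - γ'‖ := by
    calc ‖γ - γ'‖ = |s| * ‖primitiveOp E (N γ - N γ')‖ := by
          conv_lhs => rw [e, norm_smul, Real.norm_eq_abs]
      _ ≤ |s| * (1 * ‖N γ - N γ'‖) := by
          gcongr; exact (primitiveOp E).le_of_opNorm_le norm_primitiveOp_le _
      _ ≤ |s| * (1 * (L * ‖γ - γ'‖)) := by gcongr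
      _ = _ := by ring
  have : ‖γ - γ'‖ = 0 := by
    by_contra hne
    have hpos : 0 < ‖γ - γ'‖ := lt_of_le_of_ne (norm_nonneg _) (Ne.symm hne)
    nlinarith
  exact sub_eq_zero.1 (norm_eq_zero.1 this)

/-- Integral curves, rescaled by `s`, are zeros of the defect. -/
theorem odeDefect_integral_curve [CompleteSpace E] {α : ℝ → E}
    (hα : ∀ t, HasDerivAt α (f (α t)) t) (s : ℝ) :
    odeDefect hf ((s, α 0), ⟨fun t : I => α (s * t),
      (continuous_iff_continuousAt.2 fun t => (hα t).continuousAt).comp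
        (continuous_const.mul continuous_subtype_val)⟩) = 0 := by
  have hαc : Continuous α := continuous_iff_continuousAt.2 fun t => (hα t).continuousAt
  ext t
  have h1 : ∫ u in (0 : ℝ)..t, s • f (α (s * u)) = α (s * t) - α (s * 0) := by
    refine integral_eq_sub_of_hasDerivAt (f := fun u => α (s * u)) (fun u _ => ?_) ?_
    · have := (hα (s * u)).scomp u ((hasDerivAt_id u).const_mul s)
      simpa [Function.comp_def] using this
    · exact Continuous.intervalIntegrable (by fun_prop (disch := exact hf.continuous)) _ _
  have h2 : ∀ u ∈ Set.uIcc (0 : ℝ) t, f (α (s * u)) = ContinuousMap.IccExtend zero_le_one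
      ((⟨f, hf.continuous⟩ : C(E, E)).comp (⟨fun t : I => α (s * t),
        hαc.comp (continuous_const.mul continuous_subtype_val)⟩ : C(I, E))) u := by
    intro u hu
    rw [Set.uIcc_of_le t.2.1] at hu
    rw [ContinuousMap.coe_IccExtend, Set.IccExtend_of_mem _ _ ⟨hu.1, hu.2.trans t.2.2⟩]
    rfl
  have h3 := intervalIntegral.integral_congr (μ := volume) h2
  simp only [odeDefect, ContinuousMap.sub_apply, ContinuousMap.smul_apply, primitiveOp_apply,
    ContinuousMap.zero_apply, ContinuousMap.const_apply]
  rw [← h3, ← intervalIntegral.integral_smul, h1]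
  simp

/-- A smooth compactly supported vector field on a Banach space has a flow that is smooth jointly
in time and space. For small times the curve `u ↦ φ(su, x)` on the unit interval is the unique zero
of `odeDefect`, to which the implicit function theorem applies; the group law gives all times. -/
theorem exists_smooth_flow [CompleteSpace E] (hf : ContDiff ℝ ∞ f)
    (hs : HasCompactSupport f) :
    ∃ φ : ℝ → E → E, ContDiff ℝ ∞ (fun q : ℝ × E => φ q.1 q.2) ∧ (∀ x, φ 0 x = x) ∧
      (∀ x t, HasDerivAt (fun t => φ t x) (f (φ t x)) t) := by
  have hf1 : ContDiff ℝ 1 f := hf.of_le (mod_cast le_top)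
  obtain ⟨L, hL⟩ := ContDiff.lipschitzWith_of_hasCompactSupport hs hf1 one_ne_zero
  choose α hα0 hα using exists_global_integral_curve hf1 hs
  have hgroup : ∀ s t x, α x (t + s) = α (α x s) t := by
    intro s t x
    have := ODE_solution_unique_univ (v := fun _ => f) (s := fun _ => Set.univ) (t₀ := 0)
      (f := fun t => α x (t + s)) (g := α (α x s)) (fun _ => hL.lipschitzOnWith)
      (fun t => ⟨(hα x (t + s)).comp_add_const t s, trivial⟩)
      (fun t => ⟨hα _ t, trivial⟩) (by simp [hα0])
    exact congrFun this t
  obtain ⟨δ, hδ, hδL⟩ : ∃ δ : ℝ, 0 < δ ∧ ∀ s : ℝ, |s| < δ → |s| * L < 1 := by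
    refine ⟨1 / (L + 1), by positivity, fun s hs => ?_⟩
    rw [lt_div_iff₀ (by positivity)] at hs
    nlinarith [abs_nonneg s]
  have hloc : ∀ s x, |s| < δ → ContDiffAt ℝ ∞ (fun q : ℝ × E => α q.2 q.1) (s, x) := by
    intro s x hsδ
    let c : ℝ × E → C(I, E) := fun q => ⟨fun t : I => α q.2 (q.1 * t),
      (continuous_iff_continuousAt.2 fun t => (hα q.2 t).continuousAt).comp
        (continuous_const.mul continuous_subtype_val)⟩
    have hc : ∀ q, odeDefect hf (q, c q) = 0 := by
      rintro ⟨s, x⟩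
      have := odeDefect_integral_curve hf (hα x) s
      rw [hα0] at this
      exact this
    have cdf : ContDiffAt ℝ ∞ (odeDefect hf) ((s, x), c (s, x)) :=
      (contDiff_odeDefect hf hs).contDiffAt
    have if₂ := isInvertible_fderiv_odeDefect hf hL hs (hδL s hsδ) x (c (s, x))
    have hψ := cdf.contDiffAt_implicitFunction (by simp) if₂
    have hev := cdf.eventually_apply_implicitFunction (by simp) if₂
    have hnear : ∀ᶠ q : ℝ × E in nhds (s, x), |q.1| < δ :=
      (continuous_fst.abs.isOpen_preimage _ isOpen_Iio).mem_nhds hsδ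
    have heq : (fun q : ℝ × E => α q.2 q.1) =ᶠ[nhds (s, x)]
        fun q => ContinuousMap.evalCLM ℝ (1 : I) (cdf.implicitFunction (by simp) if₂ q) := by
      filter_upwards [hev, hnear] with q hq hqδ
      rw [hc (s, x)] at hq
      have := odeDefect_zero_unique hf hL (hδL q.1 hqδ) hq (hc q)
      rw [this]
      simp [c]
    have hcomp : ContDiffAt ℝ ∞ (fun q => ContinuousMap.evalCLM ℝ (1 : I)
        (cdf.implicitFunction (by simp) if₂ q)) (s, x) :=
      (ContinuousMap.evalCLM (M := E) ℝ (1 : I)).contDiff.contDiffAt.comp (s, x) hψ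
    exact hcomp.congr_of_eventuallyEq heq
  -- The flow at time `k s` is the `k`-th iterate of the flow at the small time `s`.
  have hiter : ∀ (k : ℕ) s x, |s| < δ →
      ContDiffAt ℝ ∞ (fun q : ℝ × E => α q.2 (k * q.1)) (s, x) := by
    intro k s x hsδ
    induction k with
    | zero => simpa [hα0] using contDiffAt_snd
    | succ k ih =>
      have e : (fun q : ℝ × E => α q.2 ((k + 1 : ℕ) * q.1))
          = (fun q : ℝ × E => α q.2 q.1) ∘ fun q => (q.1, α q.2 (k * q.1)) := by
        ext q
        simp only [Function.comp_apply]
        rw [← hgroup]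
        congr 1
        push_cast
        ring
      rw [e]
      exact ContDiffAt.comp _ (hloc s _ hsδ) (contDiffAt_fst.prodMk ih)
  refine ⟨fun t x => α x t, contDiff_iff_contDiffAt.2 fun ⟨t, x⟩ => ?_, hα0, hα⟩
  obtain ⟨k, hk⟩ := exists_nat_gt (|t| / δ)
  have hk0 : (0 : ℝ) < k := lt_of_le_of_lt (by positivity) hk
  have hkδ : |t / k| < δ := by
    rw [abs_div, abs_of_pos hk0, div_lt_iff₀ hk0]
    rw [div_lt_iff₀ hδ] at hk
    linarith
  have h := hiter k (t / k) x hkδ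
  have e : (fun q : ℝ × E => α q.2 q.1)
      = (fun q : ℝ × E => α q.2 (k * q.1)) ∘ fun q => (q.1 / k, q.2) := by
    ext q
    simp only [Function.comp_apply]
    congr 1
    field_simp
  rw [e]
  exact ContDiffAt.comp _ h ((contDiffAt_fst.div_const _).prodMk contDiffAt_snd)

end Flow

/-! ### Calculus of matrix-valued functions -/

section MatrixCalculus

variable {n : ℕ} {X : Type*} [NormedAddCommGroup X] [NormedSpace ℝ X]

theorem contDiffAt_det {A : X → Matrix (Fin n) (Fin n) ℝ} {x : X}
    (hA : ∀ i j, ContDiffAt ℝ ∞ (fun y => A y i j) x) :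
    ContDiffAt ℝ ∞ (fun y => (A y).det) x := by
  simp only [Matrix.det_apply]
  exact ContDiffAt.sum fun σ _ => (contDiffAt_prod fun i _ => hA _ _).const_smul _

theorem contDiffAt_inv_apply {A : X → Matrix (Fin n) (Fin n) ℝ} {x : X}
    (hA : ∀ i j, ContDiffAt ℝ ∞ (fun y => A y i j) x) (hdet : (A x).det ≠ 0) (i j : Fin n) :
    ContDiffAt ℝ ∞ (fun y => (A y)⁻¹ i j) x := by
  -- Cramer's rule
  have h : (fun y => (A y)⁻¹ i j)
      = fun y => ((A y).det)⁻¹ * ((A y).updateRow j (Pi.single i 1)).det := by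
    ext y
    rw [Matrix.inv_def, Matrix.smul_apply, Matrix.adjugate_apply, Ring.inverse_eq_inv', smul_eq_mul]
  rw [h]
  refine ((contDiffAt_det hA).inv hdet).mul (contDiffAt_det fun k l => ?_)
  by_cases hk : k = j
  · subst hk; simp only [Matrix.updateRow_self]; exact contDiffAt_const
  · simp only [Matrix.updateRow_ne hk]; exact hA k l

/-- Jacobi's formula for the derivative of the determinant, at an invertible matrix. -/
theorem fderiv_det_apply {A : X → Matrix (Fin n) (Fin n) ℝ} {x : X}
    (hA : ∀ i j, DifferentiableAt ℝ (fun y => A y i j) x) (hdet : (A x).det ≠ 0) (v : X) :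
    fderiv ℝ (fun y => (A y).det) x v
      = (A x).det * ∑ i, ∑ l, (A x)⁻¹ i l * fderiv ℝ (fun y => A y l i) x v := by
  set F : (Fin n → Fin n → ℝ) → ℝ := fun B => (Matrix.of B).det with hF
  set a : Fin n → Fin n → ℝ := fun i j => A x i j with ha
  have hFd : DifferentiableAt ℝ F a := by
    have : ContDiffAt ℝ ∞ F a := contDiffAt_det (A := fun B => Matrix.of B) fun i j => by
      simp only [Matrix.of_apply]
      fun_prop
    exact this.differentiableAt (by simp)
  -- Along a line, `det (A + r Z) = det A * det (1 + r A⁻¹ Z)`.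
  have hline : ∀ Z : Fin n → Fin n → ℝ,
      fderiv ℝ F a Z = (A x).det * ((A x)⁻¹ * Matrix.of Z).trace := by
    intro Z
    have h1 : HasDerivAt (fun r : ℝ => F (a + r • Z)) (fderiv ℝ F a Z) 0 := by
      have hl : HasDerivAt (fun r : ℝ => a + r • Z) Z 0 := by
        simpa using ((hasDerivAt_id (0 : ℝ)).smul_const Z).const_add a
      have hFd' : HasFDerivAt F (fderiv ℝ F a) (a + (0 : ℝ) • Z) := by
        simpa using hFd.hasFDerivAt
      exact hFd'.comp_hasDerivAt _ hl
    have h2 : (fun r : ℝ => F (a + r • Z)) = fun r =>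
        (A x).det * (1 + ((A x)⁻¹ * Matrix.of Z).trace * r + (Polynomial.eval r
          (Matrix.det (1 + (Polynomial.X : Polynomial ℝ) •
            ((A x)⁻¹ * Matrix.of Z).map Polynomial.C)).divX.divX) * r ^ 2) := by
      ext r
      rw [← Matrix.det_one_add_smul, ← Matrix.det_mul, mul_add, mul_one, Matrix.mul_smul,
        Matrix.mul_nonsing_inv_cancel_left _ _ (isUnit_iff_ne_zero.2 hdet)]
      rfl
    rw [h2] at h1
    refine h1.unique ?_
    set p := (Matrix.det (1 + (Polynomial.X : Polynomial ℝ) •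
            ((A x)⁻¹ * Matrix.of Z).map Polynomial.C)).divX.divX
    have h3 := (((hasDerivAt_id (0 : ℝ)).const_mul ((A x)⁻¹ * Matrix.of Z).trace).const_add 1).add
      ((p.hasDerivAt 0).mul ((hasDerivAt_id (0 : ℝ)).pow 2))
    have h4 := h3.const_mul (A x).det
    convert! h4 using 1
    simp
  have hAd : HasFDerivAt (fun y => fun i j => A y i j)
      (ContinuousLinearMap.pi fun i => ContinuousLinearMap.pi fun j =>
        fderiv ℝ (fun y => A y i j) x) x :=
    hasFDerivAt_pi.2 fun i => hasFDerivAt_pi.2 fun j => (hA i j).hasFDerivAt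
  have hcomp : HasFDerivAt (F ∘ fun y => fun i j => A y i j) _ x := hFd.hasFDerivAt.comp x hAd
  change fderiv ℝ (F ∘ fun y => fun i j => A y i j) x v = _
  rw [hcomp.fderiv, ContinuousLinearMap.comp_apply, hline]
  simp [Matrix.trace, Matrix.mul_apply]

end MatrixCalculus

/-! ### Riemannian metrics on open subsets of Euclidean space -/

section Local

variable {n : ℕ}

local notation "𝔼" => EuclideanSpace ℝ (Fin n)

/-- `G` is a matrix-valued function on `ℝⁿ`, smooth with positive determinant on `U` and
symmetric everywhere. Of positive definiteness only the sign of the determinant is needed: it makes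
`G` invertible and `√(det G)` smooth. -/
structure IsMetricOn (G : EuclideanSpace ℝ (Fin n) → Matrix (Fin n) (Fin n) ℝ)
    (U : Set (EuclideanSpace ℝ (Fin n))) : Prop where
  smooth : ∀ x ∈ U, ∀ i j, ContDiffAt ℝ ∞ (fun y => G y i j) x
  symm : ∀ x i j, G x i j = G x j i
  det_pos : ∀ x ∈ U, 0 < (G x).det

/-- `T` with both indices raised by means of the inverse of `G`. -/
noncomputable def locRaised (G T : Matrix (Fin n) (Fin n) ℝ) : Matrix (Fin n) (Fin n) ℝ :=
  Matrix.of fun i j => ∑ k, ∑ l, G⁻¹ i k * G⁻¹ j l * T k l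

/-- The squared norm of the bilinear form `T` with respect to the inner product `G`. -/
noncomputable def locNormSq (G T : Matrix (Fin n) (Fin n) ℝ) : ℝ :=
  ∑ i, ∑ j, locRaised G T i j * T i j

/-- The Christoffel symbols `Γ^k_{ij}` of `G`. -/
noncomputable def locChristoffel (G : 𝔼 → Matrix (Fin n) (Fin n) ℝ) (x : 𝔼) (k i j : Fin n) : ℝ :=
  (1 / 2) * ∑ l, (G x)⁻¹ k l * (partialD (fun y => G y j l) x i + partialD (fun y => G y i l) x j
      - partialD (fun y => G y i j) x l)

/-- The components of `div B + A : B`, where `B` is `H - G` with indices raised by `G`, the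
divergence is that of `G`, and `A` is the difference of the connections of `H` and `G`. -/
noncomputable def locEL (G H : 𝔼 → Matrix (Fin n) (Fin n) ℝ) (x : 𝔼) (j : Fin n) : ℝ :=
  (∑ i, partialD (fun y => locRaised (G y) (H y - G y) i j) x i)
    + (∑ i, ∑ k, locChristoffel G x i i k * locRaised (G x) (H x - G x) k j)
    + (∑ i, ∑ k, locChristoffel G x j i k * locRaised (G x) (H x - G x) i k)
    + ∑ k, ∑ l, (locChristoffel H x j k l - locChristoffel G x j k l)
        * locRaised (G x) (H x - G x) k l

/-- The components of the Lie derivative `L_Y H`. -/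
noncomputable def locLie (H : 𝔼 → Matrix (Fin n) (Fin n) ℝ) (Y : 𝔼 → 𝔼) (x : 𝔼) (i j : Fin n) : ℝ :=
  (∑ m, Y x m * partialD (fun y => H y i j) x m)
    + (∑ k, H x k j * partialD (fun y => Y y k) x i)
    + ∑ k, H x i k * partialD (fun y => Y y k) x j

/-- The density `2 ⟨H - G, L_Y H⟩` of the first variation. -/
noncomputable def locVar (G H : 𝔼 → Matrix (Fin n) (Fin n) ℝ) (Y : 𝔼 → 𝔼) (x : 𝔼) : ℝ :=
  2 * ∑ i, ∑ j, locRaised (G x) (H x - G x) i j * locLie H Y x i j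

/-- The inner product `H(EL, Y)` of the Euler-Lagrange field with `Y`. -/
noncomputable def locPairing (G H : 𝔼 → Matrix (Fin n) (Fin n) ℝ) (Y : 𝔼 → 𝔼) (x : 𝔼) : ℝ :=
  ∑ j, ∑ m, H x j m * locEL G H x j * Y x m

theorem inv_symm_of_symm {A : Matrix (Fin n) (Fin n) ℝ} (h : ∀ i j, A i j = A j i) (i j : Fin n) :
    A⁻¹ i j = A⁻¹ j i := by
  have hA : A.transpose = A := by ext i j; exact h j i
  conv_lhs => rw [← hA, ← Matrix.transpose_nonsing_inv]
  rfl

theorem locRaised_symm (G : Matrix (Fin n) (Fin n) ℝ) {T : Matrix (Fin n) (Fin n) ℝ}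
    (h : ∀ i j, T i j = T j i) (i j : Fin n) : locRaised G T i j = locRaised G T j i := by
  simp only [locRaised, Matrix.of_apply]
  rw [Finset.sum_comm]
  refine Finset.sum_congr rfl fun k _ => Finset.sum_congr rfl fun l _ => ?_
  rw [h l k]; ring

theorem contDiffAt_locRaised {X : Type*} [NormedAddCommGroup X] [NormedSpace ℝ X]
    {A T : X → Matrix (Fin n) (Fin n) ℝ} {x : X}
    (hA : ∀ i j, ContDiffAt ℝ ∞ (fun y => A y i j) x) (hdet : (A x).det ≠ 0)
    (hT : ∀ i j, ContDiffAt ℝ ∞ (fun y => T y i j) x) (i j : Fin n) :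
    ContDiffAt ℝ ∞ (fun y => locRaised (A y) (T y) i j) x := by
  simp only [locRaised, Matrix.of_apply]
  exact ContDiffAt.sum fun k _ => ContDiffAt.sum fun l _ =>
    ((contDiffAt_inv_apply hA hdet i k).mul (contDiffAt_inv_apply hA hdet j l)).mul (hT k l)

theorem contDiffAt_locNormSq {X : Type*} [NormedAddCommGroup X] [NormedSpace ℝ X]
    {A T : X → Matrix (Fin n) (Fin n) ℝ} {x : X}
    (hA : ∀ i j, ContDiffAt ℝ ∞ (fun y => A y i j) x) (hdet : (A x).det ≠ 0)
    (hT : ∀ i j, ContDiffAt ℝ ∞ (fun y => T y i j) x) :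
    ContDiffAt ℝ ∞ (fun y => locNormSq (A y) (T y)) x :=
  ContDiffAt.sum fun i _ => ContDiffAt.sum fun j _ =>
    (contDiffAt_locRaised hA hdet hT i j).mul (hT i j)

theorem sum_comm_pairs (f : Fin n → Fin n → Fin n → Fin n → ℝ) :
    ∑ i, ∑ j, ∑ k, ∑ l, f i j k l = ∑ i, ∑ j, ∑ k, ∑ l, f k l i j := by
  have := Finset.sum_comm (s := (Finset.univ : Finset (Fin n × Fin n)))
    (t := (Finset.univ : Finset (Fin n × Fin n))) (f := fun p q => f p.1 p.2 q.1 q.2)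
  simpa only [Fintype.sum_prod_type] using this

/-- The derivative of `‖T‖²` is `2 ⟨T, T'⟩`, as `G` and hence `G⁻¹` is symmetric. -/
theorem hasDerivAt_locNormSq {G : Matrix (Fin n) (Fin n) ℝ} (hG : ∀ i j, G i j = G j i)
    {T : ℝ → Matrix (Fin n) (Fin n) ℝ} {T' : Fin n → Fin n → ℝ} {t : ℝ}
    (hT : ∀ i j, HasDerivAt (fun s => T s i j) (T' i j) t) :
    HasDerivAt (fun s => locNormSq G (T s)) (2 * ∑ i, ∑ j, locRaised G (T t) i j * T' i j) t := by
  have hR : ∀ i j, HasDerivAt (fun s => locRaised G (T s) i j)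
      (∑ k, ∑ l, G⁻¹ i k * G⁻¹ j l * T' k l) t := by
    intro i j
    simp only [locRaised, Matrix.of_apply]
    exact HasDerivAt.fun_sum fun k _ => HasDerivAt.fun_sum fun l _ => (hT k l).const_mul _
  have h : HasDerivAt (fun s => locNormSq G (T s)) (∑ i, ∑ j,
      ((∑ k, ∑ l, G⁻¹ i k * G⁻¹ j l * T' k l) * T t i j + locRaised G (T t) i j * T' i j)) t :=
    HasDerivAt.fun_sum fun i _ => HasDerivAt.fun_sum fun j _ => (hR i j).mul (hT i j)
  convert! h using 1
  simp only [Finset.sum_add_distrib]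
  have : ∑ i, ∑ j, (∑ k, ∑ l, G⁻¹ i k * G⁻¹ j l * T' k l) * T t i j
      = ∑ i, ∑ j, locRaised G (T t) i j * T' i j := by
    simp only [locRaised, Matrix.of_apply, Finset.sum_mul]
    rw [sum_comm_pairs]
    refine Finset.sum_congr rfl fun i _ => Finset.sum_congr rfl fun j _ =>
      Finset.sum_congr rfl fun k _ => Finset.sum_congr rfl fun l _ => ?_
    rw [inv_symm_of_symm hG k i, inv_symm_of_symm hG l j]; ring
  rw [this, two_mul]

variable {G H : EuclideanSpace ℝ (Fin n) → Matrix (Fin n) (Fin n) ℝ}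
  {U : Set (EuclideanSpace ℝ (Fin n))}

theorem partialD_symm (hH : ∀ x i j, H x i j = H x j i) (x : 𝔼) (a i j : Fin n) :
    partialD (fun y => H y i j) x a = partialD (fun y => H y j i) x a := by
  simp_rw [fun y => hH y i j]

theorem contDiffAt_partialD {f : 𝔼 → ℝ} {x : 𝔼} (hf : ContDiffAt ℝ ∞ f x) (i : Fin n) :
    ContDiffAt ℝ ∞ (fun y => partialD f y i) x :=
  (hf.fderiv_right (m := ∞) (by simp)).clm_apply contDiffAt_const

theorem partialD_eq_zero_of_notMem_tsupport {f : 𝔼 → ℝ} {x : 𝔼} (hx : x ∉ tsupport f)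
    (i : Fin n) : partialD f x i = 0 := by
  have : fderiv ℝ f x = 0 := by
    by_contra h
    exact hx (support_fderiv_subset ℝ h)
  simp [partialD, this]

theorem IsMetricOn.contDiffAt_christoffel (hG : IsMetricOn G U) {x : 𝔼} (hx : x ∈ U)
    (k i j : Fin n) : ContDiffAt ℝ ∞ (fun y => locChristoffel G y k i j) x :=
  contDiffAt_const.mul (ContDiffAt.sum fun l _ =>
    (contDiffAt_inv_apply (hG.smooth x hx) (hG.det_pos x hx).ne' k l).mul
      (((contDiffAt_partialD (hG.smooth x hx j l) i).add
        (contDiffAt_partialD (hG.smooth x hx i l) j)).sub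
        (contDiffAt_partialD (hG.smooth x hx i j) l)))

theorem contDiffAt_locRaised_sub (hG : IsMetricOn G U) (hH : IsMetricOn H U) {x : 𝔼} (hx : x ∈ U)
    (i j : Fin n) : ContDiffAt ℝ ∞ (fun y => locRaised (G y) (H y - G y) i j) x :=
  contDiffAt_locRaised (hG.smooth x hx) (hG.det_pos x hx).ne'
    (fun i j => (hH.smooth x hx i j).sub (hG.smooth x hx i j)) i j

theorem contDiffAt_locEL (hG : IsMetricOn G U) (hH : IsMetricOn H U) {x : 𝔼} (hx : x ∈ U)
    (j : Fin n) : ContDiffAt ℝ ∞ (fun y => locEL G H y j) x := by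
  have hR := contDiffAt_locRaised_sub hG hH hx
  refine (((ContDiffAt.sum fun i _ => contDiffAt_partialD (hR i j) i).add
    (ContDiffAt.sum fun i _ => ContDiffAt.sum fun k _ => ?_)).add
    (ContDiffAt.sum fun i _ => ContDiffAt.sum fun k _ => ?_)).add
    (ContDiffAt.sum fun i _ => ContDiffAt.sum fun k _ => ?_)
  · exact (hG.contDiffAt_christoffel hx _ _ _).mul (hR _ _)
  · exact (hG.contDiffAt_christoffel hx _ _ _).mul (hR _ _)
  · exact ((hH.contDiffAt_christoffel hx _ _ _).sub (hG.contDiffAt_christoffel hx _ _ _)).mul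
      (hR _ _)

theorem IsMetricOn.contDiffAt_sqrt_det (hG : IsMetricOn G U) {x : 𝔼} (hx : x ∈ U) :
    ContDiffAt ℝ ∞ (fun y => √(G y).det) x :=
  (contDiffAt_det (hG.smooth x hx)).sqrt (hG.det_pos x hx).ne'

/-- The derivative of the volume density is the contracted Christoffel symbol:
`∂_k √(det G) = √(det G) Γ^i_{ik}`. -/
theorem IsMetricOn.partialD_sqrt_det (hG : IsMetricOn G U) {x : 𝔼} (hx : x ∈ U) (k : Fin n) :
    partialD (fun y => √(G y).det) x k = √(G x).det * ∑ i, locChristoffel G x i i k := by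
  have hd := hG.det_pos x hx
  have hdd : DifferentiableAt ℝ (fun y => (G y).det) x :=
    (contDiffAt_det (hG.smooth x hx)).differentiableAt (by simp)
  have h1 : ∑ i, locChristoffel G x i i k
      = (1 / 2) * ∑ i, ∑ l, (G x)⁻¹ i l * partialD (fun y => G y l i) x k := by
    simp only [locChristoffel, ← Finset.mul_sum]
    congr 1
    simp only [mul_sub, mul_add, Finset.sum_sub_distrib, Finset.sum_add_distrib]
    have h2 : ∑ i, ∑ l, (G x)⁻¹ i l * partialD (fun y => G y k l) x i
        = ∑ i, ∑ l, (G x)⁻¹ i l * partialD (fun y => G y i k) x l := by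
      rw [Finset.sum_comm]
      refine Finset.sum_congr rfl fun i _ => Finset.sum_congr rfl fun l _ => ?_
      rw [inv_symm_of_symm (hG.symm x) l i, partialD_symm hG.symm x l k i]
    rw [h2, add_sub_cancel_left]
    refine Finset.sum_congr rfl fun i _ => Finset.sum_congr rfl fun l _ => ?_
    rw [partialD_symm hG.symm x k i l]
  rw [h1, partialD, fderiv_sqrt hdd hd.ne', _root_.smul_apply, smul_eq_mul,
    fderiv_det_apply (fun i j => (hG.smooth x hx i j).differentiableAt (by simp)) hd.ne']
  have hs : √(G x).det * √(G x).det = (G x).det := Real.mul_self_sqrt hd.le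
  have hs0 : √(G x).det ≠ 0 := (Real.sqrt_pos.2 hd).ne'
  change 1 / (2 * √(G x).det) * ((G x).det *
    ∑ i, ∑ l, (G x)⁻¹ i l * partialD (fun y => G y l i) x k) = _
  generalize ∑ i, ∑ l, (G x)⁻¹ i l * partialD (fun y => G y l i) x k = c
  nth_rewrite 2 [← hs]
  field_simp

/-- Lowering the upper index of the Christoffel symbols. -/
theorem IsMetricOn.lower_christoffel (hH : IsMetricOn H U) {x : 𝔼} (hx : x ∈ U) (m k l : Fin n) :
    ∑ j, H x j m * locChristoffel H x j k l = (1 / 2) * (partialD (fun y => H y l m) x k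
      + partialD (fun y => H y k m) x l - partialD (fun y => H y k l) x m) := by
  set c : Fin n → ℝ := fun r => partialD (fun y => H y l r) x k
      + partialD (fun y => H y k r) x l - partialD (fun y => H y k l) x r
  have h : H x * (H x)⁻¹ = 1 :=
    Matrix.mul_nonsing_inv _ (isUnit_iff_ne_zero.2 (hH.det_pos x hx).ne')
  have h2 : (H x).mulVec ((H x)⁻¹.mulVec c) m = c m := by
    rw [Matrix.mulVec_mulVec, h, Matrix.one_mulVec]
  change _ = 1 / 2 * c m
  rw [← h2, Matrix.mulVec, dotProduct, Finset.mul_sum]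
  refine Finset.sum_congr rfl fun j _ => ?_
  rw [hH.symm x j m]
  change _ * (1 / 2 * (H x)⁻¹.mulVec c j) = _
  ring

end Local

/-! ### The integration by parts in a chart -/

section LocalIntegration

variable {n : ℕ}

local notation "𝔼" => EuclideanSpace ℝ (Fin n)

variable {G H : EuclideanSpace ℝ (Fin n) → Matrix (Fin n) (Fin n) ℝ}
  {U : Set (EuclideanSpace ℝ (Fin n))}

/-- The component `√(det G) B^{ij} H_{jm} Y^m` of the vector density whose divergence relates
`locVar` to `locPairing`. -/
noncomputable def locFlux (G H : 𝔼 → Matrix (Fin n) (Fin n) ℝ) (Y : 𝔼 → 𝔼) (i : Fin n) (x : 𝔼) :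
    ℝ :=
  √(G x).det * ∑ j, ∑ m, locRaised (G x) (H x - G x) i j * (H x j m * Y x m)

theorem contDiffAt_locFlux (hG : IsMetricOn G U) (hH : IsMetricOn H U) {Y : 𝔼 → 𝔼} {x : 𝔼}
    (hx : x ∈ U) (hY : ContDiffAt ℝ ∞ Y x) (i : Fin n) : ContDiffAt ℝ ∞ (locFlux G H Y i) x :=
  (hG.contDiffAt_sqrt_det hx).mul (ContDiffAt.sum fun j _ => ContDiffAt.sum fun m _ =>
    (contDiffAt_locRaised_sub hG hH hx i j).mul ((hH.smooth x hx j m).mul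
      (contDiffAt_euclidean.1 hY m)))

theorem partialD_mul {f g : 𝔼 → ℝ} {x : 𝔼} (hf : DifferentiableAt ℝ f x)
    (hg : DifferentiableAt ℝ g x) (a : Fin n) :
    partialD (fun y => f y * g y) x a = f x * partialD g x a + partialD f x a * g x := by
  rw [partialD, fderiv_fun_mul hf hg]
  simp only [_root_.add_apply, _root_.smul_apply, smul_eq_mul, partialD]
  ring

theorem partialD_sum {ι : Type*} [Fintype ι] {f : ι → 𝔼 → ℝ} {x : 𝔼}
    (hf : ∀ i, DifferentiableAt ℝ (f i) x) (a : Fin n) :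
    partialD (fun y => ∑ i, f i y) x a = ∑ i, partialD (f i) x a := by
  rw [partialD, fderiv_fun_sum fun i _ => hf i, _root_.sum_apply]
  rfl

theorem partialD_locFlux (hG : IsMetricOn G U) (hH : IsMetricOn H U) {Y : 𝔼 → 𝔼} {x : 𝔼}
    (hx : x ∈ U) (hY : ContDiffAt ℝ ∞ Y x) (i a : Fin n) :
    partialD (locFlux G H Y i) x a = √(G x).det * ∑ j, ∑ m,
      ((∑ r, locChristoffel G x r r a) * (locRaised (G x) (H x - G x) i j * (H x j m * Y x m))
      + partialD (fun y => locRaised (G y) (H y - G y) i j) x a * (H x j m * Y x m)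
      + locRaised (G x) (H x - G x) i j * partialD (fun y => H y j m) x a * Y x m
      + locRaised (G x) (H x - G x) i j * H x j m * partialD (fun y => Y y m) x a) := by
  have d : ∀ {f : 𝔼 → ℝ}, ContDiffAt ℝ ∞ f x → DifferentiableAt ℝ f x := fun h =>
    h.differentiableAt (by simp)
  have hR := fun j => d (contDiffAt_locRaised_sub hG hH hx i j)
  have hHd := fun j m => d (hH.smooth x hx j m)
  have hYd := fun m => d (contDiffAt_euclidean.1 hY m)
  have hHY : ∀ j m, DifferentiableAt ℝ (fun y => H y j m * Y y m) x := fun j m =>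
    (hHd j m).fun_mul (hYd m)
  have hT : ∀ j m, DifferentiableAt ℝ
      (fun y => locRaised (G y) (H y - G y) i j * (H y j m * Y y m)) x := fun j m =>
    (hR j).fun_mul (hHY j m)
  have hS : ∀ j, DifferentiableAt ℝ
      (fun y => ∑ m, locRaised (G y) (H y - G y) i j * (H y j m * Y y m)) x := fun j =>
    DifferentiableAt.fun_sum fun m _ => hT j m
  unfold locFlux
  rw [partialD_mul (d (hG.contDiffAt_sqrt_det hx)) (DifferentiableAt.fun_sum fun j _ => hS j),
    partialD_sum hS, hG.partialD_sqrt_det hx a, mul_assoc, ← mul_add, Finset.mul_sum,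
    ← Finset.sum_add_distrib]
  congr 1
  refine Finset.sum_congr rfl fun j _ => ?_
  rw [partialD_sum (hT j), Finset.mul_sum, ← Finset.sum_add_distrib]
  refine Finset.sum_congr rfl fun m _ => ?_
  rw [partialD_mul (hR j) (hHY j m), partialD_mul (hHd j m) (hYd m)]
  ring

/-- The algebraic identity on which the integration by parts rests, at one point. Here `dB a`, `dH a`
and `dY a` stand for the partial derivatives in the direction `a`, `γ` for the contracted Christoffel
symbols of `G`, and `Γ` for the Christoffel symbols of `H`, known through their lowered form `hΓ`. -/
theorem variation_identity (B H : Fin n → Fin n → ℝ) (dB dH : Fin n → Fin n → Fin n → ℝ)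
    (Y : Fin n → ℝ) (dY : Fin n → Fin n → ℝ) (γ : Fin n → ℝ) (Γ : Fin n → Fin n → Fin n → ℝ)
    (hB : ∀ i j, B i j = B j i) (hH : ∀ i j, H i j = H j i)
    (hΓ : ∀ m k l, ∑ j, H j m * Γ j k l = (1 / 2) * (dH k l m + dH l k m - dH m k l)) :
    (2 * ∑ i, ∑ j, B i j *
        (∑ m, Y m * dH m i j + ∑ k, H k j * dY i k + ∑ k, H i k * dY j k))
      + 4 * ∑ j, ∑ m, H j m * (∑ i, dB i i j + ∑ k, γ k * B k j + ∑ k, ∑ l, Γ j k l * B k l) * Y m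
      = 4 * ∑ i, ∑ j, ∑ m, (γ i * (B i j * (H j m * Y m)) + dB i i j * (H j m * Y m)
          + B i j * dH i j m * Y m + B i j * H j m * dY i m) := by
  have e1 : ∑ j, ∑ m, H j m * (∑ i, dB i i j) * Y m = ∑ i, ∑ j, ∑ m, dB i i j * (H j m * Y m) := by
    rw [Finset.sum_comm]
    simp only [Finset.mul_sum, Finset.sum_mul]
    rw [Finset.sum_comm]
    conv_rhs => rw [Finset.sum_comm]
    refine Finset.sum_congr rfl fun j _ => ?_
    rw [Finset.sum_comm]
    exact Finset.sum_congr rfl fun i _ => Finset.sum_congr rfl fun m _ => by ring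
  have e2 : ∑ j, ∑ m, H j m * (∑ k, γ k * B k j) * Y m
      = ∑ i, ∑ j, ∑ m, γ i * (B i j * (H j m * Y m)) := by
    simp only [Finset.mul_sum, Finset.sum_mul]
    conv_rhs => rw [Finset.sum_comm]
    refine Finset.sum_congr rfl fun j _ => ?_
    rw [Finset.sum_comm]
    exact Finset.sum_congr rfl fun i _ => Finset.sum_congr rfl fun m _ => by ring
  have e3 : ∑ j, ∑ m, H j m * (∑ k, ∑ l, Γ j k l * B k l) * Y m
      = (∑ i, ∑ j, ∑ m, B i j * dH i j m * Y m)
        - (1 / 2) * ∑ i, ∑ j, ∑ m, B i j * (Y m * dH m i j) := by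
    have h1 : ∑ j, ∑ m, H j m * (∑ k, ∑ l, Γ j k l * B k l) * Y m
        = ∑ k, ∑ l, ∑ m, (∑ j, H j m * Γ j k l) * (B k l * Y m) := by
      simp only [Finset.mul_sum, Finset.sum_mul]
      rw [sum_comm_pairs]
      refine Finset.sum_congr rfl fun k _ => Finset.sum_congr rfl fun l _ => ?_
      rw [Finset.sum_comm]
      exact Finset.sum_congr rfl fun i _ => Finset.sum_congr rfl fun m _ => by ring
    have h2 : ∑ k, ∑ l, ∑ m, dH l k m * (B k l * Y m) = ∑ k, ∑ l, ∑ m, B k l * dH k l m * Y m := by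
      rw [Finset.sum_comm]
      refine Finset.sum_congr rfl fun k _ => Finset.sum_congr rfl fun l _ =>
        Finset.sum_congr rfl fun m _ => ?_
      rw [hB l k]; ring
    have h3 : ∑ k, ∑ l, ∑ m, (∑ j, H j m * Γ j k l) * (B k l * Y m)
        = (1 / 2) * (∑ k, ∑ l, ∑ m, B k l * dH k l m * Y m)
          + (1 / 2) * (∑ k, ∑ l, ∑ m, dH l k m * (B k l * Y m))
          - (1 / 2) * ∑ i, ∑ j, ∑ m, B i j * (Y m * dH m i j) := by
      simp only [hΓ, Finset.mul_sum, ← Finset.sum_add_distrib, ← Finset.sum_sub_distrib]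
      exact Finset.sum_congr rfl fun k _ => Finset.sum_congr rfl fun l _ =>
        Finset.sum_congr rfl fun m _ => by ring
    rw [h1, h3, h2]; ring
  have e4 : ∑ i, ∑ j, B i j * ∑ k, H k j * dY i k = ∑ i, ∑ j, ∑ m, B i j * H j m * dY i m := by
    simp only [Finset.mul_sum]
    refine Finset.sum_congr rfl fun k _ => Finset.sum_congr rfl fun l _ =>
        Finset.sum_congr rfl fun m _ => ?_
    rw [hH m l]; ring
  have e5 : ∑ i, ∑ j, B i j * ∑ k, H i k * dY j k = ∑ i, ∑ j, ∑ m, B i j * H j m * dY i m := by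
    simp only [Finset.mul_sum]
    rw [Finset.sum_comm]
    refine Finset.sum_congr rfl fun k _ => Finset.sum_congr rfl fun l _ =>
        Finset.sum_congr rfl fun m _ => ?_
    rw [hB l k]; ring
  simp only [mul_add, add_mul, Finset.sum_add_distrib]
  rw [e1, e2, e3, e4, e5]
  simp only [Finset.mul_sum]
  simp only [← Finset.mul_sum]
  ring

/-- The Christoffel symbols of `G` cancel in `locEL`, except for the contracted ones: the term
`Γ^j_{ik} B^{ik}` of the divergence is removed by the difference of the connections. -/
theorem locEL_eq (G H : 𝔼 → Matrix (Fin n) (Fin n) ℝ) (x : 𝔼) (j : Fin n) :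
    locEL G H x j = ∑ i, partialD (fun y => locRaised (G y) (H y - G y) i j) x i
      + ∑ k, (∑ r, locChristoffel G x r r k) * locRaised (G x) (H x - G x) k j
      + ∑ k, ∑ l, locChristoffel H x j k l * locRaised (G x) (H x - G x) k l := by
  simp only [locEL, sub_mul, Finset.sum_sub_distrib, Finset.sum_mul]
  rw [Finset.sum_comm (f := fun i k => locChristoffel G x i i k * _)]
  ring

/-- The pointwise identity behind the first variation formula: the variation density plus
four times the pairing with the Euler-Lagrange field is a divergence. -/
theorem locVar_add_locPairing (hG : IsMetricOn G U) (hH : IsMetricOn H U) {Y : 𝔼 → 𝔼} {x : 𝔼}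
    (hx : x ∈ U) (hY : ContDiffAt ℝ ∞ Y x) :
    locVar G H Y x * √(G x).det + 4 * (locPairing G H Y x * √(G x).det)
      = 4 * ∑ i, partialD (locFlux G H Y i) x i := by
  have h := variation_identity (locRaised (G x) (H x - G x)) (H x)
    (fun a i j => partialD (fun y => locRaised (G y) (H y - G y) i j) x a)
    (fun a i j => partialD (fun y => H y i j) x a) (Y x)
    (fun a m => partialD (fun y => Y y m) x a) (fun k => ∑ r, locChristoffel G x r r k)
    (locChristoffel H x)
    (locRaised_symm _ fun i j => by simp [hG.symm x i j, hH.symm x i j]) (hH.symm x)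
    (hH.lower_christoffel hx)
  simp only [partialD_locFlux hG hH hx hY, ← Finset.mul_sum, locVar, locLie, locPairing, locEL_eq]
  linear_combination √(G x).det * h

/-! ### Functions with compact support in an open set -/

theorem continuous_of_support_subset {X : Type*} [TopologicalSpace X] {f : X → ℝ} {U K : Set X}
    (hU : IsOpen U) (hK : IsClosed K) (hKU : K ⊆ U) (hf : ContinuousOn f U)
    (h0 : ∀ x ∉ K, f x = 0) : Continuous f := by
  refine continuous_iff_continuousAt.2 fun x => ?_
  by_cases hx : x ∈ K
  · exact hf.continuousAt (hU.mem_nhds (hKU hx))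
  · exact continuousAt_const.congr (Filter.eventuallyEq_of_mem (hK.isOpen_compl.mem_nhds hx)
      fun y hy => (h0 y hy).symm)

theorem integrable_of_support_subset {f : 𝔼 → ℝ} {U K : Set 𝔼}
    (hU : IsOpen U) (hK : IsCompact K) (hKU : K ⊆ U) (hf : ContinuousOn f U)
    (h0 : ∀ x ∉ K, f x = 0) : Integrable f :=
  (continuous_of_support_subset hU hK.isClosed hKU hf h0).integrable_of_hasCompactSupport
    (HasCompactSupport.intro hK h0)

theorem integral_partialD_eq_zero {f : 𝔼 → ℝ} (hf : ContDiff ℝ ∞ f) (hs : HasCompactSupport f)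
    (i : Fin n) : ∫ x, partialD f x i = 0 := by
  have hc : Continuous fun x => fderiv ℝ f x (stdVec i) :=
    (hf.continuous_fderiv (by simp)).clm_apply continuous_const
  have hcs : HasCompactSupport fun x => fderiv ℝ f x (stdVec i) :=
    HasCompactSupport.intro (hs.fderiv ℝ) fun x hx => by
      rw [image_eq_zero_of_notMem_tsupport hx]; rfl
  have h := integral_mul_fderiv_eq_neg_fderiv_mul_of_integrable (μ := volume)
    (f := fun _ : 𝔼 => (1 : ℝ)) (g := f) (v := stdVec i) (by simp)
    (by simpa using hc.integrable_of_hasCompactSupport hcs)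
    (by simpa using hf.continuous.integrable_of_hasCompactSupport hs)
    (fun _ _ => by fun_prop) (fun x _ => hf.differentiable (by simp) x)
  simpa [partialD] using h

/-! ### The first variation formula in a chart -/

theorem locVar_eq_zero {Y : 𝔼 → 𝔼} {x : 𝔼} (hx : x ∉ tsupport Y) : locVar G H Y x = 0 := by
  have h0 : ∀ k, Y x k = 0 := fun k => by rw [image_eq_zero_of_notMem_tsupport hx]; rfl
  have h1 : ∀ k i, partialD (fun y => Y y k) x i = 0 := fun k i =>
    partialD_eq_zero_of_notMem_tsupport (fun h => hx
      (closure_mono (Function.support_subset_iff'.2 fun y hy => by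
        rw [Function.notMem_support.1 hy]; rfl) h)) i
  simp [locVar, locLie, h0, h1]

theorem locPairing_eq_zero {Y : 𝔼 → 𝔼} {x : 𝔼} (hx : Y x = 0) : locPairing G H Y x = 0 := by
  simp [locPairing, hx]

theorem contDiffAt_locVar (hG : IsMetricOn G U) (hH : IsMetricOn H U) {Y : 𝔼 → 𝔼} {x : 𝔼}
    (hx : x ∈ U) (hY : ContDiffAt ℝ ∞ Y x) : ContDiffAt ℝ ∞ (locVar G H Y) x := by
  have hYc := contDiffAt_euclidean.1 hY
  refine contDiffAt_const.mul (ContDiffAt.sum fun i _ => ContDiffAt.sum fun j _ =>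
    (contDiffAt_locRaised_sub hG hH hx i j).mul (((ContDiffAt.sum fun m _ => ?_).add
      (ContDiffAt.sum fun m _ => ?_)).add (ContDiffAt.sum fun m _ => ?_)))
  · exact (hYc m).mul (contDiffAt_partialD (hH.smooth x hx i j) m)
  · exact (hH.smooth x hx m j).mul (contDiffAt_partialD (hYc m) i)
  · exact (hH.smooth x hx i m).mul (contDiffAt_partialD (hYc m) j)

theorem contDiffAt_locPairing (hG : IsMetricOn G U) (hH : IsMetricOn H U) {Y : 𝔼 → 𝔼} {x : 𝔼}
    (hx : x ∈ U) (hY : ContDiffAt ℝ ∞ Y x) : ContDiffAt ℝ ∞ (locPairing G H Y) x :=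
  ContDiffAt.sum fun j _ => ContDiffAt.sum fun m _ =>
    ((hH.smooth x hx j m).mul (contDiffAt_locEL hG hH hx j)).mul (contDiffAt_euclidean.1 hY m)

/-- The first variation formula for a vector field with compact support in a chart. -/
theorem integral_locVar (hU : IsOpen U) (hG : IsMetricOn G U) (hH : IsMetricOn H U) {Y : 𝔼 → 𝔼}
    (hY : ContDiff ℝ ∞ Y) (hs : HasCompactSupport Y) (hYU : tsupport Y ⊆ U) :
    ∫ x in U, locVar G H Y x * √(G x).det = -4 * ∫ x in U, locPairing G H Y x * √(G x).det := by
  have hV : ∫ x, locVar G H Y x * √(G x).det = ∫ x in U, locVar G H Y x * √(G x).det :=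
    (setIntegral_eq_integral_of_forall_compl_eq_zero fun x hx => by
      rw [locVar_eq_zero fun h => hx (hYU h), zero_mul]).symm
  have hP : ∫ x, locPairing G H Y x * √(G x).det = ∫ x in U, locPairing G H Y x * √(G x).det :=
    (setIntegral_eq_integral_of_forall_compl_eq_zero fun x hx => by
      rw [locPairing_eq_zero (image_eq_zero_of_notMem_tsupport fun h => hx (hYU h)),
        zero_mul]).symm
  have hVi : Integrable fun x => locVar G H Y x * √(G x).det :=
    integrable_of_support_subset hU hs hYU (fun x hx => ((contDiffAt_locVar hG hH hx
      hY.contDiffAt).mul (hG.contDiffAt_sqrt_det hx)).continuousAt.continuousWithinAt)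
      fun x hx => by rw [locVar_eq_zero hx, zero_mul]
  have hPi : Integrable fun x => locPairing G H Y x * √(G x).det :=
    integrable_of_support_subset hU hs hYU (fun x hx => ((contDiffAt_locPairing hG hH hx
      hY.contDiffAt).mul (hG.contDiffAt_sqrt_det hx)).continuousAt.continuousWithinAt)
      fun x hx => by
        rw [locPairing_eq_zero (image_eq_zero_of_notMem_tsupport hx), zero_mul]
  have hF0 : ∀ i, ∀ x ∉ tsupport Y, locFlux G H Y i x = 0 := fun i x hx => by
    simp [locFlux, image_eq_zero_of_notMem_tsupport hx]
  have hFs : ∀ i, HasCompactSupport (locFlux G H Y i) := fun i =>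
    HasCompactSupport.intro hs (hF0 i)
  have hF : ∀ i, ContDiff ℝ ∞ (locFlux G H Y i) := fun i => by
    refine contDiff_iff_contDiffAt.2 fun x => ?_
    by_cases hx : x ∈ tsupport Y
    · exact contDiffAt_locFlux hG hH (hYU hx) hY.contDiffAt i
    · exact contDiffAt_const.congr_of_eventuallyEq (Filter.eventuallyEq_of_mem
        ((isClosed_tsupport Y).isOpen_compl.mem_nhds hx) fun y hy => hF0 i y hy)
  have hpt : ∀ x, locVar G H Y x * √(G x).det + 4 * (locPairing G H Y x * √(G x).det)
      = 4 * ∑ i, partialD (locFlux G H Y i) x i := by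
    intro x
    by_cases hx : x ∈ tsupport Y
    · exact locVar_add_locPairing hG hH (hYU hx) hY.contDiffAt
    · have hz : ∀ i, partialD (locFlux G H Y i) x i = 0 := fun i => by
        refine partialD_eq_zero_of_notMem_tsupport (fun h => hx ?_) i
        exact closure_minimal (Function.support_subset_iff'.2 (hF0 i)) (isClosed_tsupport Y) h
      simp [locVar_eq_zero hx, locPairing_eq_zero (image_eq_zero_of_notMem_tsupport hx), hz]
  have hint : ∫ x, (locVar G H Y x * √(G x).det + 4 * (locPairing G H Y x * √(G x).det)) = 0 := by
    simp_rw [hpt]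
    rw [integral_const_mul, integral_finsetSum]
    · simp [integral_partialD_eq_zero (hF _) (hFs _)]
    · intro i _
      refine ((hF i).continuous_fderiv (by simp)).clm_apply continuous_const
        |>.integrable_of_hasCompactSupport ?_
      exact HasCompactSupport.intro ((hFs i).fderiv ℝ) fun x hx => by
        rw [image_eq_zero_of_notMem_tsupport hx]; rfl
  rw [integral_add hVi (hPi.const_mul 4), integral_const_mul] at hint
  rw [← hV, ← hP]
  linarith

/-- A continuous vector field whose pairing with every compactly supported multiple of a coordinate
field integrates to zero vanishes. -/
theorem eq_zero_of_integral_pairing_eq_zero (hU : IsOpen U) {w : 𝔼 → ℝ} {W : 𝔼 → Fin n → ℝ}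
    (hH : ∀ x ∈ U, ∀ i j, ContinuousAt (fun y => H y i j) x) (hdet : ∀ x ∈ U, (H x).det ≠ 0)
    (hw : ∀ x ∈ U, ContinuousAt w x) (hw0 : ∀ x ∈ U, w x ≠ 0)
    (hW : ∀ x ∈ U, ∀ j, ContinuousAt (fun y => W y j) x)
    (h : ∀ m, ∀ f : 𝔼 → ℝ, ContDiff ℝ ∞ f → HasCompactSupport f → tsupport f ⊆ U →
      ∫ x, f x * ((∑ j, H x j m * W x j) * w x) = 0) :
    ∀ x ∈ U, W x = 0 := by
  have hcont : ∀ m, ContinuousOn (fun x => (∑ j, H x j m * W x j) * w x) U := fun m x hx =>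
    ContinuousAt.continuousWithinAt ((tendsto_finsetSum _ fun j _ =>
      (hH x hx j m).mul (hW x hx j)).mul (hw x hx))
  have hz : ∀ m, ∀ x ∈ U, (∑ j, H x j m * W x j) * w x = 0 := by
    intro m
    have hae := hU.ae_eq_zero_of_integral_contDiff_smul_eq_zero (μ := volume)
      ((hcont m).locallyIntegrableOn hU.measurableSet) (h m)
    have hae' : (fun x => (∑ j, H x j m * W x j) * w x) =ᵐ[volume.restrict U] fun _ => (0 : ℝ) :=
      (ae_restrict_iff' hU.measurableSet).2 hae
    exact Measure.eqOn_open_of_ae_eq hae' hU (hcont m) continuousOn_const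
  intro x hx
  have hv : Matrix.vecMul (W x) (H x) = 0 := by
    ext m
    have := (mul_eq_zero.1 (hz m x hx)).resolve_right (hw0 x hx)
    rw [Matrix.vecMul, dotProduct, Pi.zero_apply, ← this]
    exact Finset.sum_congr rfl fun j _ => mul_comm _ _
  exact Matrix.eq_zero_of_vecMul_eq_zero (hdet x hx) hv

end LocalIntegration

/-! ### Tensor and vector fields in charts -/

section Charts

variable {n : ℕ}
variable {M : Type*} [TopologicalSpace M] [ChartedSpace (EuclideanSpace ℝ (Fin n)) M]
variable {N : Type*} [TopologicalSpace N] [ChartedSpace (EuclideanSpace ℝ (Fin n)) N]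

local notation "𝔼" => EuclideanSpace ℝ (Fin n)

/-- The derivative at `x` of the inverse of the preferred chart at `q`. Here, as in the following
definitions, every tangent space is identified with `ℝⁿ`, to which it is definitionally equal; this
makes it possible to compare tangent vectors at points that are only propositionally equal. -/
noncomputable def dSymm (q : M) (x : 𝔼) : 𝔼 →L[ℝ] 𝔼 :=
  mfderiv 𝓘(ℝ, 𝔼) (𝓡 n) (extChartAt (𝓡 n) q).symm x

/-- The derivative at `p` of the preferred chart at `q`. -/
noncomputable def dChart (q p : M) : 𝔼 →L[ℝ] 𝔼 :=
  mfderiv (𝓡 n) 𝓘(ℝ, 𝔼) (extChartAt (𝓡 n) q) p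

/-- A tensor field of type `(0,2)`, as a family of bilinear forms on `ℝⁿ`. -/
def tensorForm (T : TensorField02 n M) (p : M) : 𝔼 →L[ℝ] 𝔼 →L[ℝ] ℝ := T p

/-- A vector field, as a family of vectors of `ℝⁿ`. -/
def fieldVec (Y : (p : M) → TangentSpace (𝓡 n) p) (p : M) : 𝔼 := Y p

/-- The coordinate representation of the vector field `Y` in the preferred chart at `q`. -/
noncomputable def locField (q : M) (Y : (p : M) → TangentSpace (𝓡 n) p) (x : 𝔼) : 𝔼 :=
  dChart q ((extChartAt (𝓡 n) q).symm x) (fieldVec Y ((extChartAt (𝓡 n) q).symm x))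

/-- The derivative of a map between manifolds. -/
noncomputable def dMap (f : M → N) (p : M) : 𝔼 →L[ℝ] 𝔼 := mfderiv (𝓡 n) (𝓡 n) f p

theorem eq_sum_stdVec (v : 𝔼) : v = ∑ i, v i • (stdVec i : 𝔼) := by
  ext j
  simp [stdVec, Finset.sum_apply, Pi.single_apply]

theorem components_eq (T : TensorField02 n M) (q : M) (x : 𝔼) (i j : Fin n) :
    components T q x i j = tensorForm T ((extChartAt (𝓡 n) q).symm x) (dSymm q x (stdVec i))
      (dSymm q x (stdVec j)) := rfl

theorem tensorForm_dSymm (T : TensorField02 n M) (q : M) (x : 𝔼) (v w : 𝔼) :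
    tensorForm T ((extChartAt (𝓡 n) q).symm x) (dSymm q x v) (dSymm q x w)
      = ∑ k, ∑ l, components T q x k l * v k * w l := by
  conv_lhs => rw [eq_sum_stdVec v, eq_sum_stdVec w]
  simp only [map_sum, map_smul, _root_.sum_apply, _root_.smul_apply, smul_eq_mul, components_eq,
    Finset.mul_sum]
  rw [Finset.sum_comm]
  exact Finset.sum_congr rfl fun k _ => Finset.sum_congr rfl fun l _ => by ring

theorem tensorForm_pullback (f : M → N) (T : TensorField02 n N) (p : M) (v w : 𝔼) :
    tensorForm (pullback f T) p v w = tensorForm T (f p) (dMap f p v) (dMap f p w) := rfl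

theorem extChartAt_target_mem_nhds' {q : M} {x : 𝔼} (hx : x ∈ (extChartAt (𝓡 n) q).target) :
    (extChartAt (𝓡 n) q).target ∈ nhds x := (isOpen_extChartAt_target q).mem_nhds hx

theorem extChartAt_source_mem_nhds_of_mem {q p : M} (hp : p ∈ (extChartAt (𝓡 n) q).source) :
    (extChartAt (𝓡 n) q).source ∈ nhds p := (isOpen_extChartAt_source q).mem_nhds hp

theorem locField_apply {q p : M} (hp : p ∈ (extChartAt (𝓡 n) q).source)
    (Y : (p : M) → TangentSpace (𝓡 n) p) :
    locField q Y (extChartAt (𝓡 n) q p) = dChart q p (fieldVec Y p) := by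
  rw [locField, (extChartAt (𝓡 n) q).left_inv hp]

theorem pullback_id (T : TensorField02 n M) : pullback (fun p : M => p) T = T := by
  funext p
  refine ContinuousLinearMap.ext fun u => ContinuousLinearMap.ext fun v => ?_
  have h : mfderiv (𝓡 n) (𝓡 n) (fun p : M => p) p = ContinuousLinearMap.id ℝ _ := mfderiv_id
  rw [pullback_apply, h]
  rfl

variable [IsManifold (𝓡 n) ∞ M] [IsManifold (𝓡 n) ∞ N]

theorem contMDiffAt_symm {q : M} {x : 𝔼} (hx : x ∈ (extChartAt (𝓡 n) q).target) :
    ContMDiffAt 𝓘(ℝ, 𝔼) (𝓡 n) ∞ (extChartAt (𝓡 n) q).symm x :=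
  (contMDiffOn_extChartAt_symm q).contMDiffAt (extChartAt_target_mem_nhds' hx)

theorem contMDiffAt_chart {q p : M} (hp : p ∈ (extChartAt (𝓡 n) q).source) :
    ContMDiffAt (𝓡 n) 𝓘(ℝ, 𝔼) ∞ (extChartAt (𝓡 n) q) p :=
  contMDiffAt_extChartAt' (by simpa using hp)

theorem dChart_comp_dSymm {q : M} {x : 𝔼} (hx : x ∈ (extChartAt (𝓡 n) q).target) :
    (dChart q ((extChartAt (𝓡 n) q).symm x)).comp (dSymm q x) = ContinuousLinearMap.id ℝ 𝔼 := by
  have h := mfderiv_extChartAt_comp_mfderivWithin_extChartAt_symm (I := 𝓡 n) hx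
  rw [ModelWithCorners.range_eq_univ, mfderivWithin_univ] at h
  exact h

theorem dSymm_comp_dChart {q p : M} (hp : p ∈ (extChartAt (𝓡 n) q).source) :
    (dSymm q (extChartAt (𝓡 n) q p)).comp (dChart q p) = ContinuousLinearMap.id ℝ 𝔼 := by
  have h := mfderivWithin_extChartAt_symm_comp_mfderiv_extChartAt' (I := 𝓡 n) hp
  rw [ModelWithCorners.range_eq_univ, mfderivWithin_univ] at h
  exact h

theorem dChart_dSymm {q : M} {x : 𝔼} (hx : x ∈ (extChartAt (𝓡 n) q).target) (v : 𝔼) :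
    dChart q ((extChartAt (𝓡 n) q).symm x) (dSymm q x v) = v :=
  DFunLike.congr_fun (dChart_comp_dSymm hx) v

theorem dSymm_dChart {q p : M} (hp : p ∈ (extChartAt (𝓡 n) q).source) (v : 𝔼) :
    dSymm q (extChartAt (𝓡 n) q p) (dChart q p v) = v :=
  DFunLike.congr_fun (dSymm_comp_dChart hp) v

/-- The identification of the tangent space at `q` with `ℝⁿ` is the one through the preferred chart
at `q`. -/
theorem dChart_self (q : M) : dChart q q = ContinuousLinearMap.id ℝ 𝔼 := mfderiv_extChartAt_self

/-- The derivative of a map, expressed through its coordinate representation. -/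
theorem dMap_dSymm {f : M → N} {q : M} {q' : N} {x : 𝔼}
    (hx : x ∈ (extChartAt (𝓡 n) q).target)
    (hf : MDifferentiableAt (𝓡 n) (𝓡 n) f ((extChartAt (𝓡 n) q).symm x))
    (hfx : f ((extChartAt (𝓡 n) q).symm x) ∈ (extChartAt (𝓡 n) q').source) (v : 𝔼) :
    dMap f ((extChartAt (𝓡 n) q).symm x) (dSymm q x v)
      = dSymm q' (extChartAt (𝓡 n) q' (f ((extChartAt (𝓡 n) q).symm x)))
        (fderiv ℝ (fun y => extChartAt (𝓡 n) q' (f ((extChartAt (𝓡 n) q).symm y))) x v) := by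
  have hs : MDifferentiableAt 𝓘(ℝ, 𝔼) (𝓡 n) (extChartAt (𝓡 n) q).symm x :=
    (contMDiffAt_symm hx).mdifferentiableAt (by simp)
  have hc : MDifferentiableAt (𝓡 n) 𝓘(ℝ, 𝔼) (extChartAt (𝓡 n) q')
      (f ((extChartAt (𝓡 n) q).symm x)) := (contMDiffAt_chart hfx).mdifferentiableAt (by simp)
  have h1 : mfderiv 𝓘(ℝ, 𝔼) (𝓡 n) (f ∘ (extChartAt (𝓡 n) q).symm) x
      = (mfderiv (𝓡 n) (𝓡 n) f ((extChartAt (𝓡 n) q).symm x)).comp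
        (mfderiv 𝓘(ℝ, 𝔼) (𝓡 n) (extChartAt (𝓡 n) q).symm x) := mfderiv_comp x hf hs
  have h2 : mfderiv 𝓘(ℝ, 𝔼) 𝓘(ℝ, 𝔼)
      (extChartAt (𝓡 n) q' ∘ (f ∘ (extChartAt (𝓡 n) q).symm)) x
      = (mfderiv (𝓡 n) 𝓘(ℝ, 𝔼) (extChartAt (𝓡 n) q') (f ((extChartAt (𝓡 n) q).symm x))).comp
        (mfderiv 𝓘(ℝ, 𝔼) (𝓡 n) (f ∘ (extChartAt (𝓡 n) q).symm) x) :=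
    mfderiv_comp x hc (hf.comp x hs)
  rw [mfderiv_eq_fderiv, h1] at h2
  have h3 : fderiv ℝ (fun y => extChartAt (𝓡 n) q' (f ((extChartAt (𝓡 n) q).symm y))) x v
      = dChart q' (f ((extChartAt (𝓡 n) q).symm x))
        (dMap f ((extChartAt (𝓡 n) q).symm x) (dSymm q x v)) :=
    DFunLike.congr_fun h2 v
  rw [h3, dSymm_dChart hfx]

/-- The components of a pull-back, through the coordinate representation of the map. -/
theorem components_pullback {f : M → N} (T : TensorField02 n N) {q : M} {q' : N} {x : 𝔼}
    (hx : x ∈ (extChartAt (𝓡 n) q).target)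
    (hf : MDifferentiableAt (𝓡 n) (𝓡 n) f ((extChartAt (𝓡 n) q).symm x))
    (hfx : f ((extChartAt (𝓡 n) q).symm x) ∈ (extChartAt (𝓡 n) q').source) (i j : Fin n) :
    components (pullback f T) q x i j
      = ∑ k, ∑ l, components T q' (extChartAt (𝓡 n) q' (f ((extChartAt (𝓡 n) q).symm x))) k l
        * fderiv ℝ (fun y => extChartAt (𝓡 n) q' (f ((extChartAt (𝓡 n) q).symm y))) x (stdVec i) k
        * fderiv ℝ (fun y => extChartAt (𝓡 n) q' (f ((extChartAt (𝓡 n) q).symm y))) x (stdVec j) l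
    := by
  rw [components_eq, tensorForm_pullback, dMap_dSymm hx hf hfx, dMap_dSymm hx hf hfx,
    ← tensorForm_dSymm, (extChartAt (𝓡 n) q').left_inv hfx]

/-- The transition map between two preferred charts. -/
noncomputable def transition (q q' : M) (x : 𝔼) : 𝔼 :=
  extChartAt (𝓡 n) q' ((extChartAt (𝓡 n) q).symm x)

theorem contDiffAt_transition {q q' : M} {x : 𝔼} (hx : x ∈ (extChartAt (𝓡 n) q).target)
    (hx' : (extChartAt (𝓡 n) q).symm x ∈ (extChartAt (𝓡 n) q').source) :
    ContDiffAt ℝ ∞ (transition q q') x :=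
  ((contMDiffAt_chart hx').comp x (contMDiffAt_symm hx)).contDiffAt

/-- The Jacobian matrix of a map at a point. -/
noncomputable def jacobian (f : 𝔼 → 𝔼) (x : 𝔼) : Matrix (Fin n) (Fin n) ℝ :=
  Matrix.of fun k i => fderiv ℝ f x (stdVec i) k

theorem det_jacobian (f : 𝔼 → 𝔼) (x : 𝔼) : (jacobian f x).det = (fderiv ℝ f x).det := by
  rw [ContinuousLinearMap.det, ← LinearMap.det_toMatrix (EuclideanSpace.basisFun (Fin n) ℝ).toBasis]
  congr 1

/-- The tensor transformation law between two charts. -/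
theorem components_change {q q' : M} (T : TensorField02 n M) {x : 𝔼}
    (hx : x ∈ (extChartAt (𝓡 n) q).target)
    (hx' : (extChartAt (𝓡 n) q).symm x ∈ (extChartAt (𝓡 n) q').source) :
    components T q x = (jacobian (transition q q') x).transpose
      * components T q' (transition q q' x) * jacobian (transition q q') x := by
  ext i j
  conv_lhs => rw [← pullback_id T]
  rw [components_pullback (f := fun p => p) T hx mdifferentiableAt_id hx']
  simp only [Matrix.mul_apply, Matrix.transpose_apply, Finset.sum_mul]
  rw [Finset.sum_comm]
  exact Finset.sum_congr rfl fun k _ => Finset.sum_congr rfl fun l _ => by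
    simp only [jacobian, Matrix.of_apply]
    change _ = fderiv ℝ (transition q q') x (stdVec i) l * _ * _
    rw [mul_comm (fderiv ℝ (transition q q') x (stdVec i) l)]
    rfl

/-- The chain rule for transition maps, applied to vectors. -/
theorem fderiv_transition {q q' : M} {x : 𝔼} (hx : x ∈ (extChartAt (𝓡 n) q).target)
    (hx' : (extChartAt (𝓡 n) q).symm x ∈ (extChartAt (𝓡 n) q').source) (v : 𝔼) :
    fderiv ℝ (transition q q') x v
      = dChart q' ((extChartAt (𝓡 n) q).symm x) (dSymm q x v) := by
  have h := dMap_dSymm (f := fun p : M => p) (q' := q') hx mdifferentiableAt_id hx' v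
  have h0 : dMap (fun p : M => p) ((extChartAt (𝓡 n) q).symm x)
      = ContinuousLinearMap.id ℝ 𝔼 := mfderiv_id
  rw [h0] at h
  have h2 := congrArg (dChart q' ((extChartAt (𝓡 n) q).symm x)) h
  rw [ContinuousLinearMap.id_apply] at h2
  rw [h2]
  have h3 := dChart_dSymm (q := q') ((extChartAt (𝓡 n) q').map_source hx')
    (fderiv ℝ (transition q q') x v)
  rw [(extChartAt (𝓡 n) q').left_inv hx'] at h3
  exact h3.symm

theorem det_jacobian_transition_ne_zero {q q' : M} {x : 𝔼}
    (hx : x ∈ (extChartAt (𝓡 n) q).target)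
    (hx' : (extChartAt (𝓡 n) q).symm x ∈ (extChartAt (𝓡 n) q').source) :
    (jacobian (transition q q') x).det ≠ 0 := by
  rw [det_jacobian, ContinuousLinearMap.det]
  refine (LinearMap.isUnit_iff_isUnit_det _).1 ?_ |>.ne_zero
  refine (LinearMap.isUnit_iff_ker_eq_bot _).2 (LinearMap.ker_eq_bot'.2 fun v hv => ?_)
  rw [ContinuousLinearMap.coe_coe, fderiv_transition hx hx'] at hv
  have h1 := dSymm_dChart hx' (dSymm q x v)
  rw [hv, map_zero] at h1
  rw [← dChart_dSymm hx v, ← h1, map_zero]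

/-! ### Independence of the fibre norm of the chart -/

theorem locNormSq_eq_trace (G T : Matrix (Fin n) (Fin n) ℝ) :
    locNormSq G T = (G⁻¹ * T * G⁻¹.transpose * T.transpose).trace := by
  have h : locRaised G T = G⁻¹ * T * G⁻¹.transpose := by
    ext i j
    simp only [locRaised, Matrix.of_apply, Matrix.mul_apply, Matrix.transpose_apply, Finset.sum_mul]
    rw [Finset.sum_comm]
    exact Finset.sum_congr rfl fun k _ => Finset.sum_congr rfl fun l _ => by ring
  rw [← h]
  simp [locNormSq, Matrix.trace, Matrix.mul_apply]

/-- Congruence by `J` is the effect of a change of coordinates on both bilinear forms. -/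
theorem locNormSq_congruence {G T J : Matrix (Fin n) (Fin n) ℝ} (hJ : J.det ≠ 0) :
    locNormSq (J.transpose * G * J) (J.transpose * T * J) = locNormSq G T := by
  have hu : IsUnit J.det := isUnit_iff_ne_zero.2 hJ
  have hut : IsUnit J.transpose.det := by rwa [Matrix.det_transpose]
  have e : J⁻¹ * (G⁻¹ * J.transpose⁻¹) * (J.transpose * T * J)
      * (J⁻¹ * (G⁻¹ * J.transpose⁻¹)).transpose * (J.transpose * T * J).transpose
      = J⁻¹ * (G⁻¹ * T * G⁻¹.transpose * T.transpose * J) := by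
    simp only [Matrix.transpose_mul, Matrix.transpose_nonsing_inv, Matrix.transpose_transpose,
      Matrix.mul_assoc]
    rw [Matrix.nonsing_inv_mul_cancel_left _ _ hut, Matrix.mul_nonsing_inv_cancel_left _ _ hu,
      Matrix.nonsing_inv_mul_cancel_left _ _ hut]
  rw [locNormSq_eq_trace, locNormSq_eq_trace, Matrix.mul_inv_rev, Matrix.mul_inv_rev, e,
    Matrix.trace_mul_comm, Matrix.mul_assoc, Matrix.mul_nonsing_inv _ hu, Matrix.mul_one]

/-- The squared fibre norm, defined through the preferred chart at the point, may be computed in any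
chart. -/
theorem fiberNormSq_eq {q p : M} (hp : p ∈ (extChartAt (𝓡 n) q).source) (g T : TensorField02 n M) :
    fiberNormSq g T p = locNormSq (components g q (extChartAt (𝓡 n) q p))
      (components T q (extChartAt (𝓡 n) q p)) := by
  have hx : extChartAt (𝓡 n) p p ∈ (extChartAt (𝓡 n) p).target := mem_extChartAt_target p
  have hs : (extChartAt (𝓡 n) p).symm (extChartAt (𝓡 n) p p) = p := extChartAt_to_inv p
  have hx' : (extChartAt (𝓡 n) p).symm (extChartAt (𝓡 n) p p) ∈ (extChartAt (𝓡 n) q).source := by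
    rwa [hs]
  have ht : transition p q (extChartAt (𝓡 n) p p) = extChartAt (𝓡 n) q p := by
    rw [transition, hs]
  change locNormSq (components g p (extChartAt (𝓡 n) p p))
    (components T p (extChartAt (𝓡 n) p p)) = _
  rw [components_change g hx hx', components_change T hx hx',
    locNormSq_congruence (det_jacobian_transition_ne_zero hx hx'), ht]

/-! ### Smoothness in charts -/

/-- A vector field is smooth at a point if and only if its coordinates in a chart are. -/
theorem contMDiffAt_field_iff {Y : (p : M) → TangentSpace (𝓡 n) p} {q p : M}
    (hp : p ∈ (extChartAt (𝓡 n) q).source) :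
    ContMDiffAt (𝓡 n) (𝓡 n).tangent ∞ (fun p => (⟨p, Y p⟩ : TangentBundle (𝓡 n) M)) p ↔
      ContMDiffAt (𝓡 n) 𝓘(ℝ, 𝔼) ∞ (fun p => dChart q p (fieldVec Y p)) p := by
  have hp' : p ∈ (chartAt 𝔼 q).source := by simpa using hp
  refine ((trivializationAt 𝔼 (TangentSpace (𝓡 n)) q).contMDiffAt_section_iff (n := ∞)
    (IB := 𝓡 n) (s := Y) (by simpa using hp')).trans ?_
  refine Filter.EventuallyEq.contMDiffAt_iff ?_
  filter_upwards [(chartAt 𝔼 q).open_source.mem_nhds hp'] with p' hp'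
  have h := TangentBundle.continuousLinearMapAt_trivializationAt (I := 𝓡 n) hp'
  have h2 := DFunLike.congr_fun h (Y p')
  rw [Trivialization.continuousLinearMapAt_apply, Trivialization.linearMapAt_apply,
    if_pos (by simpa using hp')] at h2
  exact h2

theorem contDiffAt_locField {Y : (p : M) → TangentSpace (𝓡 n) p} (hY : IsSmoothVectorField Y)
    {q : M} {x : 𝔼} (hx : x ∈ (extChartAt (𝓡 n) q).target) : ContDiffAt ℝ ∞ (locField q Y) x :=
  (((contMDiffAt_field_iff ((extChartAt (𝓡 n) q).map_target hx)).1 (hY _)).comp x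
    (contMDiffAt_symm hx)).contDiffAt

/-- The components of a smooth metric are smooth. -/
theorem contDiffAt_components_metric (g : RiemMetric n M) {q : M} {x : 𝔼}
    (hx : x ∈ (extChartAt (𝓡 n) q).target) (i j : Fin n) :
    ContDiffAt ℝ ∞ (fun y => components g.inner q y i j) x := by
  set p := (extChartAt (𝓡 n) q).symm x
  have hp : p ∈ (extChartAt (𝓡 n) q).source := (extChartAt (𝓡 n) q).map_target hx
  let E : Fin n → (p : M) → TangentSpace (𝓡 n) p := fun i p =>
    (dSymm q (extChartAt (𝓡 n) q p) (stdVec i) : 𝔼)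
  have hE : ∀ i, ContMDiffAt (𝓡 n) (𝓡 n).tangent ∞
      (fun p => (⟨p, E i p⟩ : TangentBundle (𝓡 n) M)) p := fun i => by
    refine (contMDiffAt_field_iff hp).2 (contMDiffAt_const (c := (stdVec i : 𝔼))
      |>.congr_of_eventuallyEq ?_)
    filter_upwards [extChartAt_source_mem_nhds_of_mem hp] with p' hp'
    have h := dChart_dSymm ((extChartAt (𝓡 n) q).map_source hp') (stdVec i)
    rw [(extChartAt (𝓡 n) q).left_inv hp'] at h
    exact h
  have h := ContMDiffAt.clm_bundle_apply₂ (F₁ := 𝔼) (F₂ := 𝔼) (F₃ := ℝ)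
    (E₃ := Bundle.Trivial M ℝ) (g.contMDiff p) (hE i) (hE j)
  simp only [contMDiffAt_totalSpace] at h
  refine ((h.2.comp x (contMDiffAt_symm hx)).contDiffAt).congr_of_eventuallyEq ?_
  filter_upwards [extChartAt_target_mem_nhds' hx] with y hy
  have h1 : components g.inner q y i j = tensorForm g.inner ((extChartAt (𝓡 n) q).symm y)
      (dSymm q (extChartAt (𝓡 n) q ((extChartAt (𝓡 n) q).symm y)) (stdVec i))
      (dSymm q (extChartAt (𝓡 n) q ((extChartAt (𝓡 n) q).symm y)) (stdVec j)) := by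
    rw [(extChartAt (𝓡 n) q).right_inv hy, components_eq]
  exact h1

end Charts

/-! ### The Lie derivative as derivative of a pull-back -/

section LieDerivative

variable {n : ℕ}

local notation "𝔼" => EuclideanSpace ℝ (Fin n)

theorem fderiv_prodMk_right {Ψ : ℝ × 𝔼 → 𝔼} {t : ℝ} {x : 𝔼}
    (hΨ : DifferentiableAt ℝ Ψ (t, x)) (v : 𝔼) :
    fderiv ℝ (fun y => Ψ (t, y)) x v = fderiv ℝ Ψ (t, x) (0, v) := by
  have h := hΨ.hasFDerivAt.comp x (hasFDerivAt_prodMk_right t x)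
  change fderiv ℝ (Ψ ∘ fun y => (t, y)) x v = _
  rw [h.fderiv]
  simp

/-- The derivative at time zero of the spatial derivative of a flow is the derivative of the vector
field, by symmetry of second derivatives. -/
theorem hasDerivAt_fderiv_flow {Ψ : ℝ × 𝔼 → 𝔼} {Y : 𝔼 → 𝔼} {x₀ : 𝔼}
    (hΨ : ContDiffAt ℝ ∞ Ψ (0, x₀))
    (hY : ∀ᶠ x in nhds x₀, HasDerivAt (fun t => Ψ (t, x)) (Y x) 0) (v : 𝔼) :
    HasDerivAt (fun t => fderiv ℝ (fun y => Ψ (t, y)) x₀ v) (fderiv ℝ Y x₀ v) 0 := by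
  have hev : ∀ᶠ z in nhds ((0 : ℝ), x₀), DifferentiableAt ℝ Ψ z :=
    ((hΨ.of_le (m := 1) (mod_cast le_top)).eventually (by simp)).mono
      fun z hz => hz.differentiableAt one_ne_zero
  have hD : HasFDerivAt (fderiv ℝ Ψ) (fderiv ℝ (fderiv ℝ Ψ) (0, x₀)) (0, x₀) :=
    ((hΨ.fderiv_right (m := ∞) (by simp)).differentiableAt (by simp)).hasFDerivAt
  set D := fderiv ℝ (fderiv ℝ Ψ) (0, x₀)
  have hsymm : D (1, 0) (0, v) = D (0, v) (1, 0) :=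
    ((hΨ.of_le (m := 2) (WithTop.coe_le_coe.2 le_top)).isSymmSndFDerivAt (by simp)).eq _ _
  have ht : Filter.Tendsto (fun t : ℝ => (t, x₀)) (nhds 0) (nhds (0, x₀)) :=
    (continuous_id.prodMk continuous_const).tendsto' _ _ rfl
  have hx : Filter.Tendsto (fun x : 𝔼 => ((0 : ℝ), x)) (nhds x₀) (nhds (0, x₀)) :=
    (continuous_const.prodMk continuous_id).tendsto' _ _ rfl
  have h1 : HasDerivAt (fun t => fderiv ℝ Ψ (t, x₀) (0, v)) (D (1, 0) (0, v)) 0 := by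
    have hl : HasDerivAt (fun t : ℝ => (t, x₀)) ((1 : ℝ), (0 : 𝔼)) 0 :=
      (hasDerivAt_id _).prodMk (hasDerivAt_const _ _)
    exact ((ContinuousLinearMap.apply ℝ 𝔼 ((0 : ℝ), v)).hasFDerivAt.comp (0, x₀)
      hD).comp_hasDerivAt (0 : ℝ) hl
  have h2 : HasFDerivAt Y (((ContinuousLinearMap.apply ℝ 𝔼 ((1 : ℝ), (0 : 𝔼))).comp D).comp
      (ContinuousLinearMap.inr ℝ ℝ 𝔼)) x₀ := by
    have h3 := ((ContinuousLinearMap.apply ℝ 𝔼 ((1 : ℝ), (0 : 𝔼))).hasFDerivAt.comp _ hD).comp x₀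
      (hasFDerivAt_prodMk_right (0 : ℝ) x₀)
    refine h3.congr_of_eventuallyEq ?_
    filter_upwards [hx.eventually hev, hY] with x hx hYx
    have h4 := hx.hasFDerivAt.comp_hasDerivAt (0 : ℝ)
      ((hasDerivAt_id (0 : ℝ)).prodMk (hasDerivAt_const (0 : ℝ) x))
    exact hYx.unique h4
  have h5 : fderiv ℝ Y x₀ v = D (0, v) (1, 0) := by rw [h2.fderiv]; rfl
  rw [h5, ← hsymm]
  refine h1.congr_of_eventuallyEq ?_
  filter_upwards [ht.eventually hev] with t ht
  exact fderiv_prodMk_right ht v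

theorem fderiv_apply_coord {Y : 𝔼 → 𝔼} {x : 𝔼} (hY : DifferentiableAt ℝ Y x) (i k : Fin n) :
    fderiv ℝ Y x (stdVec i) k = partialD (fun y => Y y k) x i := by
  have h : HasFDerivAt (fun y => Y y k) _ x :=
    (EuclideanSpace.proj k : 𝔼 →L[ℝ] ℝ).hasFDerivAt.comp x hY.hasFDerivAt
  rw [partialD, h.fderiv]
  rfl

theorem fderiv_eq_sum_partialD {f : 𝔼 → ℝ} {x : 𝔼} (v : 𝔼) :
    fderiv ℝ f x v = ∑ m, v m * partialD f x m := by
  conv_lhs => rw [eq_sum_stdVec v]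
  simp [partialD]

/-- The derivative at time zero of the components of the pull-back of `H` by a flow `Ψ` with
velocity field `Y` is the Lie derivative. -/
theorem hasDerivAt_pullback_components {H : 𝔼 → Matrix (Fin n) (Fin n) ℝ} {Ψ : ℝ × 𝔼 → 𝔼}
    {Y : 𝔼 → 𝔼} {x₀ : 𝔼} (hΨ : ContDiffAt ℝ ∞ Ψ (0, x₀)) (h0 : ∀ᶠ x in nhds x₀, Ψ (0, x) = x)
    (hYd : DifferentiableAt ℝ Y x₀)
    (hY : ∀ᶠ x in nhds x₀, HasDerivAt (fun t => Ψ (t, x)) (Y x) 0)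
    (hH : ∀ i j, DifferentiableAt ℝ (fun y => H y i j) x₀) (i j : Fin n) :
    HasDerivAt (fun t => ∑ k, ∑ l, H (Ψ (t, x₀)) k l
      * fderiv ℝ (fun y => Ψ (t, y)) x₀ (stdVec i) k
      * fderiv ℝ (fun y => Ψ (t, y)) x₀ (stdVec j) l) (locLie H Y x₀ i j) 0 := by
  have hx0 : Ψ (0, x₀) = x₀ := h0.self_of_nhds
  have hid : ∀ v, fderiv ℝ (fun y => Ψ (0, y)) x₀ v = v := fun v => by
    have : (fun y => Ψ (0, y)) =ᶠ[nhds x₀] id := h0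
    rw [this.fderiv_eq, fderiv_id]; rfl
  have hδ : ∀ i k, (stdVec i : 𝔼) k = if k = i then 1 else 0 := fun i k => by
    simp [stdVec]
  have h1 : ∀ k l, HasDerivAt (fun t => H (Ψ (t, x₀)) k l)
      (∑ m, Y x₀ m * partialD (fun y => H y k l) x₀ m) 0 := fun k l => by
    have hH' : HasFDerivAt (fun y => H y k l) (fderiv ℝ (fun y => H y k l) x₀) (Ψ (0, x₀)) := by
      rw [hx0]; exact (hH k l).hasFDerivAt
    have := hH'.comp_hasDerivAt (0 : ℝ) hY.self_of_nhds
    rwa [fderiv_eq_sum_partialD] at this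
  have h2 : ∀ i k, HasDerivAt (fun t => fderiv ℝ (fun y => Ψ (t, y)) x₀ (stdVec i) k)
      (partialD (fun y => Y y k) x₀ i) 0 := fun i k => by
    have := hasDerivAt_fderiv_flow hΨ hY (stdVec i)
    rw [← fderiv_apply_coord hYd]
    exact (EuclideanSpace.proj k : 𝔼 →L[ℝ] ℝ).hasFDerivAt.comp_hasDerivAt (0 : ℝ) this
  have h3 := HasDerivAt.fun_sum (u := Finset.univ) fun k _ =>
    HasDerivAt.fun_sum (u := Finset.univ) fun l _ => ((h1 k l).fun_mul (h2 i k)).fun_mul (h2 j l)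
  convert! h3 using 1
  simp only [hid, hδ, hx0, locLie]
  simp [Finset.sum_add_distrib]

end LieDerivative

/-! ### The energy density along a flow -/

section EnergyDensity

variable {n : ℕ}
variable {M : Type*} [TopologicalSpace M] [ChartedSpace (EuclideanSpace ℝ (Fin n)) M]
variable {N : Type*} [TopologicalSpace N] [ChartedSpace (EuclideanSpace ℝ (Fin n)) N]

local notation "𝔼" => EuclideanSpace ℝ (Fin n)

theorem pullback_comp {h : M → N} (hh : ContMDiff (𝓡 n) (𝓡 n) ∞ h) {f : M → M}
    (hf : ContMDiff (𝓡 n) (𝓡 n) ∞ f) (T : TensorField02 n N) :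
    pullback (fun p => h (f p)) T = pullback f (pullback h T) := by
  funext p
  refine ContinuousLinearMap.ext fun u => ContinuousLinearMap.ext fun v => ?_
  have e : mfderiv (𝓡 n) (𝓡 n) (fun p => h (f p)) p
      = (mfderiv (𝓡 n) (𝓡 n) h (f p)).comp (mfderiv (𝓡 n) (𝓡 n) f p) :=
    mfderiv_comp p (hh.mdifferentiableAt (by simp)) (hf.mdifferentiableAt (by simp))
  rw [pullback_apply, e]
  rfl

theorem contMDiff_of_joint {φ : ℝ → M → M}
    (hφ : ContMDiff (𝓘(ℝ, ℝ).prod (𝓡 n)) (𝓡 n) ∞ (fun q : ℝ × M => φ q.1 q.2)) (t : ℝ) :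
    ContMDiff (𝓡 n) (𝓡 n) ∞ (φ t) :=
  hφ.comp (contMDiff_const.prodMk contMDiff_id)

variable [IsManifold (𝓡 n) ∞ M] [IsManifold (𝓡 n) ∞ N]

theorem dSymm_injective {q : M} {x : 𝔼} (hx : x ∈ (extChartAt (𝓡 n) q).target) {v : 𝔼}
    (hv : v ≠ 0) : dSymm q x v ≠ 0 := fun h => hv (by
  rw [← dChart_dSymm hx v, h, map_zero])

theorem isMetricOn_components {T : TensorField02 n M} {q : M}
    (hT : ∀ x ∈ (extChartAt (𝓡 n) q).target, ∀ i j,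
      ContDiffAt ℝ ∞ (fun y => components T q y i j) x)
    (hsymm : ∀ p v w, tensorForm T p v w = tensorForm T p w v)
    (hpos : ∀ p v, v ≠ 0 → 0 < tensorForm T p v v) :
    IsMetricOn (components T q) (extChartAt (𝓡 n) q).target where
  smooth := hT
  symm x i j := hsymm _ _ _
  det_pos x hx := by
    refine Matrix.PosDef.det_pos (Matrix.PosDef.of_dotProduct_mulVec_pos ?_ fun v hv => ?_)
    · ext i j
      exact hsymm _ _ _
    · have hv' : (WithLp.toLp 2 v : 𝔼) ≠ 0 := fun h => hv (by
        ext i; exact congrArg (fun w : 𝔼 => w i) h)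
      have h := hpos ((extChartAt (𝓡 n) q).symm x) _ (dSymm_injective hx hv')
      rw [tensorForm_dSymm] at h
      refine h.trans_eq ?_
      simp only [dotProduct, Matrix.mulVec, Finset.mul_sum]
      exact Finset.sum_congr rfl fun k _ => Finset.sum_congr rfl fun l _ => by
        simp; ring

theorem isMetricOn_metric (g : RiemMetric n M) (q : M) :
    IsMetricOn (components g.inner q) (extChartAt (𝓡 n) q).target :=
  isMetricOn_components (fun _ hx i j => contDiffAt_components_metric g hx i j) g.symm g.pos

theorem contDiffAt_components_pullback (g : RiemMetric n N) {h : M → N}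
    (hh : ContMDiff (𝓡 n) (𝓡 n) ∞ h) {q : M} {x : 𝔼} (hx : x ∈ (extChartAt (𝓡 n) q).target)
    (i j : Fin n) : ContDiffAt ℝ ∞ (fun y => components (pullback h g.inner) q y i j) x := by
  set q' := h ((extChartAt (𝓡 n) q).symm x)
  have hq' : h ((extChartAt (𝓡 n) q).symm x) ∈ (extChartAt (𝓡 n) q').source :=
    mem_extChartAt_source q'
  have hc : ContMDiffAt 𝓘(ℝ, 𝔼) (𝓡 n) ∞ (fun y => h ((extChartAt (𝓡 n) q).symm y)) x :=
    hh.contMDiffAt.comp x (contMDiffAt_symm hx)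
  have hψ : ContDiffAt ℝ ∞ (fun y => extChartAt (𝓡 n) q' (h ((extChartAt (𝓡 n) q).symm y))) x :=
    ((contMDiffAt_chart hq').comp x hc).contDiffAt
  have hd : ∀ v k, ContDiffAt ℝ ∞ (fun y => fderiv ℝ (fun z =>
      extChartAt (𝓡 n) q' (h ((extChartAt (𝓡 n) q).symm z))) y v k) x := fun v k =>
    contDiffAt_euclidean.1 ((hψ.fderiv_right (m := ∞) (by simp)).clm_apply contDiffAt_const) k
  have hC : ∀ k l, ContDiffAt ℝ ∞ (fun y => components g.inner q'
      (extChartAt (𝓡 n) q' (h ((extChartAt (𝓡 n) q).symm y))) k l) x := fun k l =>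
    ContDiffAt.comp (g := fun y => components g.inner q' y k l) x
      (contDiffAt_components_metric g ((extChartAt (𝓡 n) q').map_source hq') k l) hψ
  have hsum : ContDiffAt ℝ ∞ (fun y => ∑ k, ∑ l, components g.inner q'
      (extChartAt (𝓡 n) q' (h ((extChartAt (𝓡 n) q).symm y))) k l
      * fderiv ℝ (fun z => extChartAt (𝓡 n) q' (h ((extChartAt (𝓡 n) q).symm z))) y (stdVec i) k
      * fderiv ℝ (fun z => extChartAt (𝓡 n) q' (h ((extChartAt (𝓡 n) q).symm z))) y (stdVec j) l)
      x := ContDiffAt.sum fun k _ => ContDiffAt.sum fun l _ =>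
    ((hC k l).mul (hd (stdVec i) k)).mul (hd (stdVec j) l)
  refine hsum.congr_of_eventuallyEq ?_
  filter_upwards [extChartAt_target_mem_nhds' hx,
    hc.continuousAt.preimage_mem_nhds (extChartAt_source_mem_nhds_of_mem hq')] with y hy hy'
  exact components_pullback g.inner hy (hh.mdifferentiableAt (by simp)) hy' i j

/-- The components of the pull-back of a metric by a diffeomorphism form a metric. -/
theorem isMetricOn_pullback (g : RiemMetric n N) (h : M ≃ₘ^∞⟮𝓡 n, 𝓡 n⟯ N) (q : M) :
    IsMetricOn (components (pullback h g.inner) q) (extChartAt (𝓡 n) q).target := by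
  refine isMetricOn_components (fun _ hx i j => contDiffAt_components_pullback g h.contMDiff hx i j)
    (fun p v w => g.symm _ _ _) (fun p v hv => g.pos _ _ ?_)
  intro h0
  refine hv ?_
  have := (h.mfderivToContinuousLinearEquiv (by simp) p).injective
  exact this (h0.trans (map_zero _).symm)

/-- The energy density of `h` composed with the maps `φ t`. -/
noncomputable def energyDensity (gM : RiemMetric n M) (gN : RiemMetric n N) (h : M → N)
    (φ : ℝ → M → M) (t : ℝ) (p : M) : ℝ :=
  fiberNormSq gM.inner (strain gM gN fun p => h (φ t p)) p

/-- The coordinate representation of a family of maps, in the charts at `q` and `q'`. -/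
noncomputable def flowChart (q q' : M) (φ : ℝ → M → M) (z : ℝ × 𝔼) : 𝔼 :=
  extChartAt (𝓡 n) q' (φ z.1 ((extChartAt (𝓡 n) q).symm z.2))

/-- The coordinate representation of the energy density: `‖Ψ_t^* H - G‖²` at `x` for the pair
`z = (t, x)`, where `Ψ` represents the family of maps. -/
noncomputable def locDensity (G H : 𝔼 → Matrix (Fin n) (Fin n) ℝ) (Ψ : ℝ × 𝔼 → 𝔼) (z : ℝ × 𝔼) :
    ℝ :=
  locNormSq (G z.2) (Matrix.of fun i j => (∑ k, ∑ l, H (Ψ z) k l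
      * fderiv ℝ (fun y => Ψ (z.1, y)) z.2 (stdVec i) k
      * fderiv ℝ (fun y => Ψ (z.1, y)) z.2 (stdVec j) l) - G z.2 i j)

variable {gM : RiemMetric n M} {gN : RiemMetric n N} {h : M → N} {φ : ℝ → M → M}

/-- In charts, `(h ∘ φ_t)^* g_N` is the pull-back of `h^* g_N` by `φ_t`. -/
theorem energyDensity_eq (hh : ContMDiff (𝓡 n) (𝓡 n) ∞ h)
    (hφ : ContMDiff (𝓘(ℝ, ℝ).prod (𝓡 n)) (𝓡 n) ∞ (fun q : ℝ × M => φ q.1 q.2))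
    {q q' p : M} {t : ℝ} (hp : p ∈ (extChartAt (𝓡 n) q).source)
    (hp' : φ t p ∈ (extChartAt (𝓡 n) q').source) :
    energyDensity gM gN h φ t p = locDensity (components gM.inner q)
      (components (pullback h gN.inner) q') (flowChart q q' φ) (t, extChartAt (𝓡 n) q p) := by
  rw [energyDensity, fiberNormSq_eq hp, locDensity]
  congr 1
  ext i j
  have hx := (extChartAt (𝓡 n) q).map_source hp
  have h1 := components_pullback (f := φ t) (q' := q') (pullback h gN.inner) hx
    ((contMDiff_of_joint hφ t).mdifferentiableAt (by simp))
    (by rwa [(extChartAt (𝓡 n) q).left_inv hp]) i j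
  rw [← pullback_comp hh (contMDiff_of_joint hφ t)] at h1
  have h2 : ∀ k : M → N, components (strain gM gN k) q (extChartAt (𝓡 n) q p) i j
      = components (pullback k gN.inner) q (extChartAt (𝓡 n) q p) i j
        - components gM.inner q (extChartAt (𝓡 n) q p) i j := fun k => rfl
  rw [h2, h1]
  rfl

theorem contDiffAt_flowChart
    (hφ : ContMDiff (𝓘(ℝ, ℝ).prod (𝓡 n)) (𝓡 n) ∞ (fun q : ℝ × M => φ q.1 q.2))
    {q q' : M} {t : ℝ} {x : 𝔼} (hx : x ∈ (extChartAt (𝓡 n) q).target)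
    (hx' : φ t ((extChartAt (𝓡 n) q).symm x) ∈ (extChartAt (𝓡 n) q').source) :
    ContDiffAt ℝ ∞ (flowChart q q' φ) (t, x) := by
  have h1 : ContMDiffAt 𝓘(ℝ, ℝ × 𝔼) (𝓘(ℝ, ℝ).prod (𝓡 n)) ∞
      (fun z : ℝ × 𝔼 => (z.1, (extChartAt (𝓡 n) q).symm z.2)) (t, x) := by
    refine ContMDiffAt.prodMk contDiffAt_fst.contMDiffAt ?_
    exact (contMDiffAt_symm hx).comp (t, x) contDiffAt_snd.contMDiffAt
  have h2 := hφ.contMDiffAt.comp (t, x) h1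
  exact ((contMDiffAt_chart hx').comp (t, x) h2).contDiffAt

theorem contDiffAt_locDensity {G H : 𝔼 → Matrix (Fin n) (Fin n) ℝ} {Ψ : ℝ × 𝔼 → 𝔼} {z : ℝ × 𝔼}
    (hΨ : ContDiffAt ℝ ∞ Ψ z) (hG : ∀ i j, ContDiffAt ℝ ∞ (fun y => G y i j) z.2)
    (hdet : (G z.2).det ≠ 0) (hH : ∀ i j, ContDiffAt ℝ ∞ (fun y => H y i j) (Ψ z)) :
    ContDiffAt ℝ ∞ (locDensity G H Ψ) z := by
  have hG' : ∀ i j, ContDiffAt ℝ ∞ (fun w : ℝ × 𝔼 => G w.2 i j) z := fun i j =>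
    (hG i j).comp z contDiffAt_snd
  have hH' : ∀ i j, ContDiffAt ℝ ∞ (fun w : ℝ × 𝔼 => H (Ψ w) i j) z := fun i j =>
    (hH i j).comp z hΨ
  have hev : ∀ᶠ w in nhds z, DifferentiableAt ℝ Ψ w :=
    ((hΨ.of_le (m := 1) (mod_cast le_top)).eventually (by simp)).mono
      fun z hz => hz.differentiableAt one_ne_zero
  have hd : ∀ v k, ContDiffAt ℝ ∞ (fun w : ℝ × 𝔼 =>
      fderiv ℝ (fun y => Ψ (w.1, y)) w.2 v k) z := fun v k => by
    have h1 := contDiffAt_euclidean.1 ((hΨ.fderiv_right (m := ∞) (by simp)).clm_apply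
      (contDiffAt_const (c := ((0 : ℝ), v)))) k
    refine h1.congr_of_eventuallyEq ?_
    filter_upwards [hev] with w hw
    rw [fderiv_prodMk_right hw]
  refine contDiffAt_locNormSq hG' hdet fun i j => ?_
  exact (ContDiffAt.sum fun k _ => ContDiffAt.sum fun l _ =>
    ((hH' k l).mul (hd _ k)).mul (hd _ l)).sub (hG' i j)

/-- The energy density along a flow is a jointly smooth function of the time and the point. -/
theorem contMDiffAt_energyDensity (hh : ContMDiff (𝓡 n) (𝓡 n) ∞ h)
    (hdet : ∀ q : M, IsMetricOn (components (pullback h gN.inner) q) (extChartAt (𝓡 n) q).target)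
    (hφ : ContMDiff (𝓘(ℝ, ℝ).prod (𝓡 n)) (𝓡 n) ∞ (fun q : ℝ × M => φ q.1 q.2)) (t₀ : ℝ)
    (p₀ : M) : ContMDiffAt (𝓘(ℝ, ℝ).prod (𝓡 n)) 𝓘(ℝ, ℝ) ∞
      (fun z : ℝ × M => energyDensity gM gN h φ z.1 z.2) (t₀, p₀) := by
  set q' := φ t₀ p₀
  have hq' : φ t₀ p₀ ∈ (extChartAt (𝓡 n) q').source := mem_extChartAt_source q'
  have hp : p₀ ∈ (extChartAt (𝓡 n) p₀).source := mem_extChartAt_source p₀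
  have hx := (extChartAt (𝓡 n) p₀).map_source hp
  have hs : φ t₀ ((extChartAt (𝓡 n) p₀).symm (extChartAt (𝓡 n) p₀ p₀)) = q' := by
    rw [(extChartAt (𝓡 n) p₀).left_inv hp]
  have hΨ : ContDiffAt ℝ ∞ (flowChart p₀ q' φ) (t₀, extChartAt (𝓡 n) p₀ p₀) :=
    contDiffAt_flowChart hφ hx (by rw [hs]; exact hq')
  have hv : flowChart p₀ q' φ (t₀, extChartAt (𝓡 n) p₀ p₀) ∈ (extChartAt (𝓡 n) q').target := by
    rw [flowChart, hs]
    exact mem_extChartAt_target q'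
  have hloc : ContDiffAt ℝ ∞ (locDensity (components gM.inner p₀)
      (components (pullback h gN.inner) q') (flowChart p₀ q' φ)) (t₀, extChartAt (𝓡 n) p₀ p₀) :=
    contDiffAt_locDensity hΨ ((isMetricOn_metric gM p₀).smooth _ hx)
      ((isMetricOn_metric gM p₀).det_pos _ hx).ne' ((hdet q').smooth _ hv)
  have hc : ContMDiffAt (𝓘(ℝ, ℝ).prod (𝓡 n)) 𝓘(ℝ, ℝ × 𝔼) ∞
      (fun z : ℝ × M => (z.1, extChartAt (𝓡 n) p₀ z.2)) (t₀, p₀) :=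
    contMDiffAt_fst.prodMk_space ((contMDiffAt_chart hp).comp (t₀, p₀) contMDiffAt_snd)
  refine (hloc.contMDiffAt.comp (t₀, p₀) hc).congr_of_eventuallyEq ?_
  have hcont : ContinuousAt (fun z : ℝ × M => φ z.1 z.2) (t₀, p₀) := hφ.continuous.continuousAt
  filter_upwards [continuousAt_snd.preimage_mem_nhds (extChartAt_source_mem_nhds_of_mem hp),
    hcont.preimage_mem_nhds (extChartAt_source_mem_nhds_of_mem hq')] with z hz hz'
  exact energyDensity_eq hh hφ hz hz'

/-- The derivative at time zero of the energy density along the flow of `Y`, in any chart. -/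
theorem hasDerivAt_energyDensity (hh : ContMDiff (𝓡 n) (𝓡 n) ∞ h)
    (hH : ∀ q : M, IsMetricOn (components (pullback h gN.inner) q) (extChartAt (𝓡 n) q).target)
    {Y : (p : M) → TangentSpace (𝓡 n) p} (hY : IsSmoothVectorField Y) (hφ : IsFlow Y φ)
    {q p : M} (hp : p ∈ (extChartAt (𝓡 n) q).source) :
    HasDerivAt (fun t => energyDensity gM gN h φ t p)
      (locVar (components gM.inner q) (components (pullback h gN.inner) q) (locField q Y)
        (extChartAt (𝓡 n) q p)) 0 := by
  set x₀ := extChartAt (𝓡 n) q p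
  set Ψ := flowChart (n := n) q q φ
  have hx := (extChartAt (𝓡 n) q).map_source hp
  have hΨ : ContDiffAt ℝ ∞ Ψ (0, x₀) := contDiffAt_flowChart hφ.smooth hx (by
    rw [hφ.zero]; exact (extChartAt (𝓡 n) q).map_target hx)
  have hvel : ∀ x ∈ (extChartAt (𝓡 n) q).target,
      HasDerivAt (fun t => Ψ (t, x)) (locField q Y x) 0 := by
    intro x hx
    set p' := (extChartAt (𝓡 n) q).symm x
    have hp' : φ 0 p' ∈ (extChartAt (𝓡 n) q).source := by
      rw [hφ.zero]; exact (extChartAt (𝓡 n) q).map_target hx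
    have h1 : HasFDerivAt (fun t => Ψ (t, x)) ((dChart q (φ 0 p')).comp
        ((1 : ℝ →L[ℝ] ℝ).smulRight (fieldVec Y (φ 0 p')))) 0 :=
      (((contMDiffAt_chart hp').mdifferentiableAt (by simp)).hasMFDerivAt.comp (0 : ℝ)
        (hφ.integralCurve p' 0)).hasFDerivAt
    have h2 : HasDerivAt (fun t => Ψ (t, x))
        (dChart q (φ 0 p') ((1 : ℝ) • fieldVec Y (φ 0 p'))) 0 := h1.hasDerivAt
    rw [hφ.zero, one_smul] at h2
    exact h2
  have hd := hasDerivAt_pullback_components (H := components (pullback h gN.inner) q) hΨ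
    (Filter.eventually_of_mem (extChartAt_target_mem_nhds' hx) fun x hx => by
      change extChartAt (𝓡 n) q (φ 0 ((extChartAt (𝓡 n) q).symm x)) = x
      rw [hφ.zero, (extChartAt (𝓡 n) q).right_inv hx])
    ((contDiffAt_locField hY hx).differentiableAt (by simp))
    (Filter.eventually_of_mem (extChartAt_target_mem_nhds' hx) hvel)
    (fun i j => ((hH q).smooth _ hx i j).differentiableAt (by simp))
  have hN := hasDerivAt_locNormSq (G := components gM.inner q x₀)
    ((isMetricOn_metric gM q).symm x₀) (t := 0)
    (T := fun t => Matrix.of fun i j => (∑ k, ∑ l,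
      components (pullback h gN.inner) q (Ψ (t, x₀)) k l
      * fderiv ℝ (fun y => Ψ (t, y)) x₀ (stdVec i) k
      * fderiv ℝ (fun y => Ψ (t, y)) x₀ (stdVec j) l) - components gM.inner q x₀ i j)
    (T' := locLie (components (pullback h gN.inner) q) (locField q Y) x₀)
    (fun i j => (hd i j).sub_const _)
  have hT0 : (Matrix.of fun i j => (∑ k, ∑ l,
      components (pullback h gN.inner) q (Ψ (0, x₀)) k l
      * fderiv ℝ (fun y => Ψ (0, y)) x₀ (stdVec i) k
      * fderiv ℝ (fun y => Ψ (0, y)) x₀ (stdVec j) l) - components gM.inner q x₀ i j)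
      = components (pullback h gN.inner) q x₀ - components gM.inner q x₀ := by
    have hid : (fun y => Ψ (0, y)) =ᶠ[nhds x₀] id :=
      Filter.eventually_of_mem (extChartAt_target_mem_nhds' hx) fun x hx => by
        change extChartAt (𝓡 n) q (φ 0 ((extChartAt (𝓡 n) q).symm x)) = x
        rw [hφ.zero, (extChartAt (𝓡 n) q).right_inv hx]
    have h0 : Ψ (0, x₀) = x₀ := hid.self_of_nhds
    ext i j
    simp only [Matrix.of_apply, Matrix.sub_apply, hid.fderiv_eq, fderiv_id, h0,
      ContinuousLinearMap.id_apply]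
    simp [stdVec]
  rw [hT0] at hN
  refine hN.congr_of_eventuallyEq ?_
  have hcont : Continuous fun t => φ t p :=
    hφ.smooth.continuous.comp (continuous_id.prodMk continuous_const)
  have hp0 : φ 0 p ∈ (extChartAt (𝓡 n) q).source := by rw [hφ.zero]; exact hp
  filter_upwards [hcont.continuousAt.preimage_mem_nhds (extChartAt_source_mem_nhds_of_mem hp0)]
    with t ht
  exact energyDensity_eq hh hφ.smooth hp ht

end EnergyDensity

/-! ### The Riemannian volume in charts -/

section Volume

variable {n : ℕ}
variable {M : Type*} [TopologicalSpace M] [ChartedSpace (EuclideanSpace ℝ (Fin n)) M]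
  [MeasurableSpace M] [BorelSpace M]

local notation "𝔼" => EuclideanSpace ℝ (Fin n)

theorem aemeasurable_symm (g : TensorField02 n M) (q : M) :
    AEMeasurable (extChartAt (𝓡 n) q).symm
      ((volume.restrict (extChartAt (𝓡 n) q).target).withDensity
        fun x => ENNReal.ofReal √(components g q x).det) :=
  ((continuousOn_extChartAt_symm q).aemeasurable
    (isOpen_extChartAt_target q).measurableSet).mono_ac (withDensity_absolutelyContinuous _ _)

theorem chartVolume_apply (g : TensorField02 n M) (q : M) {A : Set M} (hA : MeasurableSet A) :
    chartVolume g q A = ∫⁻ x in (extChartAt (𝓡 n) q).target ∩ (extChartAt (𝓡 n) q).symm ⁻¹' A,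
      ENNReal.ofReal √(components g q x).det := by
  rw [chartVolume, Measure.map_apply_of_aemeasurable (aemeasurable_symm g q) hA,
    withDensity_apply', Measure.restrict_restrict' (isOpen_extChartAt_target q).measurableSet,
    Set.inter_comm]

theorem measurableSet_target_inter_preimage (q : M) {A : Set M} (hA : MeasurableSet A) :
    MeasurableSet ((extChartAt (𝓡 n) q).target ∩ (extChartAt (𝓡 n) q).symm ⁻¹' A) := by
  have h := (continuousOn_extChartAt_symm (I := 𝓡 n) q).domRestrict.measurable hA
  have h2 := (isOpen_extChartAt_target (I := 𝓡 n) q).measurableSet.subtype_image h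
  convert h2 using 1
  ext x
  simp [and_comm]

theorem chartVolume_inter_source (g : TensorField02 n M) (q : M) {A : Set M}
    (hA : MeasurableSet A) :
    chartVolume g q (A ∩ (extChartAt (𝓡 n) q).source) = chartVolume g q A := by
  rw [chartVolume_apply g q hA,
    chartVolume_apply g q (hA.inter (isOpen_extChartAt_source q).measurableSet)]
  congr 2
  ext x
  simp only [Set.mem_inter_iff, Set.mem_preimage]
  exact ⟨fun h => ⟨h.1, h.2.1⟩, fun h => ⟨h.1, h.2, (extChartAt (𝓡 n) q).map_target h.1⟩⟩

variable [IsManifold (𝓡 n) ∞ M]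

/-- The volumes of two charts agree on the overlap: this is the change of variables formula, since
`√(det g)` is multiplied by the absolute value of the Jacobian determinant. -/
theorem chartVolume_eq_of_subset (g : RiemMetric n M) (q q' : M) {A : Set M}
    (hA : MeasurableSet A) (hq : A ⊆ (extChartAt (𝓡 n) q).source)
    (hq' : A ⊆ (extChartAt (𝓡 n) q').source) :
    chartVolume g.inner q A = chartVolume g.inner q' A := by
  set S := (extChartAt (𝓡 n) q).target ∩ (extChartAt (𝓡 n) q).symm ⁻¹' A
  have himage : (extChartAt (𝓡 n) q').target ∩ (extChartAt (𝓡 n) q').symm ⁻¹' A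
      = transition q q' '' S := by
    ext y
    constructor
    · rintro ⟨hy, hyA⟩
      refine ⟨extChartAt (𝓡 n) q ((extChartAt (𝓡 n) q').symm y),
        ⟨(extChartAt (𝓡 n) q).map_source (hq hyA), ?_⟩, ?_⟩
      · rw [Set.mem_preimage, (extChartAt (𝓡 n) q).left_inv (hq hyA)]
        exact hyA
      · rw [transition, (extChartAt (𝓡 n) q).left_inv (hq hyA),
          (extChartAt (𝓡 n) q').right_inv hy]
    · rintro ⟨x, ⟨-, hxA⟩, rfl⟩
      refine ⟨(extChartAt (𝓡 n) q').map_source (hq' hxA), ?_⟩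
      rw [Set.mem_preimage, transition, (extChartAt (𝓡 n) q').left_inv (hq' hxA)]
      exact hxA
  have hinj : Set.InjOn (transition q q') S := by
    rintro x ⟨hx, hxA⟩ y ⟨hy, hyA⟩ hxy
    exact (extChartAt (𝓡 n) q).symm.injOn hx hy
      ((extChartAt (𝓡 n) q').injOn (hq' hxA) (hq' hyA) hxy)
  have hS : MeasurableSet S := measurableSet_target_inter_preimage q hA
  rw [chartVolume_apply _ q hA, chartVolume_apply _ q' hA, himage,
    lintegral_image_eq_lintegral_abs_det_fderiv_mul volume hS
      (f' := fun x => fderiv ℝ (transition q q') x)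
      (fun x hx => ((contDiffAt_transition hx.1 (hq' hx.2)).differentiableAt
        (by simp)).hasFDerivAt.hasFDerivWithinAt) hinj]
  refine setLIntegral_congr_fun hS fun x hx => ?_
  rw [components_change g.inner hx.1 (hq' hx.2), Matrix.det_mul, Matrix.det_mul,
    Matrix.det_transpose, det_jacobian, ← ENNReal.ofReal_mul (abs_nonneg _)]
  congr 1
  rw [mul_right_comm, Real.sqrt_mul (mul_self_nonneg _), Real.sqrt_mul_self_eq_abs]

variable [CompactSpace M]

/-- On the domain of a chart the Riemannian volume is the volume of that chart. -/
theorem riemannianVolume_restrict_source (g : RiemMetric n M) (q : M) :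
    (riemannianVolume g.inner).restrict (extChartAt (𝓡 n) q).source = chartVolume g.inner q := by
  obtain ⟨s, hs, hcover⟩ := countable_cover_nhds_of_sigmaCompact
    fun p : M => extChartAt_source_mem_nhds (I := 𝓡 n) p
  have hne : s.Nonempty := by
    by_contra h
    rw [Set.not_nonempty_iff_eq_empty.1 h] at hcover
    simpa using hcover.symm.subset (Set.mem_univ q)
  obtain ⟨c, rfl⟩ := hs.exists_eq_range hne
  rw [Set.biUnion_range] at hcover
  set S : ℕ → Set M := fun i => (extChartAt (𝓡 n) (c i)).source
  have hSm : ∀ i, MeasurableSet (disjointed S i) := fun i =>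
    MeasurableSet.disjointed (fun j => (isOpen_extChartAt_source (c j)).measurableSet) i
  -- Cut `M` into disjoint measurable pieces, each inside one chart domain, and use on each piece
  -- the volume of that chart: the resulting measure dominates the volumes of all charts.
  set ν : Measure M := Measure.sum fun i => (chartVolume g.inner (c i)).restrict (disjointed S i)
  have hν : ∀ (p : M) {A : Set M}, MeasurableSet A → A ⊆ (extChartAt (𝓡 n) p).source →
      ν A = chartVolume g.inner p A := by
    intro p A hA hAp
    have hU : A = ⋃ i, A ∩ disjointed S i := by
      rw [← Set.inter_iUnion, iUnion_disjointed, hcover, Set.inter_univ]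
    conv_rhs => rw [hU]
    rw [measure_iUnion (fun i j hij => (disjoint_disjointed S hij).mono Set.inter_subset_right
      Set.inter_subset_right) fun i => hA.inter (hSm i), Measure.sum_apply _ hA]
    refine tsum_congr fun i => ?_
    rw [Measure.restrict_apply hA]
    exact chartVolume_eq_of_subset g _ _ (hA.inter (hSm i))
      (Set.inter_subset_right.trans (disjointed_subset S i)) (Set.inter_subset_left.trans hAp)
  have hle : riemannianVolume g.inner ≤ ν := by
    refine iSup_le fun p => Measure.le_iff.2 fun A hA => ?_
    rw [← chartVolume_inter_source _ p hA,
      ← hν p (hA.inter (isOpen_extChartAt_source p).measurableSet) Set.inter_subset_right]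
    exact measure_mono Set.inter_subset_left
  ext A hA
  rw [Measure.restrict_apply hA, ← chartVolume_inter_source _ q hA]
  refine le_antisymm ?_ (le_iSup (fun p => chartVolume g.inner p) q _)
  rw [← hν q (hA.inter (isOpen_extChartAt_source q).measurableSet) Set.inter_subset_right]
  exact hle _

theorem isFiniteMeasure_riemannianVolume (g : RiemMetric n M) :
    IsFiniteMeasure (riemannianVolume g.inner) := by
  have hloc : IsLocallyFiniteMeasure (riemannianVolume g.inner) := by
    refine ⟨fun p => ?_⟩
    obtain ⟨r, hr, hsub⟩ := Metric.nhds_basis_closedBall.mem_iff.1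
      (extChartAt_target_mem_nhds (I := 𝓡 n) p)
    set U := (extChartAt (𝓡 n) p).source ∩ extChartAt (𝓡 n) p ⁻¹'
      Metric.ball (extChartAt (𝓡 n) p p) r
    have hU : IsOpen U := (continuousOn_extChartAt p).isOpen_inter_preimage
      (isOpen_extChartAt_source p) Metric.isOpen_ball
    refine ⟨U, hU.mem_nhds ⟨mem_extChartAt_source p, Metric.mem_ball_self hr⟩, ?_⟩
    have h1 : riemannianVolume g.inner U = chartVolume g.inner p U := by
      rw [← riemannianVolume_restrict_source, Measure.restrict_apply hU.measurableSet,
        Set.inter_eq_left.2 Set.inter_subset_left]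
    rw [h1, chartVolume_apply _ _ hU.measurableSet]
    have hcont : ContinuousOn (fun x => √(components g.inner p x).det)
        (Metric.closedBall (extChartAt (𝓡 n) p p) r) := fun x hx =>
      ((isMetricOn_metric g p).contDiffAt_sqrt_det (hsub hx)).continuousAt.continuousWithinAt
    refine (lintegral_mono_set ?_).trans_lt
      (hcont.integrableOn_compact (isCompact_closedBall _ _)).lintegral_lt_top
    rintro x ⟨hx, -, hx'⟩
    rw [Set.mem_preimage, (extChartAt (𝓡 n) p).right_inv hx] at hx'
    exact Metric.ball_subset_closedBall hx'
  have := isFiniteMeasureOnCompacts_of_isLocallyFiniteMeasure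
    (μ := riemannianVolume g.inner)
  exact CompactSpace.isFiniteMeasure

/-- Integration over a chart domain in coordinates. -/
theorem setIntegral_source (g : RiemMetric n M) (q : M) {F : M → ℝ}
    (hF : ContinuousOn F (extChartAt (𝓡 n) q).source) :
    ∫ p in (extChartAt (𝓡 n) q).source, F p ∂(riemannianVolume g.inner)
      = ∫ x in (extChartAt (𝓡 n) q).target,
        F ((extChartAt (𝓡 n) q).symm x) * √(components g.inner q x).det := by
  have hm : AEStronglyMeasurable F (chartVolume g.inner q) := by
    rw [← riemannianVolume_restrict_source]
    exact hF.aestronglyMeasurable (isOpen_extChartAt_source q).measurableSet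
  rw [riemannianVolume_restrict_source, chartVolume, integral_map (aemeasurable_symm _ q) hm,
    integral_withDensity_eq_integral_toReal_smul₀ _ (by simp)]
  · refine integral_congr_ae (.of_forall fun x => ?_)
    simp only [ENNReal.toReal_ofReal (Real.sqrt_nonneg _), smul_eq_mul]
    ring
  · have hcont : ContinuousOn (fun x => √(components g.inner q x).det)
        (extChartAt (𝓡 n) q).target := fun x hx =>
      ((isMetricOn_metric g q).contDiffAt_sqrt_det hx).continuousAt.continuousWithinAt
    exact (hcont.aemeasurable (isOpen_extChartAt_target q).measurableSet).ennreal_ofReal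

end Volume

/-! ### Vector fields supported in a chart and their flows -/

section ChartField

variable {n : ℕ}
variable {M : Type*} [TopologicalSpace M] [ChartedSpace (EuclideanSpace ℝ (Fin n)) M]

local notation "𝔼" => EuclideanSpace ℝ (Fin n)

open Classical in
/-- The vector field on `M` with coordinate representation `y` in the preferred chart at `q`,
extended by zero outside the chart domain. -/
noncomputable def chartField (q : M) (y : 𝔼 → 𝔼) (p : M) : TangentSpace (𝓡 n) p :=
  if p ∈ (extChartAt (𝓡 n) q).source then
    (dSymm q (extChartAt (𝓡 n) q p) (y (extChartAt (𝓡 n) q p)) : 𝔼)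
  else (0 : 𝔼)

theorem fieldVec_chartField {q p : M} (hp : p ∈ (extChartAt (𝓡 n) q).source) (y : 𝔼 → 𝔼) :
    fieldVec (chartField q y) p = dSymm q (extChartAt (𝓡 n) q p) (y (extChartAt (𝓡 n) q p)) :=
  if_pos hp

theorem fieldVec_chartField_of_notMem {q : M} {p : M}
    (y : 𝔼 → 𝔼) (hp : p ∉ (extChartAt (𝓡 n) q).symm '' tsupport y) :
    fieldVec (chartField q y) p = 0 := by
  by_cases hp' : p ∈ (extChartAt (𝓡 n) q).source
  · have h : y (extChartAt (𝓡 n) q p) = 0 := image_eq_zero_of_notMem_tsupport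
      fun h => hp ⟨_, h, (extChartAt (𝓡 n) q).left_inv hp'⟩
    rw [fieldVec_chartField hp', h, map_zero]
  · exact if_neg hp'

theorem isCompact_symm_image {q : M} {K : Set 𝔼} (hK : IsCompact K)
    (hsub : K ⊆ (extChartAt (𝓡 n) q).target) : IsCompact ((extChartAt (𝓡 n) q).symm '' K) :=
  hK.image_of_continuousOn ((continuousOn_extChartAt_symm q).mono hsub)

open Classical in
/-- The coordinate representation of a vector field, extended by zero outside the chart. -/
noncomputable def extField (q : M) (Y : (p : M) → TangentSpace (𝓡 n) p) (x : 𝔼) : 𝔼 :=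
  if x ∈ (extChartAt (𝓡 n) q).target then locField q Y x else 0

theorem extField_of_mem {q : M} {Y : (p : M) → TangentSpace (𝓡 n) p} {x : 𝔼}
    (hx : x ∈ (extChartAt (𝓡 n) q).target) : extField q Y x = locField q Y x := if_pos hx

theorem extField_of_notMem {q : M} {Y : (p : M) → TangentSpace (𝓡 n) p} {K : Set M}
    (h0 : ∀ p ∉ K, fieldVec Y p = 0) {x : 𝔼} (hx : x ∉ extChartAt (𝓡 n) q '' K) :
    extField q Y x = 0 := by
  by_cases hx' : x ∈ (extChartAt (𝓡 n) q).target
  · rw [extField_of_mem hx', locField, h0, map_zero]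
    exact fun h => hx ⟨_, h, (extChartAt (𝓡 n) q).right_inv hx'⟩
  · exact if_neg hx'

theorem isCompact_chart_image {q : M} {K : Set M} (hK : IsCompact K)
    (hKq : K ⊆ (extChartAt (𝓡 n) q).source) : IsCompact (extChartAt (𝓡 n) q '' K) :=
  hK.image_of_continuousOn ((continuousOn_extChartAt q).mono hKq)

theorem tsupport_extField_subset {q : M} {Y : (p : M) → TangentSpace (𝓡 n) p} {K : Set M}
    (hK : IsCompact K) (hKq : K ⊆ (extChartAt (𝓡 n) q).source) (h0 : ∀ p ∉ K, fieldVec Y p = 0) :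
    tsupport (extField q Y) ⊆ extChartAt (𝓡 n) q '' K :=
  closure_minimal (fun _ hx => by_contra fun h => hx (extField_of_notMem h0 h))
    (isCompact_chart_image hK hKq).isClosed

theorem hasCompactSupport_extField {q : M} {Y : (p : M) → TangentSpace (𝓡 n) p} {K : Set M}
    (hK : IsCompact K) (hKq : K ⊆ (extChartAt (𝓡 n) q).source) (h0 : ∀ p ∉ K, fieldVec Y p = 0) :
    HasCompactSupport (extField q Y) :=
  (isCompact_chart_image hK hKq).of_isClosed_subset (isClosed_tsupport _)
    (tsupport_extField_subset hK hKq h0)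

variable [IsManifold (𝓡 n) ∞ M]

theorem locField_chartField {q : M} {x : 𝔼} (hx : x ∈ (extChartAt (𝓡 n) q).target) (y : 𝔼 → 𝔼) :
    locField q (chartField q y) x = y x := by
  rw [locField, fieldVec_chartField ((extChartAt (𝓡 n) q).map_target hx),
    (extChartAt (𝓡 n) q).right_inv hx, dChart_dSymm hx]

/-- A vector field is smooth at every point near which it vanishes. -/
theorem contMDiffAt_field_of_eventually_zero {Y : (p : M) → TangentSpace (𝓡 n) p} {p : M}
    (h : ∀ᶠ p' in nhds p, fieldVec Y p' = 0) :
    ContMDiffAt (𝓡 n) (𝓡 n).tangent ∞ (fun p => (⟨p, Y p⟩ : TangentBundle (𝓡 n) M)) p := by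
  refine (contMDiffAt_field_iff (mem_extChartAt_source p)).2 ?_
  refine (contMDiffAt_const (c := (0 : 𝔼))).congr_of_eventuallyEq ?_
  filter_upwards [h] with p' hp'
  rw [hp', map_zero]

theorem isSmoothVectorField_chartField [T2Space M] {q : M} {y : 𝔼 → 𝔼} (hy : ContDiff ℝ ∞ y)
    (hs : HasCompactSupport y) (hsub : tsupport y ⊆ (extChartAt (𝓡 n) q).target) :
    IsSmoothVectorField (chartField q y) := by
  intro p
  by_cases hp : p ∈ (extChartAt (𝓡 n) q).source
  · refine (contMDiffAt_field_iff hp).2 ?_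
    refine (hy.contMDiff.contMDiffAt.comp p (contMDiffAt_chart hp)).congr_of_eventuallyEq ?_
    filter_upwards [extChartAt_source_mem_nhds_of_mem hp] with p' hp'
    rw [← locField_apply hp', locField_chartField ((extChartAt (𝓡 n) q).map_source hp')]
    rfl
  · refine contMDiffAt_field_of_eventually_zero ?_
    have hK := (isCompact_symm_image hs hsub).isClosed
    refine Filter.eventually_of_mem (hK.isOpen_compl.mem_nhds ?_) fun p' hp' =>
      fieldVec_chartField_of_notMem y hp'
    rintro ⟨x, hx, rfl⟩
    exact hp ((extChartAt (𝓡 n) q).map_target (hsub hx))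

variable {q : M} {Y : (p : M) → TangentSpace (𝓡 n) p} {K : Set M}

theorem contDiff_extField (hY : IsSmoothVectorField Y)
    (hK : IsCompact K) (hKq : K ⊆ (extChartAt (𝓡 n) q).source) (h0 : ∀ p ∉ K, fieldVec Y p = 0) :
    ContDiff ℝ ∞ (extField q Y) := by
  refine contDiff_iff_contDiffAt.2 fun x => ?_
  by_cases hx : x ∈ (extChartAt (𝓡 n) q).target
  · refine (contDiffAt_locField hY hx).congr_of_eventuallyEq ?_
    exact Filter.eventually_of_mem (extChartAt_target_mem_nhds' hx) fun y hy => extField_of_mem hy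
  · refine (contDiffAt_const (c := (0 : 𝔼))).congr_of_eventuallyEq ?_
    refine Filter.eventually_of_mem
      ((isCompact_chart_image hK hKq).isClosed.isOpen_compl.mem_nhds ?_)
      fun y hy => extField_of_notMem h0 hy
    rintro ⟨p, hp, rfl⟩
    exact hx ((extChartAt (𝓡 n) q).map_source (hKq hp))

/-- A smooth vector field supported in a chart domain has a global smooth flow: the flow in
coordinates preserves the range of the chart, and it is continued by the identity. -/
theorem exists_isFlow [T2Space M] (hY : IsSmoothVectorField Y)
    (hK : IsCompact K) (hKq : K ⊆ (extChartAt (𝓡 n) q).source) (h0 : ∀ p ∉ K, fieldVec Y p = 0) :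
    ∃ φ : ℝ → M → M, IsFlow Y φ := by
  classical
  have hf := contDiff_extField hY hK hKq h0
  have hfs := hasCompactSupport_extField hK hKq h0
  obtain ⟨Φ, hΦ, hΦ0, hΦd⟩ := exists_smooth_flow hf hfs
  obtain ⟨C, hC⟩ := (hf.of_le (m := 1) (mod_cast le_top)).lipschitzWith_of_hasCompactSupport hfs
    one_ne_zero
  -- Stationary points of the flow are not reached from elsewhere.
  have hstat : ∀ x t, extField q Y (Φ t x) = 0 → ∀ s, Φ s x = Φ t x := by
    intro x t hz s
    have := ODE_solution_unique_univ (v := fun _ => extField q Y) (s := fun _ => Set.univ)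
      (K := C) (t₀ := t) (f := fun s => Φ s x) (g := fun _ => Φ t x)
      (fun _ => hC.lipschitzOnWith) (fun s => ⟨hΦd x s, trivial⟩)
      (fun s => ⟨by rw [hz]; exact hasDerivAt_const s _, trivial⟩) rfl
    exact congrFun this s
  have htarget : ∀ x ∈ (extChartAt (𝓡 n) q).target, ∀ t, Φ t x ∈ (extChartAt (𝓡 n) q).target := by
    intro x hx t
    by_contra h
    have := hstat x t (if_neg h) 0
    rw [hΦ0] at this
    exact h (this ▸ hx)
  have hfix : ∀ x, extField q Y x = 0 → ∀ t, Φ t x = x := by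
    intro x hx t
    have := hstat x 0 (by rwa [hΦ0]) t
    rwa [hΦ0] at this
  set φ : ℝ → M → M := fun t p => if p ∈ (extChartAt (𝓡 n) q).source then
    (extChartAt (𝓡 n) q).symm (Φ t (extChartAt (𝓡 n) q p)) else p with hφdef
  have hφs : ∀ t, ∀ p ∈ (extChartAt (𝓡 n) q).source,
      φ t p = (extChartAt (𝓡 n) q).symm (Φ t (extChartAt (𝓡 n) q p)) := fun t p hp => if_pos hp
  have hφK : ∀ t, ∀ p ∉ K, φ t p = p := by
    intro t p hp
    by_cases hps : p ∈ (extChartAt (𝓡 n) q).source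
    · rw [hφs t p hps, hfix, (extChartAt (𝓡 n) q).left_inv hps]
      refine extField_of_notMem h0 ?_
      rintro ⟨p', hp', he⟩
      exact hp ((extChartAt (𝓡 n) q).injOn (hKq hp') hps he ▸ hp')
    · exact if_neg hps
  refine ⟨φ, ?_, ?_, ?_⟩
  · rintro ⟨t₀, p₀⟩
    by_cases hp : p₀ ∈ (extChartAt (𝓡 n) q).source
    · have hc : ContMDiffAt (𝓘(ℝ, ℝ).prod (𝓡 n)) 𝓘(ℝ, ℝ × 𝔼) ∞
          (fun z : ℝ × M => (z.1, extChartAt (𝓡 n) q z.2)) (t₀, p₀) :=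
        contMDiffAt_fst.prodMk_space ((contMDiffAt_chart hp).comp (t₀, p₀) contMDiffAt_snd)
      have hx := htarget _ ((extChartAt (𝓡 n) q).map_source hp) t₀
      refine ((contMDiffAt_symm hx).comp (t₀, p₀)
        (hΦ.contMDiff.contMDiffAt.comp (t₀, p₀) hc)).congr_of_eventuallyEq ?_
      filter_upwards [continuousAt_snd.preimage_mem_nhds (extChartAt_source_mem_nhds_of_mem hp)]
        with z hz
      exact hφs _ _ hz
    · refine (contMDiffAt_snd (n := ∞) (I := 𝓘(ℝ, ℝ)) (J := 𝓡 n)).congr_of_eventuallyEq ?_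
      filter_upwards [continuousAt_snd.preimage_mem_nhds
        (hK.isClosed.isOpen_compl.mem_nhds fun h => hp (hKq h))] with z hz
      exact hφK _ _ hz
  · intro p
    by_cases hp : p ∈ (extChartAt (𝓡 n) q).source
    · rw [hφs _ _ hp, hΦ0, (extChartAt (𝓡 n) q).left_inv hp]
    · exact if_neg hp
  · intro p
    by_cases hp : p ∈ (extChartAt (𝓡 n) q).source
    · rw [funext fun t => hφs t p hp]
      intro t
      have hx := htarget _ ((extChartAt (𝓡 n) q).map_source hp) t
      have h1 : HasMFDerivAt 𝓘(ℝ, ℝ) (𝓡 n)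
          (fun t => (extChartAt (𝓡 n) q).symm (Φ t (extChartAt (𝓡 n) q p))) t
          ((dSymm q (Φ t (extChartAt (𝓡 n) q p))).comp
            ((1 : ℝ →L[ℝ] ℝ).smulRight (extField q Y (Φ t (extChartAt (𝓡 n) q p))))) :=
        ((contMDiffAt_symm hx).mdifferentiableAt (by simp)).hasMFDerivAt.comp t
          (hΦd (extChartAt (𝓡 n) q p) t).hasFDerivAt.hasMFDerivAt
      have h2 : (dSymm q (Φ t (extChartAt (𝓡 n) q p))).comp
            ((1 : ℝ →L[ℝ] ℝ).smulRight (extField q Y (Φ t (extChartAt (𝓡 n) q p))))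
          = (1 : ℝ →L[ℝ] ℝ).smulRight (fieldVec Y ((extChartAt (𝓡 n) q).symm
            (Φ t (extChartAt (𝓡 n) q p)))) := by
        refine ContinuousLinearMap.ext_ring ?_
        have h3 := dSymm_dChart ((extChartAt (𝓡 n) q).map_target hx)
          (fieldVec Y ((extChartAt (𝓡 n) q).symm (Φ t (extChartAt (𝓡 n) q p))))
        rw [(extChartAt (𝓡 n) q).right_inv hx] at h3
        rw [ContinuousLinearMap.comp_apply, ContinuousLinearMap.smulRight_apply,
          ContinuousLinearMap.smulRight_apply, one_apply_eq_self, one_smul, one_smul,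
          extField_of_mem hx, locField, h3]
      exact h1.congr_mfderiv h2
    · rw [funext fun t => hφK t p fun h => hp (hKq h)]
      intro t
      have h1 : HasMFDerivAt 𝓘(ℝ, ℝ) (𝓡 n) (fun _ : ℝ => p) t (0 : ℝ →L[ℝ] 𝔼) :=
        hasMFDerivAt_const p t
      have h2 : (1 : ℝ →L[ℝ] ℝ).smulRight (fieldVec Y p) = 0 := by
        rw [h0 p fun h => hp (hKq h)]; simp
      rw [← h2] at h1
      exact h1

end ChartField

/-! ### The first variation density and the Euler-Lagrange field on the manifold -/

section FirstVariation

variable {n : ℕ}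

local notation "𝔼" => EuclideanSpace ℝ (Fin n)

theorem locVar_congr {G H : 𝔼 → Matrix (Fin n) (Fin n) ℝ} {Y Z : 𝔼 → 𝔼} {x : 𝔼}
    (h : Y =ᶠ[nhds x] Z) : locVar G H Y x = locVar G H Z x := by
  have h1 : ∀ k i, partialD (fun y => Y y k) x i = partialD (fun y => Z y k) x i := fun k i => by
    have h2 : (fun y => Y y k) =ᶠ[nhds x] fun y => Z y k := h.mono fun y hy => by simp only [hy]
    rw [partialD, partialD, h2.fderiv_eq]
  simp only [locVar, locLie, h1, h.self_of_nhds]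

theorem locVar_sum {ι : Type*} [Fintype ι] {G H : 𝔼 → Matrix (Fin n) (Fin n) ℝ}
    {Y : ι → 𝔼 → 𝔼} {x : 𝔼} (hY : ∀ a, DifferentiableAt ℝ (Y a) x) :
    locVar G H (fun y => ∑ a, Y a y) x = ∑ a, locVar G H (Y a) x := by
  have h1 : ∀ k i, partialD (fun y => (∑ a, Y a y) k) x i
      = ∑ a, partialD (fun y => Y a y k) x i := fun k i => by
    have h2 : (fun y => (∑ a, Y a y) k) = fun y => ∑ a, Y a y k := by
      funext y; simp
    rw [h2, partialD_sum fun a => differentiableAt_euclidean.1 (hY a) k]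
  have h3 : ∀ i j, locLie H (fun y => ∑ a, Y a y) x i j = ∑ a, locLie H (Y a) x i j := by
    intro i j
    have h4 : ∀ k, (∑ a, Y a x) k = ∑ a, Y a x k := fun k => by simp
    simp only [locLie, h1, h4, Finset.mul_sum, Finset.sum_mul, Finset.sum_add_distrib]
    exact congrArg₂ _ (congrArg₂ _ Finset.sum_comm Finset.sum_comm) Finset.sum_comm
  simp only [locVar, h3, Finset.mul_sum]
  exact (Finset.sum_congr rfl fun _ _ => Finset.sum_comm).trans Finset.sum_comm

variable {M : Type*} [TopologicalSpace M] [ChartedSpace (EuclideanSpace ℝ (Fin n)) M]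
  [IsManifold (𝓡 n) ∞ M]
variable {N : Type*} [TopologicalSpace N] [ChartedSpace (EuclideanSpace ℝ (Fin n)) N]
  [IsManifold (𝓡 n) ∞ N]
variable (gM : RiemMetric n M) (gN : RiemMetric n N) (h : M ≃ₘ^∞⟮𝓡 n, 𝓡 n⟯ N)

/-- The density of the first variation of the energy in the direction `Y`, at each point computed
in the preferred chart there. -/
noncomputable def varDensity (Y : (p : M) → TangentSpace (𝓡 n) p) (p : M) : ℝ :=
  locVar (components gM.inner p) (components (pullback h gN.inner) p) (locField p Y)
    (extChartAt (𝓡 n) p p)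

/-- The Euler-Lagrange field computed in the preferred chart at `q`, as a vector field on the domain
of that chart; outside the domain its values are meaningless. -/
noncomputable def elChart (q p : M) : 𝔼 :=
  dSymm q (extChartAt (𝓡 n) q p) (WithLp.toLp 2 (locEL (components gM.inner q)
    (components (pullback h gN.inner) q) (extChartAt (𝓡 n) q p)))

theorem eulerLagrangeField_eq (p : M) : eulerLagrangeField gM gN h p = elChart gM gN h p p := by
  have h1 : elChart gM gN h p p = WithLp.toLp 2 (locEL (components gM.inner p)
      (components (pullback h gN.inner) p) (extChartAt (𝓡 n) p p)) := by
    have h2 := dSymm_dChart (mem_extChartAt_source (I := 𝓡 n) p)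
      (WithLp.toLp 2 (locEL (components gM.inner p)
        (components (pullback h gN.inner) p) (extChartAt (𝓡 n) p p)))
    rw [dChart_self] at h2
    exact h2
  rw [h1]
  rfl

variable {gM gN h}

theorem dChart_elChart {q p : M} (hp : p ∈ (extChartAt (𝓡 n) q).source) :
    dChart q p (elChart gM gN h q p) = WithLp.toLp 2 (locEL (components gM.inner q)
      (components (pullback h gN.inner) q) (extChartAt (𝓡 n) q p)) := by
  have h1 := dChart_dSymm ((extChartAt (𝓡 n) q).map_source hp)
    (WithLp.toLp 2 (locEL (components gM.inner q)
      (components (pullback h gN.inner) q) (extChartAt (𝓡 n) q p)))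
  rwa [(extChartAt (𝓡 n) q).left_inv hp] at h1

/-- A bilinear form evaluated on two tangent vectors, in coordinates. -/
theorem tensorForm_eq_sum (T : TensorField02 n M) {q p : M}
    (hp : p ∈ (extChartAt (𝓡 n) q).source) (v w : 𝔼) :
    tensorForm T p v w = ∑ k, ∑ l, components T q (extChartAt (𝓡 n) q p) k l
      * dChart q p v k * dChart q p w l := by
  have h1 := tensorForm_dSymm T q (extChartAt (𝓡 n) q p) (dChart q p v) (dChart q p w)
  rwa [dSymm_dChart hp, dSymm_dChart hp, (extChartAt (𝓡 n) q).left_inv hp] at h1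

theorem tensorForm_elChart {q p : M} (hp : p ∈ (extChartAt (𝓡 n) q).source)
    (Y : (p : M) → TangentSpace (𝓡 n) p) :
    tensorForm (pullback h gN.inner) p (elChart gM gN h q p) (fieldVec Y p)
      = locPairing (components gM.inner q) (components (pullback h gN.inner) q) (locField q Y)
        (extChartAt (𝓡 n) q p) := by
  rw [tensorForm_eq_sum _ hp, dChart_elChart hp, ← locField_apply hp]
  rfl

/-- In every chart the density of the first variation is given by the same formula, because it is
the derivative of the energy density along a flow. -/
theorem varDensity_eq {Y : (p : M) → TangentSpace (𝓡 n) p} (hY : IsSmoothVectorField Y)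
    {φ : ℝ → M → M} (hφ : IsFlow Y φ) {q p : M} (hp : p ∈ (extChartAt (𝓡 n) q).source) :
    varDensity gM gN h Y p = locVar (components gM.inner q) (components (pullback h gN.inner) q)
      (locField q Y) (extChartAt (𝓡 n) q p) :=
  (hasDerivAt_energyDensity h.contMDiff (isMetricOn_pullback gN h) hY hφ
    (mem_extChartAt_source p)).unique
    (hasDerivAt_energyDensity h.contMDiff (isMetricOn_pullback gN h) hY hφ hp)

theorem varDensity_eq_zero {Y : (p : M) → TangentSpace (𝓡 n) p} {K : Set M} (hK : IsClosed K)
    (h0 : ∀ p ∉ K, fieldVec Y p = 0) {p : M} (hp : p ∉ K) : varDensity gM gN h Y p = 0 := by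
  refine locVar_eq_zero (notMem_tsupport_iff_eventuallyEq.2 ?_)
  have hc := (contMDiffAt_symm (mem_extChartAt_target (I := 𝓡 n) p)).continuousAt
  have hKp : Kᶜ ∈ nhds ((extChartAt (𝓡 n) p).symm (extChartAt (𝓡 n) p p)) := by
    rw [extChartAt_to_inv]
    exact hK.isOpen_compl.mem_nhds hp
  filter_upwards [hc.preimage_mem_nhds hKp] with x hx
  rw [locField, h0 _ hx, map_zero]
  rfl

section ChartSupport

variable {q : M} {Y : (p : M) → TangentSpace (𝓡 n) p} {K : Set M}

theorem continuousOn_varDensity (hY : IsSmoothVectorField Y) {φ : ℝ → M → M} (hφ : IsFlow Y φ)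
    (q : M) : ContinuousOn (varDensity gM gN h Y) (extChartAt (𝓡 n) q).source := by
  have h1 : ContinuousOn (fun p => locVar (components gM.inner q)
      (components (pullback h gN.inner) q) (locField q Y) (extChartAt (𝓡 n) q p))
      (extChartAt (𝓡 n) q).source := fun p hp => by
    have hx := (extChartAt (𝓡 n) q).map_source hp
    exact (ContinuousAt.comp (f := extChartAt (𝓡 n) q)
      (contDiffAt_locVar (isMetricOn_metric gM q) (isMetricOn_pullback gN h q) hx
      (contDiffAt_locField hY hx)).continuousAt
      (contMDiffAt_chart hp).continuousAt).continuousWithinAt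
  exact h1.congr fun p hp => varDensity_eq hY hφ hp

theorem continuousOn_tensorForm_elChart (hY : IsSmoothVectorField Y) (q : M) :
    ContinuousOn (fun p => tensorForm (pullback h gN.inner) p (elChart gM gN h q p) (fieldVec Y p))
      (extChartAt (𝓡 n) q).source := by
  have h1 : ContinuousOn (fun p => locPairing (components gM.inner q)
      (components (pullback h gN.inner) q) (locField q Y) (extChartAt (𝓡 n) q p))
      (extChartAt (𝓡 n) q).source := fun p hp => by
    have hx := (extChartAt (𝓡 n) q).map_source hp
    exact (ContinuousAt.comp (f := extChartAt (𝓡 n) q)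
      (contDiffAt_locPairing (isMetricOn_metric gM q) (isMetricOn_pullback gN h q) hx
      (contDiffAt_locField hY hx)).continuousAt
      (contMDiffAt_chart hp).continuousAt).continuousWithinAt
  exact h1.congr fun p hp => tensorForm_elChart hp Y

variable [T2Space M] [CompactSpace M] [MeasurableSpace M] [BorelSpace M]

theorem integrable_varDensity (hY : IsSmoothVectorField Y) (hK : IsCompact K)
    (hKq : K ⊆ (extChartAt (𝓡 n) q).source) (h0 : ∀ p ∉ K, fieldVec Y p = 0) :
    Integrable (varDensity gM gN h Y) (riemannianVolume gM.inner) := by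
  have := isFiniteMeasure_riemannianVolume gM
  obtain ⟨φ, hφ⟩ := exists_isFlow hY hK hKq h0
  exact (continuous_of_support_subset (isOpen_extChartAt_source q) hK.isClosed hKq
    (continuousOn_varDensity hY hφ q) fun p hp =>
      varDensity_eq_zero hK.isClosed h0 hp).integrable_of_hasCompactSupport
    (HasCompactSupport.of_compactSpace _)

theorem integrable_tensorForm_elChart (hY : IsSmoothVectorField Y) (hK : IsCompact K)
    (hKq : K ⊆ (extChartAt (𝓡 n) q).source) (h0 : ∀ p ∉ K, fieldVec Y p = 0) :
    Integrable (fun p => tensorForm (pullback h gN.inner) p (elChart gM gN h q p) (fieldVec Y p))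
      (riemannianVolume gM.inner) := by
  have := isFiniteMeasure_riemannianVolume gM
  exact (continuous_of_support_subset (isOpen_extChartAt_source q) hK.isClosed hKq
    (continuousOn_tensorForm_elChart hY q) fun p hp => by
      rw [h0 p hp, map_zero]).integrable_of_hasCompactSupport
    (HasCompactSupport.of_compactSpace _)

/-- The integrated first variation formula for a vector field supported in a chart domain. -/
theorem integral_varDensity_chart (hY : IsSmoothVectorField Y) (hK : IsCompact K)
    (hKq : K ⊆ (extChartAt (𝓡 n) q).source) (h0 : ∀ p ∉ K, fieldVec Y p = 0) :
    ∫ p, varDensity gM gN h Y p ∂(riemannianVolume gM.inner)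
      = -4 * ∫ p, tensorForm (pullback h gN.inner) p (elChart gM gN h q p) (fieldVec Y p)
        ∂(riemannianVolume gM.inner) := by
  obtain ⟨φ, hφ⟩ := exists_isFlow hY hK hKq h0
  have hU := isOpen_extChartAt_target (I := 𝓡 n) q
  have h1 := setIntegral_source gM q
    (continuousOn_varDensity (h := h) (gN := gN) (gM := gM) hY hφ q)
  have h2 := setIntegral_source gM q
    (continuousOn_tensorForm_elChart (h := h) (gN := gN) (gM := gM) hY q)
  rw [setIntegral_eq_integral_of_forall_compl_eq_zero fun p hp =>
    varDensity_eq_zero hK.isClosed h0 fun hp' => hp (hKq hp')] at h1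
  rw [setIntegral_eq_integral_of_forall_compl_eq_zero fun p hp => by
    rw [h0 p fun hp' => hp (hKq hp'), map_zero]] at h2
  have h3 := integral_locVar hU (isMetricOn_metric gM q) (isMetricOn_pullback gN h q)
    (contDiff_extField hY hK hKq h0) (hasCompactSupport_extField hK hKq h0)
    ((tsupport_extField_subset hK hKq h0).trans (by
      rintro _ ⟨p, hp, rfl⟩
      exact (extChartAt (𝓡 n) q).map_source (hKq hp)))
  rw [h1, h2]
  refine (setIntegral_congr_fun hU.measurableSet fun x hx => ?_).trans
    (h3.trans (congrArg _ (setIntegral_congr_fun hU.measurableSet fun x hx => ?_)))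
  · simp only [varDensity_eq hY hφ ((extChartAt (𝓡 n) q).map_target hx),
      (extChartAt (𝓡 n) q).right_inv hx]
    rw [locVar_congr (Filter.eventually_of_mem (extChartAt_target_mem_nhds' hx) fun y hy =>
      (extField_of_mem hy).symm)]
  · simp only [tensorForm_elChart ((extChartAt (𝓡 n) q).map_target hx),
      (extChartAt (𝓡 n) q).right_inv hx, locPairing, extField_of_mem hx]

end ChartSupport

end FirstVariation

/-! ### Independence of the chart and the global first variation formula -/

section Globalization

variable {n : ℕ}
variable {M : Type*} [TopologicalSpace M] [ChartedSpace (EuclideanSpace ℝ (Fin n)) M]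
  [IsManifold (𝓡 n) ∞ M]
variable {N : Type*} [TopologicalSpace N] [ChartedSpace (EuclideanSpace ℝ (Fin n)) N]
  [IsManifold (𝓡 n) ∞ N]
variable {gM : RiemMetric n M} {gN : RiemMetric n N} {h : M ≃ₘ^∞⟮𝓡 n, 𝓡 n⟯ N}

local notation "𝔼" => EuclideanSpace ℝ (Fin n)

/-- The coordinates in the chart at `q` of the Euler-Lagrange field computed in the chart at `q'`
depend continuously on the point. -/
theorem continuousAt_dChart_elChart {q q' : M} {x : 𝔼} (hx : x ∈ (extChartAt (𝓡 n) q).target)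
    (hx' : (extChartAt (𝓡 n) q).symm x ∈ (extChartAt (𝓡 n) q').source) :
    ContinuousAt (fun y => dChart q ((extChartAt (𝓡 n) q).symm y)
      (elChart gM gN h q' ((extChartAt (𝓡 n) q).symm y))) x := by
  have hc := (contMDiffAt_symm hx).continuousAt
  have hτ := (contDiffAt_transition hx hx').continuousAt
  have hy : transition q q' x ∈ (extChartAt (𝓡 n) q').target := (extChartAt (𝓡 n) q').map_source hx'
  have hsymm : ∀ y, (extChartAt (𝓡 n) q).symm y ∈ (extChartAt (𝓡 n) q').source →
      (extChartAt (𝓡 n) q').symm (transition q q' y) = (extChartAt (𝓡 n) q).symm y :=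
    fun y hy => (extChartAt (𝓡 n) q').left_inv hy
  have h1 : ContinuousAt (fun z => fderiv ℝ (transition q' q) z (WithLp.toLp 2
      (locEL (components gM.inner q') (components (pullback h gN.inner) q') z)))
      (transition q q' x) := by
    refine ContinuousAt.clm_apply ?_ ?_
    · refine ((contDiffAt_transition hy ?_).fderiv_right (m := ∞) (by simp)).continuousAt
      rw [hsymm x hx']
      exact (extChartAt (𝓡 n) q).map_target hx
    · exact (contDiffAt_euclidean.2 fun j => contDiffAt_locEL (isMetricOn_metric gM q')
        (isMetricOn_pullback gN h q') hy j).continuousAt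
  refine (ContinuousAt.comp (f := transition q q') h1 hτ).congr ?_
  filter_upwards [extChartAt_target_mem_nhds' hx,
    hc.preimage_mem_nhds (extChartAt_source_mem_nhds_of_mem hx')] with y hy hy'
  have hs := hsymm y hy'
  have hq : (extChartAt (𝓡 n) q').symm (transition q q' y) ∈ (extChartAt (𝓡 n) q).source := by
    rw [hs]; exact (extChartAt (𝓡 n) q).map_target hy
  have hz : transition q q' y ∈ (extChartAt (𝓡 n) q').target := (extChartAt (𝓡 n) q').map_source hy'
  rw [Function.comp_apply, fderiv_transition hz hq, hs]
  rfl

section Localization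

variable [T2Space M] [CompactSpace M] [MeasurableSpace M] [BorelSpace M]

/-- The fundamental lemma of the calculus of variations for a vector field `E` on a part of a chart
domain, tested with the smooth vector fields supported there. -/
theorem eq_zero_of_integral_tensorForm_eq_zero {q : M} {O : Set 𝔼} (hO : IsOpen O)
    (hOq : O ⊆ (extChartAt (𝓡 n) q).target) {E : M → 𝔼}
    (hE : ∀ x ∈ O, ContinuousAt (fun y => dChart q ((extChartAt (𝓡 n) q).symm y)
      (E ((extChartAt (𝓡 n) q).symm y))) x)
    (hint : ∀ (Y : (p : M) → TangentSpace (𝓡 n) p) (K : Set M), IsSmoothVectorField Y →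
      IsCompact K → K ⊆ (extChartAt (𝓡 n) q).symm '' O → (∀ p ∉ K, fieldVec Y p = 0) →
      ∫ p, tensorForm (pullback h gN.inner) p (E p) (fieldVec Y p)
        ∂(riemannianVolume gM.inner) = 0)
    {x : 𝔼} (hx : x ∈ O) : E ((extChartAt (𝓡 n) q).symm x) = 0 := by
  set G := components gM.inner q
  set H := components (pullback h gN.inner) q
  set W : 𝔼 → Fin n → ℝ := fun y j => dChart q ((extChartAt (𝓡 n) q).symm y)
      (E ((extChartAt (𝓡 n) q).symm y)) j with hWdef
  have hG : IsMetricOn G (extChartAt (𝓡 n) q).target := isMetricOn_metric gM q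
  have hH : IsMetricOn H (extChartAt (𝓡 n) q).target := isMetricOn_pullback gN h q
  have hWc : ∀ x ∈ O, ∀ j, ContinuousAt (fun y => W y j) x := fun x hx j =>
    ContinuousAt.comp (g := fun v : 𝔼 => v j) (by fun_prop) (hE x hx)
  have hHc : ∀ x ∈ O, ∀ i j, ContinuousAt (fun y => H y i j) x := fun x hx i j =>
    (hH.smooth x (hOq hx) i j).continuousAt
  have hW : ∀ x ∈ O, W x = 0 := by
    refine eq_zero_of_integral_pairing_eq_zero hO hHc (fun x hx => (hH.det_pos x (hOq hx)).ne')
      (w := fun x => √(G x).det)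
      (fun x hx => (hG.contDiffAt_sqrt_det (hOq hx)).continuousAt)
      (fun x hx => (Real.sqrt_pos.2 (hG.det_pos x (hOq hx))).ne') hWc fun m f hf hfs hfO => ?_
    set y : 𝔼 → 𝔼 := fun x => f x • stdVec m
    have hy : ContDiff ℝ ∞ y := hf.smul contDiff_const
    have hyf : tsupport y ⊆ tsupport f := tsupport_smul_subset_left f fun _ => stdVec m
    have hys : HasCompactSupport y := hfs.smul_right
    have hyq : tsupport y ⊆ (extChartAt (𝓡 n) q).target := (hyf.trans hfO).trans hOq
    set K := (extChartAt (𝓡 n) q).symm '' tsupport y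
    have hK : IsCompact K := isCompact_symm_image hys hyq
    have hKO : K ⊆ (extChartAt (𝓡 n) q).symm '' O := Set.image_mono (hyf.trans hfO)
    have h0 : ∀ p ∉ K, fieldVec (chartField q y) p = 0 := fun p hp =>
      fieldVec_chartField_of_notMem y hp
    have hKq : K ⊆ (extChartAt (𝓡 n) q).source := by
      rintro _ ⟨x, hx, rfl⟩
      exact (extChartAt (𝓡 n) q).map_target (hyq hx)
    have hform : ∀ p ∈ (extChartAt (𝓡 n) q).source,
        tensorForm (pullback h gN.inner) p (E p) (fieldVec (chartField q y) p)
          = f (extChartAt (𝓡 n) q p)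
            * ∑ j, H (extChartAt (𝓡 n) q p) j m * W (extChartAt (𝓡 n) q p) j := by
      intro p hp
      rw [tensorForm_eq_sum _ hp, ← locField_apply hp,
        locField_chartField ((extChartAt (𝓡 n) q).map_source hp), Finset.mul_sum]
      refine Finset.sum_congr rfl fun j _ => ?_
      rw [Finset.sum_eq_single m]
      · simp only [y, stdVec, PiLp.smul_apply, PiLp.single_apply, if_true, smul_eq_mul,
          mul_one, hWdef, (extChartAt (𝓡 n) q).left_inv hp]
        ring
      · intro l _ hl
        simp [y, stdVec, hl]
      · simp
    set U := (extChartAt (𝓡 n) q).source ∩ extChartAt (𝓡 n) q ⁻¹' O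
    have hU : IsOpen U := (continuousOn_extChartAt q).isOpen_inter_preimage
      (isOpen_extChartAt_source q) hO
    have hKU : K ⊆ U := by
      intro p hp
      obtain ⟨x, hx, rfl⟩ := hKO hp
      refine ⟨hKq hp, ?_⟩
      rw [Set.mem_preimage, (extChartAt (𝓡 n) q).right_inv (hOq hx)]
      exact hx
    have hcont : Continuous fun p =>
        tensorForm (pullback h gN.inner) p (E p) (fieldVec (chartField q y) p) := by
      refine continuous_of_support_subset hU hK.isClosed hKU ?_ fun p hp => by
        rw [h0 p hp, map_zero]
      have hk : ContinuousOn (fun p => f (extChartAt (𝓡 n) q p)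
          * ∑ j, H (extChartAt (𝓡 n) q p) j m * W (extChartAt (𝓡 n) q p) j) U := fun p hp => by
        have hk' : ContinuousAt (fun x => f x * ∑ j, H x j m * W x j) (extChartAt (𝓡 n) q p) :=
          hf.continuous.continuousAt.mul (tendsto_finsetSum _ fun j _ =>
            (hHc _ hp.2 j m).mul (hWc _ hp.2 j))
        exact (ContinuousAt.comp (f := extChartAt (𝓡 n) q) hk'
          (contMDiffAt_chart hp.1).continuousAt).continuousWithinAt
      exact hk.congr fun p hp => hform p hp.1
    have h1 := hint _ K (isSmoothVectorField_chartField hy hys hyq) hK hKO h0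
    rw [← setIntegral_eq_integral_of_forall_compl_eq_zero fun p hp => by
      rw [h0 p fun hp' => hp (hKq hp'), map_zero],
      setIntegral_source gM q hcont.continuousOn] at h1
    rw [← setIntegral_eq_integral_of_forall_compl_eq_zero
      (s := (extChartAt (𝓡 n) q).target) fun x hx => by
      rw [image_eq_zero_of_notMem_tsupport fun h' => hx (hOq (hfO h')), zero_mul], ← h1]
    refine setIntegral_congr_fun (isOpen_extChartAt_target q).measurableSet fun x hx => ?_
    simp only [hform _ ((extChartAt (𝓡 n) q).map_target hx), (extChartAt (𝓡 n) q).right_inv hx]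
    ring
  have h1 : dChart q ((extChartAt (𝓡 n) q).symm x) (E ((extChartAt (𝓡 n) q).symm x)) = 0 := by
    ext j
    exact congrFun (hW x hx) j
  have h2 := dSymm_dChart ((extChartAt (𝓡 n) q).map_target (hOq hx))
    (E ((extChartAt (𝓡 n) q).symm x))
  rw [← h2, h1, map_zero]

/-- The Euler-Lagrange fields computed in two charts agree on the overlap, because both represent
the first variation of the energy. -/
theorem elChart_eq {q q' p : M} (hp : p ∈ (extChartAt (𝓡 n) q).source)
    (hp' : p ∈ (extChartAt (𝓡 n) q').source) : elChart gM gN h q p = elChart gM gN h q' p := by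
  set O := (extChartAt (𝓡 n) q).target ∩
    (extChartAt (𝓡 n) q).symm ⁻¹' (extChartAt (𝓡 n) q').source
  have hO : IsOpen O := (continuousOn_extChartAt_symm q).isOpen_inter_preimage
    (isOpen_extChartAt_target q) (isOpen_extChartAt_source q')
  have hx : extChartAt (𝓡 n) q p ∈ O := by
    refine ⟨(extChartAt (𝓡 n) q).map_source hp, ?_⟩
    rw [Set.mem_preimage, (extChartAt (𝓡 n) q).left_inv hp]
    exact hp'
  have h1 := eq_zero_of_integral_tensorForm_eq_zero (gM := gM) (gN := gN) (h := h) hO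
    Set.inter_subset_left (E := fun p => elChart gM gN h q p - elChart gM gN h q' p) ?_ ?_ hx
  · rw [(extChartAt (𝓡 n) q).left_inv hp] at h1
    exact sub_eq_zero.1 h1
  · intro x hx
    simp only [map_sub]
    exact (continuousAt_dChart_elChart hx.1 ((extChartAt (𝓡 n) q).map_target hx.1)).sub
      (continuousAt_dChart_elChart hx.1 hx.2)
  · intro Y K hY hK hKO h0
    have hKq : K ⊆ (extChartAt (𝓡 n) q).source := fun p hp => by
      obtain ⟨x, hx, rfl⟩ := hKO hp
      exact (extChartAt (𝓡 n) q).map_target hx.1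
    have hKq' : K ⊆ (extChartAt (𝓡 n) q').source := fun p hp => by
      obtain ⟨x, hx, rfl⟩ := hKO hp
      exact hx.2
    have h2 := integral_varDensity_chart (gM := gM) (gN := gN) (h := h) hY hK hKq h0
    have h3 := integral_varDensity_chart (gM := gM) (gN := gN) (h := h) hY hK hKq' h0
    have h4 := integral_sub (integrable_tensorForm_elChart (gM := gM) (gN := gN) (h := h)
      hY hK hKq h0) (integrable_tensorForm_elChart (gM := gM) (gN := gN) (h := h) hY hK hKq' h0)
    simp only [map_sub, _root_.sub_apply]
    rw [h4]
    linarith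

theorem tensorForm_eulerLagrangeField {q p : M} (hp : p ∈ (extChartAt (𝓡 n) q).source) (v : 𝔼) :
    tensorForm (pullback h gN.inner) p (fieldVec (eulerLagrangeField gM gN h) p) v
      = tensorForm (pullback h gN.inner) p (elChart gM gN h q p) v := by
  rw [fieldVec, eulerLagrangeField_eq, elChart_eq hp (mem_extChartAt_source p)]

end Localization

/-- A smooth function times a smooth vector field is smooth. -/
theorem isSmoothVectorField_smul {Y : (p : M) → TangentSpace (𝓡 n) p} (hY : IsSmoothVectorField Y)
    {f : M → ℝ} (hf : ContMDiff (𝓡 n) 𝓘(ℝ, ℝ) ∞ f) : IsSmoothVectorField fun p => f p • Y p := by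
  intro p
  refine (contMDiffAt_field_iff (mem_extChartAt_source p)).2 ?_
  have h1 := hf.contMDiffAt.smul ((contMDiffAt_field_iff (mem_extChartAt_source p)).1 (hY p))
  refine h1.congr_of_eventuallyEq (.of_forall fun p' => ?_)
  exact (dChart p p').map_smul (f p') (fieldVec Y p')

variable [T2Space M] [CompactSpace M]

/-- Every smooth vector field on a compact manifold is a finite sum of smooth vector fields with
supports in chart domains. -/
theorem exists_finite_decomposition {Y : (p : M) → TangentSpace (𝓡 n) p}
    (hY : IsSmoothVectorField Y) :
    ∃ (t : Finset M) (Z : t → (p : M) → TangentSpace (𝓡 n) p),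
      (∀ i, IsSmoothVectorField (Z i)) ∧
      (∀ i : t, ∃ K : Set M, IsCompact K ∧ K ⊆ (extChartAt (𝓡 n) (i : M)).source ∧
        ∀ p ∉ K, fieldVec (Z i) p = 0) ∧
      ∀ p, fieldVec Y p = ∑ i, fieldVec (Z i) p := by
  obtain ⟨t, -, ht⟩ := isCompact_univ.elim_nhds_subcover
    (fun p : M => (extChartAt (𝓡 n) p).source) fun p _ => extChartAt_source_mem_nhds p
  obtain ⟨ρ, hρ⟩ := SmoothPartitionOfUnity.exists_isSubordinate (𝓡 n) isClosed_univ
    (fun i : t => (extChartAt (𝓡 n) (i : M)).source) (fun i => isOpen_extChartAt_source _) (by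
      rwa [Set.iUnion_subtype])
  refine ⟨t, fun i p => ρ i p • Y p, fun i => isSmoothVectorField_smul hY (ρ i).contMDiff,
    fun i => ⟨tsupport (ρ i), (isClosed_tsupport _).isCompact, hρ i, fun p hp => ?_⟩, fun p => ?_⟩
  · change ρ i p • fieldVec Y p = 0
    rw [image_eq_zero_of_notMem_tsupport hp, zero_smul]
  · have h1 := ρ.sum_eq_one (Set.mem_univ p)
    rw [finsum_eq_sum_of_fintype] at h1
    change fieldVec Y p = ∑ i, ρ i p • fieldVec Y p
    rw [← Finset.sum_smul, h1, one_smul]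

variable [MeasurableSpace M] [BorelSpace M]

/-- The integrated first variation formula for an arbitrary smooth vector field. -/
theorem integral_varDensity {Y : (p : M) → TangentSpace (𝓡 n) p} (hY : IsSmoothVectorField Y) :
    ∫ p, varDensity gM gN h Y p ∂(riemannianVolume gM.inner)
      = -4 * ∫ p, tensorForm (pullback h gN.inner) p (fieldVec (eulerLagrangeField gM gN h) p)
        (fieldVec Y p) ∂(riemannianVolume gM.inner) := by
  obtain ⟨t, Z, hZ, hK, hsum⟩ := exists_finite_decomposition hY
  choose K hK hKq h0 using hK
  have h1 : ∀ p, varDensity gM gN h Y p = ∑ i, varDensity gM gN h (Z i) p := by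
    intro p
    have hx := mem_extChartAt_target (I := 𝓡 n) p
    have h2 : locField p Y = fun x => ∑ i, locField p (Z i) x := by
      funext x
      simp only [locField, hsum, map_sum]
    simp only [varDensity]
    rw [h2, locVar_sum fun i => (contDiffAt_locField (hZ i) hx).differentiableAt (by simp)]
  have h2 : ∀ i, (fun p => tensorForm (pullback h gN.inner) p
      (fieldVec (eulerLagrangeField gM gN h) p) (fieldVec (Z i) p))
      = fun p => tensorForm (pullback h gN.inner) p (elChart gM gN h i p) (fieldVec (Z i) p) := by
    intro i
    funext p
    by_cases hp : p ∈ (extChartAt (𝓡 n) (i : M)).source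
    · exact tensorForm_eulerLagrangeField hp _
    · rw [h0 i p fun hp' => hp (hKq i hp'), map_zero, map_zero]
  simp only [h1, hsum, map_sum]
  rw [integral_finsetSum _ fun i _ => integrable_varDensity (hZ i) (hK i) (hKq i) (h0 i),
    integral_finsetSum _ fun i _ => by
      rw [h2 i]; exact integrable_tensorForm_elChart (hZ i) (hK i) (hKq i) (h0 i),
    Finset.mul_sum]
  refine Finset.sum_congr rfl fun i _ => ?_
  rw [h2 i, integral_varDensity_chart (hZ i) (hK i) (hKq i) (h0 i)]

end Globalization

/-! ### Differentiation of the energy -/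

section EnergyDerivative

variable {n : ℕ}
variable {M : Type*} [TopologicalSpace M] [ChartedSpace (EuclideanSpace ℝ (Fin n)) M]
  [IsManifold (𝓡 n) ∞ M]

local notation "𝔼" => EuclideanSpace ℝ (Fin n)

theorem continuous_deriv_left {F : ℝ × M → ℝ}
    (hF : ContMDiff (𝓘(ℝ, ℝ).prod (𝓡 n)) 𝓘(ℝ, ℝ) ∞ F) :
    Continuous fun z : ℝ × M => deriv (fun t => F (t, z.2)) z.1 := by
  refine continuous_iff_continuousAt.2 fun ⟨t₀, p₀⟩ => ?_
  set k : ℝ × 𝔼 → ℝ := fun z => F (z.1, (extChartAt (𝓡 n) p₀).symm z.2)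
  have hk : ∀ z : ℝ × 𝔼, z.2 ∈ (extChartAt (𝓡 n) p₀).target → ContDiffAt ℝ ∞ k z := by
    intro z hz
    have h1 : ContMDiffAt 𝓘(ℝ, ℝ × 𝔼) (𝓘(ℝ, ℝ).prod (𝓡 n)) ∞
        (fun z : ℝ × 𝔼 => (z.1, (extChartAt (𝓡 n) p₀).symm z.2)) z :=
      ContMDiffAt.prodMk contDiffAt_fst.contMDiffAt
        ((contMDiffAt_symm hz).comp z contDiffAt_snd.contMDiffAt)
    exact (hF.contMDiffAt.comp z h1).contDiffAt
  have hd : ∀ t : ℝ, ∀ p ∈ (extChartAt (𝓡 n) p₀).source,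
      fderiv ℝ k (t, extChartAt (𝓡 n) p₀ p) (1, 0) = deriv (fun t => F (t, p)) t := by
    intro t p hp
    have h1 := ((hk (t, extChartAt (𝓡 n) p₀ p)
      ((extChartAt (𝓡 n) p₀).map_source hp)).differentiableAt (by simp)).hasFDerivAt
    have h2 := h1.comp_hasDerivAt t
      ((hasDerivAt_id t).prodMk (hasDerivAt_const t (extChartAt (𝓡 n) p₀ p)))
    refine (h2.congr_of_eventuallyEq (.of_forall fun s => ?_)).deriv.symm
    simp only [k, Function.comp_apply, id, (extChartAt (𝓡 n) p₀).left_inv hp]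
  have hc : ContinuousAt (fun z : ℝ × M => fderiv ℝ k (z.1, extChartAt (𝓡 n) p₀ z.2) (1, 0))
      (t₀, p₀) := by
    have h1 : ContinuousAt (fun z => fderiv ℝ k z (1, 0)) (t₀, extChartAt (𝓡 n) p₀ p₀) :=
      (((hk _ (mem_extChartAt_target (I := 𝓡 n) p₀)).fderiv_right (m := ∞) (by simp)).clm_apply
        contDiffAt_const).continuousAt
    have h2 : ContinuousAt (fun z : ℝ × M => extChartAt (𝓡 n) p₀ z.2) (t₀, p₀) :=
      ContinuousAt.comp (g := extChartAt (𝓡 n) p₀) (continuousAt_extChartAt p₀) continuousAt_snd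
    exact ContinuousAt.comp (f := fun z : ℝ × M => (z.1, extChartAt (𝓡 n) p₀ z.2)) h1
      (continuousAt_fst.prodMk h2)
  refine hc.congr ?_
  filter_upwards [continuousAt_snd.preimage_mem_nhds
    (extChartAt_source_mem_nhds_of_mem (mem_extChartAt_source (I := 𝓡 n) p₀))] with z hz
  exact hd z.1 z.2 hz

/-- Differentiation under the integral sign over a compact manifold. -/
theorem hasDerivAt_integral_of_contMDiff [CompactSpace M] [MeasurableSpace M] [BorelSpace M]
    (μ : Measure M) [IsFiniteMeasure μ] {F : ℝ → M → ℝ}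
    (hF : ContMDiff (𝓘(ℝ, ℝ).prod (𝓡 n)) 𝓘(ℝ, ℝ) ∞ (fun z : ℝ × M => F z.1 z.2)) :
    HasDerivAt (fun t => ∫ p, F t p ∂μ) (∫ p, deriv (fun t => F t p) 0 ∂μ) 0 := by
  have hFt : ∀ t, Continuous (F t) := fun t =>
    hF.continuous.comp (continuous_const.prodMk continuous_id)
  have hFd : ∀ p, Differentiable ℝ fun t => F t p := by
    intro p
    have h1 : ContMDiff 𝓘(ℝ, ℝ) (𝓘(ℝ, ℝ).prod (𝓡 n)) ∞ fun t : ℝ => (t, p) :=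
      contMDiff_id.prodMk contMDiff_const
    exact (hF.comp h1).contDiff.differentiable (by simp)
  have hD := continuous_deriv_left hF
  have hcpt : IsCompact (Set.Icc (-1 : ℝ) 1 ×ˢ (Set.univ : Set M)) :=
    isCompact_Icc.prod isCompact_univ
  obtain ⟨C, hC⟩ := hcpt.exists_bound_of_continuousOn hD.continuousOn
  have hD0 : Continuous fun p => deriv (fun t => F t p) 0 :=
    hD.comp (continuous_const.prodMk continuous_id)
  exact (hasDerivAt_integral_of_dominated_loc_of_deriv_le
    (μ := μ) (F := F) (F' := fun t p => deriv (fun t => F t p) t) (x₀ := (0 : ℝ))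
    (s := Set.Icc (-1) 1) (bound := fun _ => C) (Icc_mem_nhds (by norm_num) (by norm_num))
    (.of_forall fun t => (hFt t).aestronglyMeasurable)
    ((hFt 0).integrable_of_hasCompactSupport (HasCompactSupport.of_compactSpace _))
    hD0.aestronglyMeasurable (.of_forall fun p t ht => hC (t, p) ⟨ht, trivial⟩)
    (integrable_const C) (.of_forall fun p t _ => (hFd p t).hasDerivAt)).2

variable {N : Type*} [TopologicalSpace N] [ChartedSpace (EuclideanSpace ℝ (Fin n)) N]
  [IsManifold (𝓡 n) ∞ N]
variable {gM : RiemMetric n M} {gN : RiemMetric n N} {h : M ≃ₘ^∞⟮𝓡 n, 𝓡 n⟯ N}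
variable [CompactSpace M] [MeasurableSpace M] [BorelSpace M]

/-- The derivative of the energy along the flow of `Y` is the integral of the first variation
density. -/
theorem hasDerivAt_deformationEnergy {Y : (p : M) → TangentSpace (𝓡 n) p}
    (hY : IsSmoothVectorField Y) {φ : ℝ → M → M} (hφ : IsFlow Y φ) :
    HasDerivAt (fun t => deformationEnergy gM gN fun p => h (φ t p))
      (∫ p, varDensity gM gN h Y p ∂(riemannianVolume gM.inner)) 0 := by
  have := isFiniteMeasure_riemannianVolume gM
  have h1 := hasDerivAt_integral_of_contMDiff (riemannianVolume gM.inner)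
    (F := energyDensity gM gN h φ) fun z =>
      contMDiffAt_energyDensity h.contMDiff (isMetricOn_pullback gN h) hφ.smooth z.1 z.2
  rw [funext fun p => (hasDerivAt_energyDensity h.contMDiff (isMetricOn_pullback gN h) hY hφ
    (mem_extChartAt_source p)).deriv] at h1
  exact h1

variable [T2Space M]

/-- The first variation formula. -/
theorem firstVariation {Y : (p : M) → TangentSpace (𝓡 n) p} (hY : IsSmoothVectorField Y)
    {φ : ℝ → M → M} (hφ : IsFlow Y φ) :
    HasDerivAt (fun t => deformationEnergy gM gN fun p => h (φ t p))
      (-4 * ∫ p, pullback h gN.inner p (eulerLagrangeField gM gN h p) (Y p)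
        ∂(riemannianVolume gM.inner)) 0 := by
  have h1 := hasDerivAt_deformationEnergy (gM := gM) (gN := gN) (h := h) hY hφ
  rw [integral_varDensity hY] at h1
  exact h1

/-- The Euler-Lagrange equation of critical points: the flows of fields supported in a chart domain
suffice as tests. -/
theorem eulerLagrangeField_eq_zero_of_isCriticalPoint (hc : IsCriticalPoint gM gN h) (p : M) :
    eulerLagrangeField gM gN h p = 0 := by
  have h1 := eq_zero_of_integral_tensorForm_eq_zero (gM := gM) (gN := gN) (h := h) (q := p)
    (isOpen_extChartAt_target p) subset_rfl (E := fun p' => elChart gM gN h p p')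
    (fun x hx => continuousAt_dChart_elChart hx ((extChartAt (𝓡 n) p).map_target hx)) ?_
    (mem_extChartAt_target p)
  · rw [extChartAt_to_inv] at h1
    rw [eulerLagrangeField_eq]
    exact h1
  · intro Y K hY hK hKp h0
    have hKq : K ⊆ (extChartAt (𝓡 n) p).source := fun p' hp' => by
      obtain ⟨x, hx, rfl⟩ := hKp hp'
      exact (extChartAt (𝓡 n) p).map_target hx
    obtain ⟨φ, hφ⟩ := exists_isFlow hY hK hKq h0
    have h2 := (hasDerivAt_deformationEnergy (gM := gM) (gN := gN) (h := h) hY hφ).unique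
      (hc Y hY φ hφ)
    rw [integral_varDensity_chart hY hK hKq h0] at h2
    linarith

end EnergyDerivative

end MinimalBending

theorem mainTheorem7 (n : ℕ)
    (M : Type*) [TopologicalSpace M] [T2Space M] [CompactSpace M]
    [ChartedSpace (EuclideanSpace ℝ (Fin n)) M] [IsManifold (𝓡 n) ∞ M]
    [MeasurableSpace M] [BorelSpace M]
    (N : Type*) [TopologicalSpace N] [T2Space N] [CompactSpace N]
    [ChartedSpace (EuclideanSpace ℝ (Fin n)) N] [IsManifold (𝓡 n) ∞ N]
    (gM : MinimalBending.RiemMetric n M) (gN : MinimalBending.RiemMetric n N)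
    (h : M ≃ₘ^∞⟮𝓡 n, 𝓡 n⟯ N) :
    (∀ Y : (p : M) → TangentSpace (𝓡 n) p, MinimalBending.IsSmoothVectorField Y →
      ∀ φ : ℝ → M → M, MinimalBending.IsFlow Y φ →
        HasDerivAt (fun t => MinimalBending.deformationEnergy gM gN (fun p => h (φ t p)))
          (-4 * ∫ p, MinimalBending.pullback h gN.inner p
              (MinimalBending.eulerLagrangeField gM gN h p) (Y p)
            ∂(MinimalBending.riemannianVolume gM.inner)) 0) ∧
    (MinimalBending.IsCriticalPoint gM gN h ↔
      ∀ p : M, MinimalBending.eulerLagrangeField gM gN h p = 0) := by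
  refine ⟨fun Y hY φ hφ => MinimalBending.firstVariation hY hφ,
    MinimalBending.eulerLagrangeField_eq_zero_of_isCriticalPoint, fun h0 Y hY φ hφ => ?_⟩
  have h1 := MinimalBending.firstVariation (gM := gM) (gN := gN) (h := h) hY hφ
  simpa [h0] using h1
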